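/- Let $k$ be a field of arbitrary characteristic. **Conventions.** $\mathcal T_{\widehat\otimes}$ is the category of topological $k[[h]]$-modules isomorphic to $V[[h]]$ for a $k$-vector space $V$, with the $h$-adic topology; $\widehat\otimes$ is the $h$-adically completed tensor product. $\mathcal P_{\widetilde\otimes}$ is the category of topological $k[[h]]$-modules isomorphic to $k[[h]]^E$ for a set $E$, with the product of the $h$-adic topologies (the weak topology); $\widetilde\otimes$ is the tensor product completed for the weak topology, so that $k[[h]]^E\,\widetilde\otimes\,k[[h]]^{E'}=k[[h]]^{E\times E'}$. Let $\mathfrak g$ be a finite-dimensional Lie bialgebra over $k$ with cobracket $\delta$; the dual Lie bialgebra $\mathfrak g^*$ has as bracket the transpose of $\delta$ and as cobracket the transpose of the bracket of $\mathfrak g$. * A *QUEA with semiclassical limit $U(\mathfrak g)$* is a Hopf algebra $H$ in $\mathcal T_{\widehat\otimes}$ such that $H/hH$, with the Poisson cobracket induced by $h^{-1}(\Delta-\Delta^{\mathrm{op}})$, is isomorphic as a co-Poisson Hopf algebra to $U(\mathfrak g)$, with the cobracket extending $\delta$. * A *QFSHA with semiclassical limit $F[[\mathfrak g]]$* is a Hopf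 algebra $F_h$ in $\mathcal P_{\widetilde\otimes}$ such that $F_h/hF_h$, with the Poisson bracket induced by $h^{-1}(ab-ba)$, is the topological Poisson Hopf algebra $F[[\mathfrak g]]$ of functions on a formal Poisson group with tangent Lie bialgebra $\mathfrak g$. That is, $F_h/hF_h\cong k[[\bar x_1,\dots,\bar x_n]]$ as a topological $k$-algebra for some $n$, and $\mathfrak g$ is identified with $(\mathfrak m/\mathfrak m^2)^*$ (the derivations at the counit; $\mathfrak m$ is the augmentation ideal of $F_h/hF_h$) in such a way that $\langle a,[u,v]\rangle=\langle\Delta(a),u\otimes v-v\otimes u\rangle$ and $\langle\{a,b\},u\rangle=\langle a\otimes b,\delta(u)\rangle$ for $u,v\in\mathfrak g$. * For a Hopf algebra $F_h$ in $\mathcal P_{\widetilde\otimes}$ with counit $\epsilon$, put $I=\epsilon^{-1}(h\,k[[h]])$, let $F_h^\times=\sum_{n\ge0}h^{-n}I^n$ be the $k[[h]]$-subalgebra of $k((h))\otimes_{k[[h]]}F_h$ generated by $h^{-1}I$, and let $F_h^\vee$ be the $h$-adic completion of $F_h^\times$, with the $h$-adic topology. **Proposition 3.2.** Let $F_h$ be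 a QFSHA with semiclassical limit $F[[\mathfrak g]]$. Then the algebra $F_h^\vee$ carries a structure of Hopf algebra in $\mathcal T_{\widehat\otimes}$ for which the canonical map $F_h\to F_h^\vee$ is a morphism of topological Hopf algebras, and with this structure $F_h^\vee$ is a QUEA with semiclassical limit $U(\mathfrak g^*)$: $$F_h^\vee/hF_h^\vee\;\cong\;U(\mathfrak g^*)\quad\text{as co-Poisson Hopf algebras.}$$ Moreover, if $F_h/hF_h\cong k[[\bar x_1,\dots,\bar x_n]]$ is any isomorphism of topological $k$-algebras and $x_j\in F_h$ is any lift of $\bar x_j$ ($1\le j\le n$), then there are elements $\check x_j=h^{-1}x_j$ in $F_h^\vee$, and $$F_h^\vee=k[\check x_1,\dots,\check x_n][[h]]$$ as topological $k[[h]]$-modules: the map $\sum_m P_m h^m\mapsto\sum_m P_m(\check x_1,\dots,\check x_n)\,h^m$, where the monomials are evaluated in the order $\check x_1^{d_1}\cdots\check x_n^{d_n}$, is a $k[[h]]$-linear isomorphism of $k[X_1,\dots,X_n][[h]]$ onto $F_h^\vee$. -/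

import Mathlib

open scoped TensorProduct PowerSeries Topology

noncomputable section

universe u v w

namespace QuantumDuality

/-! ### Lie bialgebras and their duals -/

section LieBialgebra

variable (k : Type u) (g : Type v) [Field k] [LieRing g] [LieAlgebra k g]

/-- For `p, q` linear forms on `g`, the linear form `p ⊗ q` on `g ⊗ g`. -/
def tensorForm {k : Type u} {V : Type v} [Field k] [AddCommGroup V] [Module k V]
    (p q : V →ₗ[k] k) : V ⊗[k] V →ₗ[k] k :=
  LinearMap.mul' k k ∘ₗ TensorProduct.map p q

@[simp] theorem tensorForm_tmul {k : Type u} {V : Type v} [Field k] [AddCommGroup V] [Module k V]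
    (p q : V →ₗ[k] k) (a b : V) : tensorForm p q (a ⊗ₜ b) = p a * q b := by
  simp [tensorForm]

theorem tensorForm_add_left {k : Type u} {V : Type v} [Field k] [AddCommGroup V] [Module k V]
    (p p' q : V →ₗ[k] k) :
    tensorForm (p + p') q = tensorForm p q + tensorForm p' q := by
  ext; simp [add_mul]

theorem tensorForm_add_right {k : Type u} {V : Type v} [Field k] [AddCommGroup V] [Module k V]
    (p q q' : V →ₗ[k] k) :
    tensorForm p (q + q') = tensorForm p q + tensorForm p q' := by
  ext; simp [mul_add]

theorem tensorForm_smul_left {k : Type u} {V : Type v} [Field k] [AddCommGroup V] [Module k V]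
    (c : k) (p q : V →ₗ[k] k) :
    tensorForm (c • p) q = c • tensorForm p q := by
  ext; simp [mul_assoc]

theorem tensorForm_smul_right {k : Type u} {V : Type v} [Field k] [AddCommGroup V] [Module k V]
    (c : k) (p q : V →ₗ[k] k) :
    tensorForm p (c • q) = c • tensorForm p q := by
  ext; simp [mul_left_comm]

/-- The transpose `g* × g* → g*` of a linear map `δ : g → g ⊗ g`. -/
def transposeBracket {k : Type u} {g : Type v} [Field k] [AddCommGroup g] [Module k g]
    (δ : g →ₗ[k] g ⊗[k] g) (p q : g →ₗ[k] k) : g →ₗ[k] k :=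
  tensorForm p q ∘ₗ δ

theorem tensorForm_lie {k : Type u} {g : Type v} [Field k] [LieRing g] [LieAlgebra k g]
    (p q : g →ₗ[k] k) (x : g) (s : g ⊗[k] g) :
    tensorForm p q ⁅x, s⁆ = tensorForm (p ∘ₗ (LieAlgebra.ad k g x : g →ₗ[k] g)) q s
      + tensorForm p (q ∘ₗ (LieAlgebra.ad k g x : g →ₗ[k] g)) s := by
  induction s with
  | zero => simp
  | add s t hs ht => rw [lie_add, map_add, map_add, map_add, hs, ht]; abel
  | tmul a b => simp [TensorProduct.LieModule.lie_tmul_right]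

/-- A Lie bialgebra: a Lie algebra `g` with a cobracket `δ : g → g ⊗ g` which is a Lie cobracket
(i.e. its transpose is alternating and satisfies the Jacobi identity) and a 1-cocycle for the
adjoint action of `g` on `g ⊗ g`. -/
class LieBialgebra where
  cobracket : g →ₗ[k] g ⊗[k] g
  alternating : ∀ p : g →ₗ[k] k, transposeBracket cobracket p p = 0
  coJacobi : ∀ p q r : g →ₗ[k] k,
    transposeBracket cobracket p (transposeBracket cobracket q r)
      + transposeBracket cobracket q (transposeBracket cobracket r p)
      + transposeBracket cobracket r (transposeBracket cobracket p q) = 0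
  cocycle : ∀ x y : g, cobracket ⁅x, y⁆ = ⁅x, cobracket y⁆ - ⁅y, cobracket x⁆

/-- The dual space `g*`, as carrier of the dual Lie bialgebra structure. -/
def LieDual : Type (max u v) := Module.Dual k g

namespace LieDual

instance : AddCommGroup (LieDual k g) := inferInstanceAs (AddCommGroup (Module.Dual k g))
instance : Module k (LieDual k g) := inferInstanceAs (Module k (Module.Dual k g))
instance [Module.Finite k g] : Module.Finite k (LieDual k g) :=
  inferInstanceAs (Module.Finite k (Module.Dual k g))

variable {k g}

/-- An element of `g*` as a linear form. -/
def form (f : LieDual k g) : g →ₗ[k] k := f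

/-- A linear form as an element of `g*`. -/
def ofForm (f : g →ₗ[k] k) : LieDual k g := f

theorem ext' {f f' : LieDual k g} (h : ∀ x, f.form x = f'.form x) : f = f' :=
  LinearMap.ext h

@[simp] theorem form_add (f f' : LieDual k g) : (f + f').form = f.form + f'.form := rfl
@[simp] theorem form_smul (c : k) (f : LieDual k g) : (c • f).form = c • f.form := rfl
@[simp] theorem form_zero : (0 : LieDual k g).form = 0 := rfl

/-- The linear form on `g ⊗ g` attached to an element of `g* ⊗ g*`. -/
def pairing [Module.Finite k g] : LieDual k g ⊗[k] LieDual k g →ₗ[k] Module.Dual k (g ⊗[k] g) :=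
  (TensorProduct.dualDistribEquiv k g g).toLinearMap

theorem pairing_injective [Module.Finite k g] : Function.Injective (pairing (k := k) (g := g)) :=
  (TensorProduct.dualDistribEquiv k g g).injective

theorem pairing_tmul [Module.Finite k g] (a b : LieDual k g) (x y : g) :
    pairing (a ⊗ₜ[k] b) (x ⊗ₜ y) = a.form x * b.form y := rfl

/-- Evaluation at `x : g`, as a linear form on `g*`. -/
def evalAt (x : g) : LieDual k g →ₗ[k] k where
  toFun f := f.form x
  map_add' _ _ := rfl
  map_smul' _ _ := rfl

@[simp] theorem evalAt_apply (x : g) (f : LieDual k g) : evalAt x f = f.form x := rfl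

theorem tensorForm_evalAt [Module.Finite k g] (x y : g) (s : LieDual k g ⊗[k] LieDual k g) :
    tensorForm (evalAt x) (evalAt y) s = pairing s (x ⊗ₜ[k] y) := by
  induction s with
  | zero => simp
  | add s t hs ht => rw [map_add, map_add, hs, ht]; rfl
  | tmul a b => rw [tensorForm_tmul, pairing_tmul]; rfl

theorem exists_evalAt [Module.Finite k g] (p : LieDual k g →ₗ[k] k) :
    ∃ x : g, p = evalAt x :=
  ⟨(Module.evalEquiv k g).symm p, ((Module.evalEquiv k g).apply_symm_apply p).symm⟩

/-- The cobracket of `g*` is the transpose of the Lie bracket of `g`: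
`⟨δ(f), x ⊗ y⟩ = f([x, y])`. -/
def cobracket [Module.Finite k g] : LieDual k g →ₗ[k] LieDual k g ⊗[k] LieDual k g :=
  (TensorProduct.dualDistribEquiv k g g).symm.toLinearMap ∘ₗ
    (LinearMap.lcomp k k (LieModule.toModuleHom k g g : g ⊗[k] g →ₗ[k] g) :
      Module.Dual k g →ₗ[k] Module.Dual k (g ⊗[k] g))

theorem pairing_cobracket [Module.Finite k g] (f : LieDual k g) (x y : g) :
    pairing (cobracket f) (x ⊗ₜ[k] y) = f.form ⁅x, y⁆ := by
  have : pairing (cobracket f) = f.form ∘ₗ (LieModule.toModuleHom k g g : g ⊗[k] g →ₗ[k] g) :=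
    (TensorProduct.dualDistribEquiv k g g).apply_symm_apply _
  rw [this]
  rfl

theorem transposeBracket_cobracket [Module.Finite k g] (x y : g) :
    transposeBracket (k := k) (g := LieDual k g) cobracket
      (evalAt x) (evalAt y) = evalAt ⁅x, y⁆ := by
  refine LinearMap.ext fun f => ?_
  exact (tensorForm_evalAt x y (cobracket f)).trans (pairing_cobracket f x y)

variable [LieBialgebra k g]

/-- The Lie bracket of `g*` is the transpose of the cobracket of `g`. -/
instance : Bracket (LieDual k g) (LieDual k g) :=
  ⟨fun f f' => ofForm (transposeBracket (LieBialgebra.cobracket (k := k) (g := g)) f.form f'.form)⟩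

theorem lie_form (f f' : LieDual k g) :
    (⁅f, f'⁆ : LieDual k g).form
      = transposeBracket (LieBialgebra.cobracket (k := k) (g := g)) f.form f'.form := rfl

theorem lie_form_apply (f f' : LieDual k g) (x : g) :
    (⁅f, f'⁆ : LieDual k g).form x
      = tensorForm f.form f'.form (LieBialgebra.cobracket (k := k) (g := g) x) := rfl

theorem tensorForm_self (p : g →ₗ[k] k) (x : g) :
    tensorForm p p (LieBialgebra.cobracket (k := k) (g := g) x) = 0 :=
  LinearMap.congr_fun (LieBialgebra.alternating (k := k) (g := g) p) x

theorem tensorForm_skew (p q : g →ₗ[k] k) (x : g) :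
    tensorForm p q (LieBialgebra.cobracket (k := k) (g := g) x)
      = - tensorForm q p (LieBialgebra.cobracket (k := k) (g := g) x) := by
  have h := tensorForm_self (p + q) x
  rw [tensorForm_add_left, tensorForm_add_right, tensorForm_add_right] at h
  simp only [LinearMap.add_apply, tensorForm_self, zero_add, add_zero] at h
  exact eq_neg_of_add_eq_zero_left h

theorem lie_skew' (f f' : LieDual k g) : ⁅f, f'⁆ = -⁅f', f⁆ :=
  ext' fun x => tensorForm_skew f.form f'.form x

instance : LieRing (LieDual k g) where
  add_lie f f' f'' := ext' fun x => by
    simp [lie_form_apply, tensorForm_add_left]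
  lie_add f f' f'' := ext' fun x => by
    simp [lie_form_apply, tensorForm_add_right]
  lie_self f := ext' fun x => by
    rw [lie_form_apply, tensorForm_self]; rfl
  leibniz_lie f f' f'' := by
    have h : ⁅f, ⁅f', f''⁆⁆ + ⁅f', ⁅f'', f⁆⁆ + ⁅f'', ⁅f, f'⁆⁆ = 0 :=
      LieBialgebra.coJacobi (k := k) (g := g) f.form f'.form f''.form
    have h1 : ⁅f'', ⁅f, f'⁆⁆ = -⁅⁅f, f'⁆, f''⁆ := lie_skew' _ _
    have h2 : ⁅f', ⁅f'', f⁆⁆ = -⁅f', ⁅f, f''⁆⁆ := by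
      rw [lie_skew' f'' f]
      refine ext' fun x => ?_
      have : (-⁅f, f''⁆ : LieDual k g) = (-1 : k) • ⁅f, f''⁆ := by simp
      rw [this, lie_form_apply, form_smul, tensorForm_smul_right]
      have h3 : (-⁅f', ⁅f, f''⁆⁆ : LieDual k g) = (-1 : k) • ⁅f', ⁅f, f''⁆⁆ := by simp
      rw [h3, form_smul]; rfl
    rw [h1, h2] at h
    have := eq_neg_of_add_eq_zero_left h
    rw [neg_neg] at this
    rw [← this]; abel

instance : LieAlgebra k (LieDual k g) where
  lie_smul c f f' := ext' fun x => by
    simp [lie_form_apply, tensorForm_smul_right]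

variable [Module.Finite k g]

theorem pairing_lie (f : LieDual k g) (s : LieDual k g ⊗[k] LieDual k g) (x y : g) :
    pairing ⁅f, s⁆ (x ⊗ₜ[k] y)
      = tensorForm f.form (pairing s ∘ₗ (TensorProduct.mk k g g).flip y)
          (LieBialgebra.cobracket (k := k) x)
        + tensorForm f.form (pairing s ∘ₗ TensorProduct.mk k g g x)
          (LieBialgebra.cobracket (k := k) y) := by
  induction s with
  | zero =>
    rw [lie_zero, map_zero, LinearMap.zero_comp, LinearMap.zero_comp]
    have : tensorForm f.form (0 : g →ₗ[k] k) = 0 := by ext; simp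
    simp [this]
  | add s t hs ht =>
    rw [lie_add, map_add, map_add, LinearMap.add_apply, hs, ht, LinearMap.add_comp,
      LinearMap.add_comp, tensorForm_add_right, tensorForm_add_right, LinearMap.add_apply,
      LinearMap.add_apply]
    abel
  | tmul a b =>
    have h1 : (pairing (a ⊗ₜ[k] b) ∘ₗ (TensorProduct.mk k g g).flip y) = b.form y • a.form := by
      ext z; simp [pairing_tmul, mul_comm]
    have h2 : (pairing (a ⊗ₜ[k] b) ∘ₗ (TensorProduct.mk k g g x)) = a.form x • b.form := by
      ext z; simp [pairing_tmul]
    rw [h1, h2, tensorForm_smul_right, tensorForm_smul_right,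
      TensorProduct.LieModule.lie_tmul_right, map_add, LinearMap.add_apply, pairing_tmul,
      pairing_tmul, lie_form_apply, lie_form_apply]
    simp [mul_comm]

/-- The dual Lie bialgebra of a finite dimensional Lie bialgebra. -/
instance : LieBialgebra k (LieDual k g) where
  cobracket := cobracket
  alternating p := by
    obtain ⟨x, rfl⟩ := exists_evalAt p
    rw [transposeBracket_cobracket, lie_self]
    exact LinearMap.ext fun f => map_zero f.form
  coJacobi p q r := by
    obtain ⟨x, rfl⟩ := exists_evalAt p
    obtain ⟨y, rfl⟩ := exists_evalAt q
    obtain ⟨z, rfl⟩ := exists_evalAt r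
    simp only [transposeBracket_cobracket]
    refine LinearMap.ext fun f => ?_
    have := congrArg f.form (lie_jacobi x y z)
    rw [map_add, map_add, map_zero] at this
    exact this
  cocycle f f' := by
    apply pairing_injective
    refine TensorProduct.ext' fun x y => ?_
    rw [map_sub, LinearMap.sub_apply, pairing_cobracket, pairing_lie, pairing_lie, lie_form_apply,
      LieBialgebra.cocycle, map_sub, tensorForm_lie, tensorForm_lie]
    have h1 : ∀ f : LieDual k g, (pairing (cobracket f) ∘ₗ (TensorProduct.mk k g g).flip y)
        = -(f.form ∘ₗ (LieAlgebra.ad k g y : g →ₗ[k] g)) := by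
      intro f; ext z
      have : pairing (cobracket f) (z ⊗ₜ[k] y) = -f.form ⁅y, z⁆ := by
        rw [pairing_cobracket, ← lie_skew, map_neg]
      simpa using this
    have h2 : ∀ f : LieDual k g, (pairing (cobracket f) ∘ₗ (TensorProduct.mk k g g x))
        = (f.form ∘ₗ (LieAlgebra.ad k g x : g →ₗ[k] g)) := by
      intro f; ext z
      simpa using pairing_cobracket f x z
    have hneg : ∀ p q : g →ₗ[k] k, tensorForm p (-q) = - tensorForm p q := by
      intro p q; ext; simp
    simp only [h1, h2, hneg, LinearMap.neg_apply]
    rw [tensorForm_skew (f.form ∘ₗ (LieAlgebra.ad k g x : g →ₗ[k] g)) f'.form y,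
      tensorForm_skew (f.form ∘ₗ (LieAlgebra.ad k g y : g →ₗ[k] g)) f'.form x]
    ring

end LieDual

end LieBialgebra

/-! ### The universal enveloping algebra as a bialgebra -/

section Enveloping

variable (k : Type u) (g : Type v) [Field k] [LieRing g] [LieAlgebra k g]

attribute [local instance 100] LieRing.ofAssociativeRing

/-- The Lie algebra map `x ↦ x ⊗ 1 + 1 ⊗ x` from `g` to `U(g) ⊗ U(g)`. -/
def envComulLie : g →ₗ⁅k⁆
    UniversalEnvelopingAlgebra k g ⊗[k] UniversalEnvelopingAlgebra k g where
  toFun x := UniversalEnvelopingAlgebra.ι k x ⊗ₜ 1 + 1 ⊗ₜ UniversalEnvelopingAlgebra.ι k x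
  map_add' x y := by
    rw [map_add, TensorProduct.add_tmul, TensorProduct.tmul_add]; abel
  map_smul' c x := by
    rw [map_smul, ← TensorProduct.smul_tmul', TensorProduct.tmul_smul, RingHom.id_apply, smul_add]
  map_lie' := by
    intro x y
    simp only [LieHom.map_lie, LieRing.of_associative_ring_bracket, mul_add, add_mul,
      Algebra.TensorProduct.tmul_mul_tmul, mul_one, one_mul, TensorProduct.sub_tmul,
      TensorProduct.tmul_sub]
    abel

/-- The coproduct of `U(g)`: the algebra map with `Δ(x) = x ⊗ 1 + 1 ⊗ x` for `x ∈ g`. -/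
def envComul : UniversalEnvelopingAlgebra k g →ₐ[k]
    UniversalEnvelopingAlgebra k g ⊗[k] UniversalEnvelopingAlgebra k g :=
  UniversalEnvelopingAlgebra.lift k (envComulLie k g)

/-- The counit of `U(g)`: the algebra map with `ε(x) = 0` for `x ∈ g`. -/
def envCounit : UniversalEnvelopingAlgebra k g →ₐ[k] k :=
  UniversalEnvelopingAlgebra.lift k (0 : g →ₗ⁅k⁆ k)

/-- The canonical map `g → U(g)`, as a linear map. -/
def envIncl : g →ₗ[k] UniversalEnvelopingAlgebra k g :=
  (UniversalEnvelopingAlgebra.ι k : g →ₗ⁅k⁆ UniversalEnvelopingAlgebra k g)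

end Enveloping

/-! ### Topological modules over `k[[h]]`

The indeterminate `h` is `PowerSeries.X : k⟦X⟧`. -/

section Modules

/-- The `h`-adic topology of a `k[[h]]`-module. -/
abbrev hAdicTopology (k : Type u) [Field k] (M : Type v) [AddCommGroup M] [Module k⟦X⟧ M] :
    TopologicalSpace M :=
  (Ideal.span {(PowerSeries.X : k⟦X⟧)}).adicModuleTopology M

/-- `V[[h]]`: formal power series `∑ hⁿ vₙ` with coefficients in a `k`-vector space `V`. -/
def FormalSeries (V : Type v) : Type v := ℕ → V

namespace FormalSeries

/-- The coefficient of `hⁿ`. -/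
def coeff {V : Type v} (f : FormalSeries V) (n : ℕ) : V := f n

theorem ext' {V : Type v} {f f' : FormalSeries V} (h : ∀ n, f.coeff n = f'.coeff n) : f = f' :=
  funext h

variable {k : Type u} {V : Type v} [Field k] [AddCommGroup V] [Module k V]

instance : AddCommGroup (FormalSeries V) := inferInstanceAs (AddCommGroup (ℕ → V))

instance : SMul k⟦X⟧ (FormalSeries V) :=
  ⟨fun r f n => ∑ p ∈ Finset.HasAntidiagonal.antidiagonal n, PowerSeries.coeff p.1 r • f.coeff p.2⟩

theorem coeff_smul (r : k⟦X⟧) (f : FormalSeries V) (n : ℕ) :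
    (r • f).coeff n = ∑ p ∈ Finset.HasAntidiagonal.antidiagonal n, PowerSeries.coeff p.1 r • f.coeff p.2 := rfl

theorem coeff_add (f f' : FormalSeries V) (n : ℕ) :
    (f + f').coeff n = f.coeff n + f'.coeff n := rfl

theorem coeff_zero (n : ℕ) : (0 : FormalSeries V).coeff n = 0 := rfl

instance : Module k⟦X⟧ (FormalSeries V) where
  one_smul f := ext' fun n => by
    rw [coeff_smul, Finset.sum_eq_single (0, n)]
    · simp
    · rintro ⟨i, j⟩ h hne
      have : i ≠ 0 := by
        rintro rfl
        exact hne (by simpa using h)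
      simp [PowerSeries.coeff_one, this]
    · simp
  mul_smul r s f := ext' fun n => by
    simp only [coeff_smul, PowerSeries.coeff_mul, Finset.sum_smul, Finset.smul_sum, mul_smul]
    rw [Finset.sum_sigma', Finset.sum_sigma']
    exact Finset.sum_nbij' (fun ⟨⟨_, j⟩, ⟨a, b⟩⟩ => ⟨(a, b + j), (b, j)⟩)
      (fun ⟨⟨a, _⟩, ⟨b, j⟩⟩ => ⟨(a + b, j), (a, b)⟩)
      (by simp only [Finset.mem_sigma, Finset.HasAntidiagonal.mem_antidiagonal]; grind)
      (by simp only [Finset.mem_sigma, Finset.HasAntidiagonal.mem_antidiagonal]; grind)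
      (by simp only [Finset.mem_sigma, Finset.HasAntidiagonal.mem_antidiagonal]; grind)
      (by simp only [Finset.mem_sigma, Finset.HasAntidiagonal.mem_antidiagonal]; grind)
      (by simp)
  smul_zero r := ext' fun n => by simp [coeff_smul, coeff_zero]
  smul_add r f f' := ext' fun n => by
    simp [coeff_smul, coeff_add, Finset.sum_add_distrib]
  add_smul r s f := ext' fun n => by
    simp [coeff_smul, coeff_add, Finset.sum_add_distrib, add_smul]
  zero_smul f := ext' fun n => by simp [coeff_smul, coeff_zero]

end FormalSeries

/-- Topologically free modules (the objects of `𝒯`): isomorphic to `V[[h]]` for a `k`-vector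
space `V`, with the `h`-adic topology. -/
def IsTopologicallyFree (k : Type u) [Field k] (M : Type v) [AddCommGroup M] [Module k⟦X⟧ M]
    [t : TopologicalSpace M] : Prop :=
  t = hAdicTopology k M ∧
    ∃ (V : Type v) (_ : AddCommGroup V) (_ : Module k V), Nonempty (M ≃ₗ[k⟦X⟧] FormalSeries V)

/-- The objects of `𝒫`: topological modules isomorphic to `k[[h]]^E` for a set `E`, with the
product of the `h`-adic topologies. -/
def IsWeakProduct (k : Type u) [Field k] (M : Type v) [AddCommGroup M] [Module k⟦X⟧ M]
    [t : TopologicalSpace M] : Prop :=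
  ∃ (E : Type v) (e : M ≃ₗ[k⟦X⟧] (E → k⟦X⟧)),
    t = TopologicalSpace.induced e (@Pi.topologicalSpace E _ fun _ => hAdicTopology k k⟦X⟧)

end Modules

/-! ### Completed tensor squares and topological Hopf algebras -/

/-- Open two-sided ideals of a topological ring. -/
structure OpenIdeal (H : Type v) [Ring H] [TopologicalSpace H] where
  toIdeal : Ideal H
  isTwoSided : toIdeal.IsTwoSided
  isOpen : IsOpen (toIdeal : Set H)

attribute [instance] OpenIdeal.isTwoSided

section Hopf

variable (k : Type u) (H : Type v) [Field k] [Ring H] [Algebra k⟦X⟧ H] [TopologicalSpace H]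

/-- The completed tensor square of a `k[[h]]`-algebra whose topology is linear (given by open
two-sided ideals): the inverse limit of the algebras `H/I ⊗ H/J` over the open two-sided ideals
`I, J`. If `H` is an object of `𝒯`, this is the `h`-adic completion of `H ⊗ H`; if `H` is an
object of `𝒫`, this is the completion of `H ⊗ H` for the weak topology,
i.e. `k[[h]]^(E × E)` for `H = k[[h]]^E`. -/
def CompletedTensor : Subalgebra k⟦X⟧
    (∀ p : OpenIdeal H × OpenIdeal H, (H ⧸ p.1.toIdeal) ⊗[k⟦X⟧] (H ⧸ p.2.toIdeal)) where
  carrier := {c | ∀ (p q : OpenIdeal H × OpenIdeal H) (h₁ : p.1.toIdeal ≤ q.1.toIdeal)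
    (h₂ : p.2.toIdeal ≤ q.2.toIdeal),
    Algebra.TensorProduct.map (Ideal.Quotient.factorₐ k⟦X⟧ h₁) (Ideal.Quotient.factorₐ k⟦X⟧ h₂)
      (c p) = c q}
  mul_mem' ha hb p q h₁ h₂ := by
    rw [Pi.mul_apply, map_mul, ha p q h₁ h₂, hb p q h₁ h₂]; rfl
  add_mem' ha hb p q h₁ h₂ := by
    rw [Pi.add_apply, map_add, ha p q h₁ h₂, hb p q h₁ h₂]; rfl
  algebraMap_mem' r p q h₁ h₂ := by
    rw [Pi.algebraMap_apply, AlgHom.commutes]; rfl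

variable {k H}

/-- The class of an element of `H` modulo an open ideal. -/
def OpenIdeal.cls (I : OpenIdeal H) (a : H) : H ⧸ I.toIdeal := Ideal.Quotient.mk I.toIdeal a

/-- The component in `H/I ⊗ H/J` of an element of the completed tensor square. -/
def component (c : CompletedTensor k H) (I J : OpenIdeal H) :
    (H ⧸ I.toIdeal) ⊗[k⟦X⟧] (H ⧸ J.toIdeal) :=
  c.1 (I, J)

/-- The finite sum `∑ uᵢ ⊗ vᵢ` approximates `c ∈ H ⊗̂ H` modulo `I ⊗ H + H ⊗ J`. -/
def Approximates {N : ℕ} (u v : Fin N → H) (c : CompletedTensor k H) (I J : OpenIdeal H) : Prop :=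
  component c I J = ∑ i, I.cls (u i) ⊗ₜ[k⟦X⟧] J.cls (v i)

variable (k H)

/-- The data and the axioms of a Hopf algebra, in the sense of complete topological
`k[[h]]`-modules, on a topological `k[[h]]`-algebra `H`.

The topology is required to have a basis of open two-sided ideals at `0`; this says that the
multiplication extends to a continuous linear map from the completed tensor square to `H`.
The structure maps are continuous and `Δ` takes its values in the completed tensor square. The Hopf
algebra axioms are identities in complete modules, i.e. inverse limits of discrete quotients; they
are stated in each of these quotients, where the infinite sums `∑ a₍₁₎ ⊗ a₍₂₎` become finite. -/
structure TopologicalHopfAlgebra where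
  ideal_basis : ∀ U ∈ 𝓝 (0 : H), ∃ I : OpenIdeal H, (I.toIdeal : Set H) ⊆ U
  comul : H →ₐ[k⟦X⟧] CompletedTensor k H
  counit : H →ₐ[k⟦X⟧] k⟦X⟧
  antipode : H →ₗ[k⟦X⟧] H
  comul_continuous : ∀ I J : OpenIdeal H, IsOpen {a | component (comul a) I J = 0}
  counit_continuous : Continuous[_, hAdicTopology k k⟦X⟧] counit
  antipode_continuous : Continuous antipode
  /-- `(Δ ⊗ id) Δ(a) = (id ⊗ Δ) Δ(a)`, in `H/I ⊗ H/J ⊗ H/L`. -/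
  coassoc : ∀ I J L P Q : OpenIdeal H,
    (∀ b ∈ P.toIdeal, component (comul b) I J = 0) → (∀ b ∈ Q.toIdeal, component (comul b) J L = 0) →
    ∀ (a : H) (M N : ℕ) (u v : Fin M → H) (u' v' : Fin N → H),
      Approximates u v (comul a) P L → Approximates u' v' (comul a) I Q →
      TensorProduct.assoc k⟦X⟧ _ _ _ (∑ i, component (comul (u i)) I J ⊗ₜ[k⟦X⟧] L.cls (v i))
        = ∑ i, I.cls (u' i) ⊗ₜ[k⟦X⟧] component (comul (v' i)) J L
  /-- `(ε ⊗ id) Δ(a) = a`, in `H/J`. -/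
  counit_left : ∀ I J : OpenIdeal H,
    (∀ b ∈ I.toIdeal, algebraMap k⟦X⟧ H (counit b) ∈ J.toIdeal) →
    ∀ (a : H) (N : ℕ) (u v : Fin N → H), Approximates u v (comul a) I J →
      J.cls (∑ i, counit (u i) • v i) = J.cls a
  /-- `(id ⊗ ε) Δ(a) = a`, in `H/I`. -/
  counit_right : ∀ I J : OpenIdeal H,
    (∀ b ∈ J.toIdeal, algebraMap k⟦X⟧ H (counit b) ∈ I.toIdeal) →
    ∀ (a : H) (N : ℕ) (u v : Fin N → H), Approximates u v (comul a) I J →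
      I.cls (∑ i, counit (v i) • u i) = I.cls a
  /-- `m (S ⊗ id) Δ(a) = ε(a) 1`, in `H/L`. -/
  antipode_left : ∀ I J L : OpenIdeal H,
    (∀ b ∈ I.toIdeal, antipode b ∈ L.toIdeal) → J.toIdeal ≤ L.toIdeal →
    ∀ (a : H) (N : ℕ) (u v : Fin N → H), Approximates u v (comul a) I J →
      L.cls (∑ i, antipode (u i) * v i) = L.cls (algebraMap k⟦X⟧ H (counit a))
  /-- `m (id ⊗ S) Δ(a) = ε(a) 1`, in `H/L`. -/
  antipode_right : ∀ I J L : OpenIdeal H,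
    I.toIdeal ≤ L.toIdeal → (∀ b ∈ J.toIdeal, antipode b ∈ L.toIdeal) →
    ∀ (a : H) (N : ℕ) (u v : Fin N → H), Approximates u v (comul a) I J →
      L.cls (∑ i, u i * antipode (v i)) = L.cls (algebraMap k⟦X⟧ H (counit a))

variable {k H}

/-- Morphisms of topological Hopf algebras: continuous algebra maps `f` with
`Δ' ∘ f = (f ⊗̂ f) ∘ Δ`, `ε' ∘ f = ε` and `S' ∘ f = f ∘ S`. -/
structure IsHopfMorphism {H' : Type w} [Ring H'] [Algebra k⟦X⟧ H'] [TopologicalSpace H']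
    (T : TopologicalHopfAlgebra k H) (T' : TopologicalHopfAlgebra k H') (f : H →ₐ[k⟦X⟧] H') :
    Prop where
  continuous : Continuous f
  map_comul : ∀ (P Q : OpenIdeal H') (I J : OpenIdeal H),
    (∀ b ∈ I.toIdeal, f b ∈ P.toIdeal) → (∀ b ∈ J.toIdeal, f b ∈ Q.toIdeal) →
    ∀ (a : H) (N : ℕ) (u v : Fin N → H), Approximates u v (T.comul a) I J →
      Approximates (f ∘ u) (f ∘ v) (T'.comul (f a)) P Q
  map_counit : ∀ a, T'.counit (f a) = T.counit a
  map_antipode : ∀ a, T'.antipode (f a) = f (T.antipode a)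

end Hopf

/-! ### Adic completion and the functor `H ↦ H^∨` -/

section Completion

variable (k : Type u) (A : Type v) [Field k] [Ring A] [Algebra k⟦X⟧ A]

/-- The two-sided ideal `hⁿ A`. -/
def hPow (n : ℕ) : Ideal A where
  carrier := {a | ∃ b : A, a = (PowerSeries.X ^ n : k⟦X⟧) • b}
  add_mem' := by
    rintro _ _ ⟨a, rfl⟩ ⟨b, rfl⟩
    exact ⟨a + b, (smul_add _ _ _).symm⟩
  zero_mem' := ⟨0, (smul_zero _).symm⟩
  smul_mem' := by
    rintro c _ ⟨a, rfl⟩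
    exact ⟨c * a, by simp⟩

instance (n : ℕ) : (hPow k A n).IsTwoSided :=
  ⟨fun c => by
    rintro ⟨b, rfl⟩
    exact ⟨b * c, by simp⟩⟩

variable {k A} in
theorem hPow_anti {m n : ℕ} (h : m ≤ n) : hPow k A n ≤ hPow k A m := by
  rintro _ ⟨b, rfl⟩
  refine ⟨(PowerSeries.X ^ (n - m) : k⟦X⟧) • b, ?_⟩
  rw [smul_smul, ← pow_add, Nat.add_sub_cancel' h]

/-- The `h`-adic completion of a `k[[h]]`-algebra `A`: the inverse limit of the algebras
`A / hⁿ A`. -/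
def hCompletion : Subalgebra k⟦X⟧ (∀ n : ℕ, A ⧸ hPow k A n) where
  carrier := {c | ∀ (m n : ℕ) (h : m ≤ n),
    Ideal.Quotient.factorₐ k⟦X⟧ (hPow_anti h) (c n) = c m}
  mul_mem' ha hb m n h := by
    rw [Pi.mul_apply, map_mul, ha m n h, hb m n h]; rfl
  add_mem' ha hb m n h := by
    rw [Pi.add_apply, map_add, ha m n h, hb m n h]; rfl
  algebraMap_mem' r m n h := by
    rw [Pi.algebraMap_apply, AlgHom.commutes]; rfl

/-- The canonical map from `A` to its `h`-adic completion. -/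
def hCompletionOf : A →ₐ[k⟦X⟧] hCompletion k A :=
  (AlgHom.pi fun n => Ideal.Quotient.mkₐ k⟦X⟧ (hPow k A n)).codRestrict (hCompletion k A)
    fun _ _ _ _ => rfl

end Completion

section Vee

variable {k : Type u} {H : Type v} [Field k] [Ring H] [Algebra k⟦X⟧ H] [TopologicalSpace H]

/-- `I_H = ε⁻¹(h k[[h]])`, as a set. -/
def augmentation (T : TopologicalHopfAlgebra k H) : Set H :=
  {a | PowerSeries.constantCoeff (T.counit a) = 0}

/-- `H^×`: the `k[[h]]`-subalgebra of `k((h)) ⊗ H` generated by `h⁻¹ I_H`. -/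
def Times (T : TopologicalHopfAlgebra k H) : Subalgebra k⟦X⟧ (LaurentSeries k ⊗[k⟦X⟧] H) :=
  Algebra.adjoin k⟦X⟧
    {b | ∃ a ∈ augmentation T, b = ((PowerSeries.X : k⟦X⟧) : LaurentSeries k)⁻¹ ⊗ₜ[k⟦X⟧] a}

theorem one_tmul_mem_times (T : TopologicalHopfAlgebra k H) (a : H) :
    (Algebra.TensorProduct.includeRight : H →ₐ[k⟦X⟧] LaurentSeries k ⊗[k⟦X⟧] H) a ∈ Times T := by
  have key : ∀ b ∈ augmentation T,
      (Algebra.TensorProduct.includeRight : H →ₐ[k⟦X⟧] LaurentSeries k ⊗[k⟦X⟧] H) b ∈ Times T := by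
    intro b hb
    have h1 := (Times T).smul_mem (Algebra.subset_adjoin ⟨b, hb, rfl⟩) (PowerSeries.X : k⟦X⟧)
    have hX : ((PowerSeries.X : k⟦X⟧) : LaurentSeries k) ≠ 0 := by
      rw [PowerSeries.coe_X]
      simp
    have h2 : (PowerSeries.X : k⟦X⟧) • (((PowerSeries.X : k⟦X⟧) : LaurentSeries k)⁻¹) = 1 := by
      rw [Algebra.smul_def]
      exact mul_inv_cancel₀ hX
    rw [TensorProduct.smul_tmul', h2] at h1
    exact h1
  have h3 : a = algebraMap k⟦X⟧ H (T.counit a) + (a - algebraMap k⟦X⟧ H (T.counit a)) := by abel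
  rw [h3, map_add, AlgHom.commutes]
  refine (Times T).add_mem ((Times T).algebraMap_mem _) (key _ ?_)
  simp [augmentation]

/-- `H^∨`: the `h`-adic completion of `H^×`. -/
def Vee (T : TopologicalHopfAlgebra k H) : Type (max u v) := hCompletion k (Times T)

variable (T : TopologicalHopfAlgebra k H)

instance : Ring (Vee T) := inferInstanceAs (Ring (hCompletion k (Times T)))
instance : Algebra k⟦X⟧ (Vee T) := inferInstanceAs (Algebra k⟦X⟧ (hCompletion k (Times T)))

/-- `H^∨` carries the `h`-adic topology. -/
instance : TopologicalSpace (Vee T) := hAdicTopology k (Vee T)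

/-- The canonical map `H → H^× → H^∨`. -/
def toVee : H →ₐ[k⟦X⟧] Vee T :=
  (hCompletionOf k (Times T)).comp
    ((Algebra.TensorProduct.includeRight : H →ₐ[k⟦X⟧] LaurentSeries k ⊗[k⟦X⟧] H).codRestrict
      (Times T) (one_tmul_mem_times T))

end Vee

/-! ### Quantisations -/

section Quantisations

variable {k : Type u} {H : Type v} [Field k] [Ring H] [Algebra k⟦X⟧ H] [TopologicalSpace H]

/-- `H` is a quantised universal enveloping algebra with semiclassical limit `U(g)`: it is a
Hopf algebra in `𝒯`, and `H / hH` is isomorphic to `U(g)` as a co-Poisson Hopf algebra. The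
isomorphism is given as a surjection `φ : H → U(g)` with kernel `hH`; the Poisson cobracket of
`H / hH` is `a ↦ h⁻¹ (Δ(a) - Δᵒᵖ(a))`, and that of `U(g)` is the one extending the cobracket
of `g`. -/
def IsQUEA (T : TopologicalHopfAlgebra k H) (g : Type w) [LieRing g] [LieAlgebra k g]
    [Module.Finite k g] [LieBialgebra k g] : Prop :=
  IsTopologicallyFree k H ∧
  ∃ φ : H →+* UniversalEnvelopingAlgebra k g,
    Function.Surjective φ ∧
    (∀ a, φ a = 0 ↔ ∃ b, a = (PowerSeries.X : k⟦X⟧) • b) ∧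
    (∀ r : k⟦X⟧, φ (algebraMap k⟦X⟧ H r)
      = algebraMap k (UniversalEnvelopingAlgebra k g) (PowerSeries.constantCoeff r)) ∧
    (∀ I J : OpenIdeal H, (∀ b ∈ I.toIdeal, φ b = 0) → (∀ b ∈ J.toIdeal, φ b = 0) →
      ∀ (a : H) (N : ℕ) (u v : Fin N → H), Approximates u v (T.comul a) I J →
        envComul k g (φ a) = ∑ i, φ (u i) ⊗ₜ[k] φ (v i)) ∧
    (∀ a, envCounit k g (φ a) = PowerSeries.constantCoeff (T.counit a)) ∧
    (∀ (x : g) (a : H), φ a = envIncl k g x →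
      ∃ c : CompletedTensor k H,
        (∀ I J : OpenIdeal H, (PowerSeries.X : k⟦X⟧) • component c I J
          = component (T.comul a) I J
            - TensorProduct.comm k⟦X⟧ _ _ (component (T.comul a) J I)) ∧
        ∀ I J : OpenIdeal H, (∀ b ∈ I.toIdeal, φ b = 0) → (∀ b ∈ J.toIdeal, φ b = 0) →
          ∀ (N : ℕ) (u v : Fin N → H), Approximates u v c I J →
            ∑ i, φ (u i) ⊗ₜ[k] φ (v i)
              = TensorProduct.map (envIncl k g) (envIncl k g)
                  (LieBialgebra.cobracket (k := k) x))

/-- `π` induces an isomorphism of topological `k`-algebras `H / hH ≅ k[[x₁, …, xₙ]]`, where `H / hH`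
has the quotient topology and `k[[x₁, …, xₙ]]` its usual topology (the product topology of
the coefficients, with `k` discrete). -/
def IsFormalCoordinates (k : Type u) {H : Type v} [Field k] [Ring H] [Algebra k⟦X⟧ H]
    [t : TopologicalSpace H] {n : ℕ} (π : H →+* MvPowerSeries (Fin n) k) : Prop :=
  (∀ a, π a = 0 ↔ ∃ b, a = (PowerSeries.X : k⟦X⟧) • b) ∧
  (∀ r : k⟦X⟧, π (algebraMap k⟦X⟧ H r) = MvPowerSeries.C (PowerSeries.constantCoeff r)) ∧
  @IsOpenQuotientMap H (MvPowerSeries (Fin n) k) t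
    (@MvPowerSeries.WithPiTopology.instTopologicalSpace (Fin n) k ⊥) π

/-- The tangent space at the identity of the formal group with function algebra `H / hH`, i.e. the
dual of `𝔪 / 𝔪²`, where `𝔪` is the augmentation ideal of `H / hH`: the space of `k`-linear
derivations `H / hH → k` at the counit. They are written as maps `d : H → k`. -/
def tangentSpace (T : TopologicalHopfAlgebra k H) : Submodule k (H → k) where
  carrier := {d | (∀ a b, d (a + b) = d a + d b) ∧
    (∀ (r : k⟦X⟧) (a : H), d (r • a) = PowerSeries.constantCoeff r * d a) ∧
    ∀ a b, d (a * b) = PowerSeries.constantCoeff (T.counit a) * d b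
      + d a * PowerSeries.constantCoeff (T.counit b)}
  add_mem' := by
    rintro d d' ⟨h1, h2, h3⟩ ⟨h1', h2', h3'⟩
    refine ⟨fun a b => ?_, fun r a => ?_, fun a b => ?_⟩
    · simp only [Pi.add_apply, h1, h1']; ring
    · simp only [Pi.add_apply, h2, h2']; ring
    · simp only [Pi.add_apply, h3, h3']; ring
  zero_mem' := by simp
  smul_mem' := by
    rintro c d ⟨h1, h2, h3⟩
    refine ⟨fun a b => ?_, fun r a => ?_, fun a b => ?_⟩
    · simp only [Pi.smul_apply, smul_eq_mul, h1]; ring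
    · simp only [Pi.smul_apply, smul_eq_mul, h2]; ring
    · simp only [Pi.smul_apply, smul_eq_mul, h3]; ring

/-- For `τ : g → T_e`, the linear form `x ↦ ⟨a, x⟩ = τ(x)(a)` on `g` attached to a function `a`. -/
def differential (T : TopologicalHopfAlgebra k H) {g : Type w} [AddCommGroup g] [Module k g]
    (τ : g ≃ₗ[k] tangentSpace T) (a : H) : g →ₗ[k] k :=
  LinearMap.proj a ∘ₗ (tangentSpace T).subtype ∘ₗ τ.toLinearMap

/-- `H` is a quantised formal series Hopf algebra with semiclassical limit `F[[g]]`: it is a Hopf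
algebra in `𝒫`, and `H / hH`, with the Poisson bracket `{a, b} = h⁻¹ (a b - b a)`, is the topological
Poisson Hopf algebra of functions on a formal Poisson group with tangent Lie bialgebra `g`.
That is: `H / hH` is isomorphic to `k[[x₁, …, xₙ]]` as a topological algebra, and there is an
isomorphism `τ` of `g` with its tangent space at the identity, under which the Lie bracket of `g` is
the commutator `[d, d'] = (d ⊗ d' - d' ⊗ d) ∘ Δ`, and the cobracket `δ` of `g` is dual to the
Poisson bracket: `⟨{a, b}, x⟩ = ⟨a ⊗ b, δ(x)⟩`. In characteristic `0` the topological Hopf algebras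
of this kind are the full linear duals `U(g)*`; the definition makes sense over every field. -/
def IsQFSHA (T : TopologicalHopfAlgebra k H) (g : Type w) [LieRing g] [LieAlgebra k g]
    [Module.Finite k g] [LieBialgebra k g] : Prop :=
  IsWeakProduct k H ∧
  (∃ (n : ℕ) (π : H →+* MvPowerSeries (Fin n) k), IsFormalCoordinates k π) ∧
  ∃ τ : g ≃ₗ[k] tangentSpace T,
    (∀ (x y : g) (I J : OpenIdeal H),
      (∀ b ∈ I.toIdeal, differential T τ b x = 0 ∧ differential T τ b y = 0) →
      (∀ b ∈ J.toIdeal, differential T τ b x = 0 ∧ differential T τ b y = 0) →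
      ∀ (a : H) (N : ℕ) (u v : Fin N → H), Approximates u v (T.comul a) I J →
        differential T τ a ⁅x, y⁆
          = ∑ i, (differential T τ (u i) x * differential T τ (v i) y
            - differential T τ (u i) y * differential T τ (v i) x)) ∧
    (∀ (x : g) (a b c : H), (PowerSeries.X : k⟦X⟧) • c = a * b - b * a →
      differential T τ c x
        = tensorForm (differential T τ a) (differential T τ b) (LieBialgebra.cobracket (k := k) x))

/-- The value `P(y₁, …, yₙ)` of a polynomial at elements of a not necessarily commutative algebra,
with the monomials written in the order `y₁^{d₁} ⋯ yₙ^{dₙ}`. -/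
def orderedEval {A : Type v} [Ring A] [Algebra k⟦X⟧ A] {n : ℕ} (y : Fin n → A)
    (P : MvPolynomial (Fin n) k) : A :=
  ∑ d ∈ P.support, (PowerSeries.C (P.coeff d) : k⟦X⟧) • (List.ofFn fun j => y j ^ d j).prod

end Quantisations

end QuantumDuality

end

noncomputable section

set_option linter.unusedSectionVars false

namespace QuantumDuality

/-! ### Maps defined by functional relations -/

/-! Write `F` for the quantised function algebra and `I = ε⁻¹(h k[[h]])`. Everything rests on the
powers of `I`, in three ways.

Topology and Hopf structure. The powers of `I` define the weak topology (`exists_augIdeal_pow_le`,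
`isOpen_augIdeal_pow`), and `Iᴺ` becomes divisible by `hᴺ` in `F^×`. A finite sum representing
`Δ(f)` modulo `Iᴺ ⊗ F + F ⊗ Iᴺ` therefore has an image in `F^× ⊗ F^×` that is well defined modulo
`hᴺ`. For `f ∈ I` this image is divisible by `h`, being congruent to `ε(f)`, so by multiplicativity
`Δ` extends to all of `F^×` (`exists_trep`, `trep_unique`). Denominators do no harm: torsion-free
modules over the discrete valuation ring `k[[h]]` are flat, so tensor powers of `F^×` are
torsion-free and an identity in `F` at precision `N + n` can be divided by `hⁿ`. The counit extends
since `ε(Iⁿ) ⊆ hⁿ k[[h]]`. The antipode extends since it is antimultiplicative and preserves `I`;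
antimultiplicativity is the usual convolution argument, done modulo each `Iᴸ`
(`convolution_antipode`). Passing to the `h`-adic completion is extension by continuity.

A basis modulo `h`. As `F/hF` is commutative and `ε` kills commutators, commutators lie in `hI`, so
sorting a product of `D` elements of `I` costs an error in `hI^{D-1}`. Hence elements of `I^D` are
sums of `x^d q_d` with `|d| = D`, up to `hI^{D-1}`, and the ordered monomials in `h⁻¹xⱼ` span `F^×`
modulo `h`. Their independence comes from `mem_pow_of_X_smul_mem`: `ha ∈ I^D` implies `a ∈ I^{D-1}`.
Reducing modulo `h` gives a syzygy between the monomials of degree `D` in `k[[x]]`; such syzygies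
are generated by the obvious ones, and these lift to `F` up to `hI^{D-1}`. Completeness turns a
basis modulo `h` into an isomorphism with `V[[h]]` (`exists_formalSeries_equiv`).

Semiclassical limit. For `ε(f) = 0` the class of `h⁻¹f` modulo `h` depends only on the differential
`df ∈ g*`, because `df = 0` forces `f ∈ I²`. Since `[h⁻¹f, h⁻¹f'] = h⁻¹(h⁻¹[f, f'])`, this is a Lie
map on `g*` and extends to `U(g*)`. Ordered monomials in the `dxⱼ` span `U(g*)` by sorting words,
and they go to the basis found above, so the extension is bijective; no PBW theorem and no condition
on the characteristic enter. Finally `trep_check` gives `Δ(h⁻¹f) = h⁻¹f ⊗ 1 + 1 ⊗ h⁻¹f + h (h⁻¹ ⊗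
h⁻¹)Δ(f)`, up to constants in the tensor factors: the class is primitive modulo `h`, and the next
order, antisymmetrised, is the transpose of the bracket of `g`. -/

theorem exists_linearMap_of_rel {R M N : Type*} [CommRing R] [AddCommGroup M] [AddCommGroup N]
    [Module R M] [Module R N] (rel : M → N → Prop) (total : ∀ m, ∃ n, rel m n)
    (unique : ∀ m n n', rel m n → rel m n' → n = n')
    (add : ∀ m m' n n', rel m n → rel m' n' → rel (m + m') (n + n'))
    (smul : ∀ (r : R) m n, rel m n → rel (r • m) (r • n)) :
    ∃ f : M →ₗ[R] N, ∀ m n, rel m n ↔ f m = n := by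
  choose f hf using total
  refine ⟨⟨⟨f, fun m m' => unique _ _ _ (hf _) (add _ _ _ _ (hf _) (hf _))⟩,
    fun r m => unique _ _ _ (hf _) (smul _ _ _ (hf _))⟩, fun m n => ⟨fun h => ?_, ?_⟩⟩
  · exact unique _ _ _ (hf _) h
  · rintro rfl
    exact hf m

/-- Several maps below are given by a choice of representative. Describing them by relations
isolates independence of the choice (`unique`) from compatibility with the operations. -/
theorem exists_algHom_of_rel {R M N : Type*} [CommRing R] [Ring M] [Ring N]
    [Algebra R M] [Algebra R N] (rel : M → N → Prop) (total : ∀ m, ∃ n, rel m n)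
    (unique : ∀ m n n', rel m n → rel m n' → n = n')
    (add : ∀ m m' n n', rel m n → rel m' n' → rel (m + m') (n + n'))
    (mul : ∀ m m' n n', rel m n → rel m' n' → rel (m * m') (n * n'))
    (scalar : ∀ r : R, rel (algebraMap R M r) (algebraMap R N r)) :
    ∃ f : M →ₐ[R] N, ∀ m n, rel m n ↔ f m = n := by
  obtain ⟨f, hf⟩ := exists_linearMap_of_rel (R := R) rel total unique add
    (fun r m n h => by
      rw [Algebra.smul_def, Algebra.smul_def]
      exact mul _ _ _ _ (scalar r) h)
  refine ⟨AlgHom.ofLinearMap f ?_ ?_, hf⟩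
  · rw [← hf, ← map_one (algebraMap R M), ← map_one (algebraMap R N)]
    exact scalar 1
  · intro x y
    rw [← hf]
    exact mul _ _ _ _ ((hf _ _).2 rfl) ((hf _ _).2 rfl)

/-! ### Torsion-free, separated and complete modules for the `h`-adic topology -/

section HAdic

variable (k : Type*) [Field k]

/-- Multiplication by `h` is injective on `M`. -/
def HTorsionFree (M : Type*) [AddCommGroup M] [Module k⟦X⟧ M] : Prop :=
  ∀ m : M, (PowerSeries.X : k⟦X⟧) • m = 0 → m = 0

variable {k}

theorem HTorsionFree.pow {M : Type*} [AddCommGroup M] [Module k⟦X⟧ M] (hM : HTorsionFree k M)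
    (n : ℕ) (m : M) (h : (PowerSeries.X ^ n : k⟦X⟧) • m = 0) : m = 0 := by
  induction n with
  | zero => simpa using h
  | succ n ih =>
    rw [pow_succ', mul_smul] at h
    exact ih (hM _ h)

theorem HTorsionFree.pow_cancel {M : Type*} [AddCommGroup M] [Module k⟦X⟧ M]
    (hM : HTorsionFree k M) (n : ℕ) {a b : M}
    (h : (PowerSeries.X ^ n : k⟦X⟧) • a = (PowerSeries.X ^ n : k⟦X⟧) • b) : a = b := by
  rw [← sub_eq_zero, ← smul_sub] at h
  exact sub_eq_zero.1 (hM.pow n _ h)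

theorem HTorsionFree.cancel {M : Type*} [AddCommGroup M] [Module k⟦X⟧ M]
    (hM : HTorsionFree k M) {a b : M}
    (h : (PowerSeries.X : k⟦X⟧) • a = (PowerSeries.X : k⟦X⟧) • b) : a = b :=
  hM.pow_cancel 1 (by simpa using h)

theorem hTorsionFree_powerSeries : HTorsionFree k k⟦X⟧ := fun m h => by
  rw [smul_eq_mul, mul_eq_zero] at h
  exact h.resolve_left PowerSeries.X_ne_zero

theorem HTorsionFree.of_injective {M N : Type*} [AddCommGroup M] [Module k⟦X⟧ M] [AddCommGroup N]
    [Module k⟦X⟧ N] (hN : HTorsionFree k N) (f : M →ₗ[k⟦X⟧] N) (hf : Function.Injective f) :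
    HTorsionFree k M := fun m h => hf (by
  rw [map_zero]
  exact hN _ (by rw [← map_smul, h, map_zero]))

/-- Over a Bézout domain flatness is absence of torsion, and a nonzero element of the discrete
valuation ring `k[[h]]` is a unit times a power of `h`, so `h`-torsion is all there is to exclude.
-/
theorem HTorsionFree.flat {M : Type*} [AddCommGroup M] [Module k⟦X⟧ M] (hM : HTorsionFree k M) :
    Module.Flat k⟦X⟧ M := by
  rw [Module.Flat.flat_iff_torsion_eq_bot_of_isBezout, eq_bot_iff]
  rintro m ⟨⟨r, hr⟩, hm⟩
  have hr0 : r ≠ 0 := nonZeroDivisors.ne_zero hr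
  obtain ⟨n, c, rfl⟩ : ∃ (n : ℕ) (c : k⟦X⟧ˣ), r = PowerSeries.X ^ n * (c : k⟦X⟧) := by
    obtain ⟨n, hn⟩ := IsDiscreteValuationRing.associated_pow_irreducible hr0
      (PowerSeries.X_prime (R := k)).irreducible
    obtain ⟨c, hc⟩ := hn.symm
    exact ⟨n, c, hc.symm⟩
  change (PowerSeries.X ^ n * (c : k⟦X⟧)) • m = 0 at hm
  rw [mul_smul] at hm
  have := hM.pow n _ hm
  exact (smul_eq_zero_iff_eq c).1 this

/-- Tensoring the injection `h : N → N` with the flat module `M` keeps it injective. This is what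
permits division by `hⁿ` in tensor powers of `F^×`. -/
theorem HTorsionFree.tensor {M N : Type*} [AddCommGroup M] [Module k⟦X⟧ M] [AddCommGroup N]
    [Module k⟦X⟧ N] (hM : HTorsionFree k M) (hN : HTorsionFree k N) :
    HTorsionFree k (M ⊗[k⟦X⟧] N) := by
  have := hM.flat
  intro z hz
  have hinj : Function.Injective (LinearMap.lsmul k⟦X⟧ N PowerSeries.X) := fun a b h => hN.cancel h
  have := Module.Flat.lTensor_preserves_injective_linearMap (M := M) _ hinj
  apply this
  rw [map_zero, ← hz]
  induction z with
  | zero => simp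
  | tmul a b => simp
  | add a b ha hb =>
    have e : ∀ a : M ⊗[k⟦X⟧] N, (LinearMap.lTensor M (LinearMap.lsmul k⟦X⟧ N PowerSeries.X)) a
        = (PowerSeries.X : k⟦X⟧) • a := by
      intro a
      induction a with
      | zero => simp
      | tmul a b => simp
      | add a b ha hb => rw [map_add, ha, hb, smul_add]
    exact e _

/-! ### Arithmetic of the ideals `hⁿ A` -/

section hPow

variable {A B : Type*} [Ring A] [Algebra k⟦X⟧ A] [Ring B] [Algebra k⟦X⟧ B]

theorem pow_smul_mem_hPow (n : ℕ) (a : A) : (PowerSeries.X ^ n : k⟦X⟧) • a ∈ hPow k A n := ⟨a, rfl⟩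

theorem mem_hPow_zero (a : A) : a ∈ hPow k A 0 := ⟨a, by simp⟩

theorem smul_mem_hPow {n : ℕ} {a : A} (r : k⟦X⟧) (h : a ∈ hPow k A n) : r • a ∈ hPow k A n := by
  rw [Algebra.smul_def]
  exact (hPow k A n).mul_mem_left _ h

theorem pow_smul_mem_hPow_add {N : ℕ} (n : ℕ) {a : A} (h : a ∈ hPow k A N) :
    (PowerSeries.X ^ n : k⟦X⟧) • a ∈ hPow k A (N + n) := by
  obtain ⟨b, rfl⟩ := h
  exact ⟨b, by rw [smul_smul, ← pow_add, add_comm]⟩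

theorem HTorsionFree.mem_hPow_of_smul (hA : HTorsionFree k A) {N n : ℕ} {a : A}
    (h : (PowerSeries.X ^ n : k⟦X⟧) • a ∈ hPow k A (N + n)) : a ∈ hPow k A N := by
  obtain ⟨b, hb⟩ := h
  refine ⟨b, hA.pow_cancel n ?_⟩
  rw [hb, smul_smul, ← pow_add, add_comm]

theorem map_mem_hPow (f : A →ₗ[k⟦X⟧] B) {n : ℕ} {a : A} (h : a ∈ hPow k A n) :
    f a ∈ hPow k B n := by
  obtain ⟨b, rfl⟩ := h
  exact ⟨f b, map_smul _ _ _⟩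

theorem algHom_mem_hPow (f : A →ₐ[k⟦X⟧] B) {n : ℕ} {a : A} (h : a ∈ hPow k A n) :
    f a ∈ hPow k B n := map_mem_hPow f.toLinearMap h

theorem hPow_mul_mem {m n : ℕ} {a b : A} (ha : a ∈ hPow k A m) (hb : b ∈ hPow k A n) :
    a * b ∈ hPow k A (m + n) := by
  obtain ⟨a, rfl⟩ := ha
  obtain ⟨b, rfl⟩ := hb
  exact ⟨a * b, by rw [smul_mul_smul_comm, pow_add]⟩

theorem mem_hPow_one {a : A} : a ∈ hPow k A 1 ↔ ∃ b, a = (PowerSeries.X : k⟦X⟧) • b := by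
  conv_rhs => rw [← pow_one (PowerSeries.X : k⟦X⟧)]
  exact Iff.rfl

theorem sub_mem_hPow_trans {n : ℕ} {a b c : A} (h : a - b ∈ hPow k A n) (h' : b - c ∈ hPow k A n) :
    a - c ∈ hPow k A n := by
  have := add_mem h h'
  rwa [sub_add_sub_cancel] at this

theorem sub_mem_hPow_symm {n : ℕ} {a b : A} (h : a - b ∈ hPow k A n) : b - a ∈ hPow k A n := by
  rw [← neg_sub]
  exact neg_mem h

theorem mul_sub_mul_mem_hPow {n : ℕ} {a b c d : A} (h : a - b ∈ hPow k A n)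
    (h' : c - d ∈ hPow k A n) : a * c - b * d ∈ hPow k A n := by
  have e : a * c - b * d = (a - b) * c + b * (c - d) := by noncomm_ring
  rw [e]
  exact add_mem ((hPow k A n).mul_mem_right _ h) ((hPow k A n).mul_mem_left _ h')

end hPow

/-- Separated and complete for the `h`-adic topology. -/
structure IsHComplete (k : Type*) [Field k] (M : Type*) [Ring M] [Algebra k⟦X⟧ M] : Prop where
  separated : ∀ m : M, (∀ n, m ∈ hPow k M n) → m = 0
  complete : ∀ s : ℕ → M, (∀ n, s (n + 1) - s n ∈ hPow k M n) → ∃ m, ∀ n, m - s n ∈ hPow k M n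

theorem IsHComplete.eq {M : Type*} [Ring M] [Algebra k⟦X⟧ M] (hM : IsHComplete k M) {a b : M}
    (h : ∀ n, a - b ∈ hPow k M n) : a = b :=
  sub_eq_zero.1 (hM.separated _ h)

theorem isHComplete_powerSeries : IsHComplete k k⟦X⟧ where
  separated m h := by
    ext n
    exact PowerSeries.X_pow_dvd_iff.1 (h (n + 1)) n (Nat.lt_succ_self n)
  complete s hs := by
    have key : ∀ n d i, i < n → PowerSeries.coeff i (s (n + d)) = PowerSeries.coeff i (s n) := by
      intro n d i hi
      induction d with
      | zero => rfl
      | succ d ih =>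
        rw [← ih, ← sub_eq_zero, ← map_sub]
        exact PowerSeries.X_pow_dvd_iff.1 (hs (n + d)) i (by omega)
    -- Coefficient `n` is settled only from index `n + 1` on, since `s (n + 1) - s n` is known to be
    -- divisible by `hⁿ` and no more.
    refine ⟨PowerSeries.mk fun n => PowerSeries.coeff n (s (n + 1)), fun n => ?_⟩
    refine PowerSeries.X_pow_dvd_iff.2 fun m hm => ?_
    obtain ⟨d, rfl⟩ := Nat.exists_eq_add_of_le hm
    rw [map_sub, PowerSeries.coeff_mk, sub_eq_zero]
    exact (key (m + 1) d m (Nat.lt_succ_self m)).symm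

/-- `ι : A → H` exhibits `H` as the `h`-adic completion of `A`. -/
structure IsHCompletion {A H : Type*} [Ring A] [Algebra k⟦X⟧ A] [Ring H] [Algebra k⟦X⟧ H]
    (ι : A →ₐ[k⟦X⟧] H) : Prop where
  torsionFree : HTorsionFree k H
  isHComplete : IsHComplete k H
  dense : ∀ (c : H) (n : ℕ), ∃ a, c - ι a ∈ hPow k H n
  reflect : ∀ (a : A) (n : ℕ), ι a ∈ hPow k H n → a ∈ hPow k A n

/-! ### Completions and extension of linear maps by continuity -/

section Completion

variable {A H : Type*} [Ring A] [Algebra k⟦X⟧ A] [Ring H] [Algebra k⟦X⟧ H] {ι : A →ₐ[k⟦X⟧] H}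

theorem IsHCompletion.reflect_sub (hι : IsHCompletion ι) {c : H} {a b : A} {n : ℕ}
    (ha : c - ι a ∈ hPow k H n) (hb : c - ι b ∈ hPow k H n) : a - b ∈ hPow k A n := by
  apply hι.reflect
  rw [map_sub]
  exact sub_mem_hPow_trans (sub_mem_hPow_symm ha) hb

/-- The value at `c` is the limit of `f(aₙ)` for any `aₙ` with `ι(aₙ)` congruent to `c` modulo `hⁿ`;
`reflect` brings congruences between the `ι(aₙ)` back to `A`, so the limit exists and does not
depend on the approximation. -/
theorem IsHCompletion.exists_extend (hι : IsHCompletion ι) {M : Type*} [Ring M] [Algebra k⟦X⟧ M]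
    (hM : IsHComplete k M) (f : A →ₗ[k⟦X⟧] M) : ∃ g : H →ₗ[k⟦X⟧] M, ∀ a, g (ι a) = f a := by
  suffices h : ∃ g : H →ₗ[k⟦X⟧] M, ∀ (c : H) (m : M),
      (∀ n a, c - ι a ∈ hPow k H n → m - f a ∈ hPow k M n) ↔ g c = m by
    obtain ⟨g, hg⟩ := h
    refine ⟨g, fun a => (hg _ _).1 fun n b hb => ?_⟩
    rw [← map_sub] at hb ⊢
    exact map_mem_hPow f (hι.reflect _ _ hb)
  apply exists_linearMap_of_rel
  · intro c
    choose s hs using hι.dense c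
    obtain ⟨m, hm⟩ := hM.complete (fun n => f (s n)) (fun n => by
      rw [← map_sub]
      exact map_mem_hPow f (hι.reflect_sub (hPow_anti (Nat.le_succ n) (hs (n + 1))) (hs n)))
    refine ⟨m, fun n a ha => sub_mem_hPow_trans (hm n) ?_⟩
    rw [← map_sub]
    exact map_mem_hPow f (hι.reflect_sub (hs n) ha)
  · intro c m m' h h'
    refine hM.eq fun n => ?_
    obtain ⟨a, ha⟩ := hι.dense c n
    exact sub_mem_hPow_trans (h n a ha) (sub_mem_hPow_symm (h' n a ha))
  · intro c c' m m' h h' n a ha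
    obtain ⟨b, hb⟩ := hι.dense c n
    obtain ⟨b', hb'⟩ := hι.dense c' n
    have h2 : c + c' - ι (b + b') ∈ hPow k H n := by
      rw [map_add, add_sub_add_comm]
      exact add_mem hb hb'
    have h1 := map_mem_hPow f (hι.reflect_sub h2 ha)
    rw [map_sub, map_add] at h1
    refine sub_mem_hPow_trans ?_ h1
    rw [add_sub_add_comm]
    exact add_mem (h n b hb) (h' n b' hb')
  · intro r c m h n a ha
    obtain ⟨b, hb⟩ := hι.dense c n
    have h2 : r • c - ι (r • b) ∈ hPow k H n := by
      rw [map_smul, ← smul_sub]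
      exact smul_mem_hPow r hb
    have h1 := map_mem_hPow f (hι.reflect_sub h2 ha)
    rw [map_sub, map_smul] at h1
    refine sub_mem_hPow_trans ?_ h1
    rw [← smul_sub]
    exact smul_mem_hPow r (h n b hb)

/-- The `h`-adic completion of a torsion-free algebra. -/
theorem isHCompletion_hCompletionOf (hA : HTorsionFree k A) :
    IsHCompletion (hCompletionOf k A) := by
  have rep : ∀ (c : hCompletion k A) (n : ℕ), ∃ a : A, ∀ m ≤ n,
      c.1 m = Ideal.Quotient.mk (hPow k A m) a := by
    intro c n
    obtain ⟨a, ha⟩ := Ideal.Quotient.mk_surjective (c.1 n)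
    refine ⟨a, fun m hm => ?_⟩
    rw [← c.2 m n hm, ← ha]
    rfl
  have of_apply : ∀ (a : A) (n : ℕ), (hCompletionOf k A a).1 n = Ideal.Quotient.mk _ a :=
    fun a n => rfl
  have smul_apply : ∀ (r : k⟦X⟧) (c : hCompletion k A) (n : ℕ), (r • c).1 n = r • c.1 n :=
    fun r c n => rfl
  have mk_smul : ∀ (r : k⟦X⟧) (a : A) (n : ℕ),
      r • Ideal.Quotient.mk (hPow k A n) a = Ideal.Quotient.mk _ (r • a) := fun r a n => rfl
  have ext : ∀ c d : hCompletion k A, (∀ n, c.1 n = d.1 n) → c = d :=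
    fun c d h => Subtype.ext (funext h)
  have tf : HTorsionFree k (hCompletion k A) := by
    intro c hc
    refine ext _ _ fun n => ?_
    obtain ⟨a, ha⟩ := rep c (n + 1)
    have h1 : ((PowerSeries.X : k⟦X⟧) • c).1 (n + 1) = 0 := by rw [hc]; rfl
    rw [smul_apply, ha _ le_rfl, mk_smul, Ideal.Quotient.eq_zero_iff_mem] at h1
    rw [ha n (Nat.le_succ n)]
    refine Ideal.Quotient.eq_zero_iff_mem.2 (hA.mem_hPow_of_smul (n := 1) ?_)
    simpa using h1
  -- The kernel of the projection to `A / hⁿ A` consists of multiples of `hⁿ`: dividing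
  -- representatives of the components of index `n + m` by `hⁿ` gives again a compatible system,
  -- because `A` is torsion-free.
  have ker : ∀ (c : hCompletion k A) (n : ℕ), c ∈ hPow k (hCompletion k A) n ↔ c.1 n = 0 := by
    intro c n
    constructor
    · rintro ⟨d, rfl⟩
      obtain ⟨a, ha⟩ := rep d n
      rw [smul_apply, ha n le_rfl, mk_smul]
      exact Ideal.Quotient.eq_zero_iff_mem.2 (pow_smul_mem_hPow _ _)
    · intro hc
      have h1 : ∀ m, ∃ b : A, c.1 (n + m) = Ideal.Quotient.mk _ ((PowerSeries.X ^ n : k⟦X⟧) • b) := by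
        intro m
        obtain ⟨a, ha⟩ := rep c (n + m)
        have h2 := ha n (Nat.le_add_right _ _)
        rw [hc] at h2
        obtain ⟨b, rfl⟩ := Ideal.Quotient.eq_zero_iff_mem.1 h2.symm
        exact ⟨b, ha _ le_rfl⟩
      choose b hb using h1
      refine ⟨⟨fun m => Ideal.Quotient.mk _ (b m), ?_⟩, ext _ _ fun m => ?_⟩
      · intro p q hpq
        change Ideal.Quotient.mk _ (b q) = Ideal.Quotient.mk _ (b p)
        rw [Ideal.Quotient.eq]
        refine hA.mem_hPow_of_smul (n := n) ?_
        have h3 := c.2 (n + p) (n + q) (by omega)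
        rw [hb p, hb q] at h3
        have h4 := Ideal.Quotient.eq.1 h3
        rw [smul_sub]
        rwa [add_comm]
      · rw [smul_apply]
        change c.1 m = (PowerSeries.X ^ n : k⟦X⟧) • Ideal.Quotient.mk _ (b m)
        rw [← c.2 m (n + m) (by omega), hb]
        rfl
  refine ⟨tf, ⟨fun c hc => ext _ _ fun n => (ker c n).1 (hc n), fun s hs => ?_⟩, fun c n => ?_,
    fun a n h => ?_⟩
  · have key : ∀ n d, (s (n + d)).1 n = (s n).1 n := by
      intro n d
      induction d with
      | zero => rfl
      | succ d ih =>
        rw [← ih, ← sub_eq_zero]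
        exact (ker _ n).1 (hPow_anti (Nat.le_add_right n d) (hs (n + d)))
    refine ⟨⟨fun n => (s n).1 n, ?_⟩, fun n => ?_⟩
    · intro m n hmn
      obtain ⟨d, rfl⟩ := Nat.exists_eq_add_of_le hmn
      rw [(s (m + d)).2 m (m + d) hmn, key]
    · rw [ker]
      exact sub_self _
  · obtain ⟨a, ha⟩ := rep c n
    refine ⟨a, (ker _ n).2 ?_⟩
    have : (c - hCompletionOf k A a).1 n = c.1 n - (hCompletionOf k A a).1 n := rfl
    rw [this, ha n le_rfl, of_apply, sub_self]
  · have := (ker _ n).1 h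
    rwa [of_apply, Ideal.Quotient.eq_zero_iff_mem] at this

end Completion

/-! ### Topologically free modules from a basis modulo `h` -/

section FormalSeries

variable {V H : Type*} [AddCommGroup V] [Module k V] [Ring H] [Algebra k⟦X⟧ H]

/-- The formal series with given coefficients. -/
def FormalSeries.mk (f : ℕ → V) : FormalSeries V := f

@[simp] theorem FormalSeries.coeff_mk (f : ℕ → V) (n : ℕ) :
    (FormalSeries.mk f).coeff n = f n := rfl

/-- The partial sums of `∑ hᵐ B(vₘ)`. -/
def partialSum (B : V →+ H) (P : FormalSeries V) (N : ℕ) : H :=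
  ∑ m ∈ Finset.range N, (PowerSeries.X ^ m : k⟦X⟧) • B (P.coeff m)

theorem partialSum_add (B : V →+ H) (P Q : FormalSeries V) (N : ℕ) :
    partialSum (k := k) B (P + Q) N = partialSum (k := k) B P N + partialSum (k := k) B Q N := by
  simp only [partialSum, FormalSeries.coeff_add, map_add, smul_add, Finset.sum_add_distrib]

theorem partialSum_succ_sub (B : V →+ H) (P : FormalSeries V) (N : ℕ) :
    partialSum (k := k) B P (N + 1) - partialSum (k := k) B P N ∈ hPow k H N := by
  rw [partialSum, Finset.sum_range_succ, partialSum, add_sub_cancel_left]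
  exact pow_smul_mem_hPow _ _

theorem partialSum_succ (B : V →+ H) (P : FormalSeries V) (N : ℕ) :
    partialSum (k := k) B P (N + 1) = B (P.coeff 0) + (PowerSeries.X : k⟦X⟧) •
      partialSum (k := k) B (.mk fun n => P.coeff (n + 1)) N := by
  rw [partialSum, Finset.sum_range_succ', partialSum, Finset.smul_sum, add_comm]
  congr 1
  · simp
  · refine Finset.sum_congr rfl fun i _ => ?_
    rw [smul_smul, pow_succ']
    rfl

/-- Truncation commutes with scalars up to order `N`. Writing `r = r(0) + h r'` separates an exact
constant part from a part in which `h` has been gained, and the induction hypothesis at `N` suffices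
for the latter. -/
theorem partialSum_smul (B : V →+ H) (hB : ∀ (c : k) v, B (c • v) = (PowerSeries.C c : k⟦X⟧) • B v)
    (N : ℕ) : ∀ (r : k⟦X⟧) (P : FormalSeries V),
    partialSum (k := k) B (r • P) N - r • partialSum (k := k) B P N ∈ hPow k H N := by
  induction N with
  | zero => exact fun r P => mem_hPow_zero _
  | succ N ih =>
    intro r P
    set r' : k⟦X⟧ := PowerSeries.mk fun n => PowerSeries.coeff (n + 1) r with hr'
    have hr : r = PowerSeries.C (PowerSeries.constantCoeff r) + PowerSeries.X * r' := by
      ext n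
      cases n with
      | zero => simp
      | succ n => simp [hr', PowerSeries.coeff_succ_X_mul]
    have hcoe : FormalSeries.mk (fun n => (r • P).coeff (n + 1))
        = .mk (fun n => PowerSeries.constantCoeff r • P.coeff (n + 1)) + r' • P := by
      refine FormalSeries.ext' fun n => ?_
      rw [FormalSeries.coeff_add, FormalSeries.coeff_mk, FormalSeries.coeff_mk,
        FormalSeries.coeff_smul, FormalSeries.coeff_smul, Finset.Nat.antidiagonal_succ,
        Finset.sum_cons, Finset.sum_map]
      simp [hr']
    have hscal : ∀ (c : k) (Q : FormalSeries V) (M : ℕ),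
        partialSum (k := k) B (.mk fun n => c • Q.coeff n) M
          = (PowerSeries.C c : k⟦X⟧) • partialSum (k := k) B Q M := by
      intro c Q M
      rw [partialSum, partialSum, Finset.smul_sum]
      refine Finset.sum_congr rfl fun i _ => ?_
      rw [FormalSeries.coeff_mk, hB, smul_comm]
    have h0 : B ((r • P).coeff 0) = (PowerSeries.C (PowerSeries.constantCoeff r) : k⟦X⟧)
        • B (P.coeff 0) := by
      rw [← hB, FormalSeries.coeff_smul]
      simp
    have e1 : partialSum (k := k) B (r • P) (N + 1)
        = (PowerSeries.C (PowerSeries.constantCoeff r) : k⟦X⟧) • partialSum (k := k) B P (N + 1)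
          + (PowerSeries.X : k⟦X⟧) • partialSum (k := k) B (r' • P) N := by
      rw [partialSum_succ, h0, hcoe, partialSum_add, partialSum_succ B P, smul_add, smul_add,
        ← add_assoc]
      congr 2
      rw [smul_comm]
      exact congrArg _ (hscal (PowerSeries.constantCoeff r) (.mk fun n => P.coeff (n + 1)) N)
    have e2 : partialSum (k := k) B (r • P) (N + 1) - r • partialSum (k := k) B P (N + 1)
        = (PowerSeries.X ^ 1 : k⟦X⟧) • ((partialSum (k := k) B (r' • P) N
            - r' • partialSum (k := k) B P N)
          - r' • (partialSum (k := k) B P (N + 1) - partialSum (k := k) B P N)) := by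
      conv_lhs => rw [e1]; enter [2, 1]; rw [hr]
      rw [add_smul, add_sub_add_left_eq_sub, mul_smul, pow_one, ← smul_sub]
      congr 1
      rw [smul_sub]
      abel
    rw [e2]
    exact pow_smul_mem_hPow_add 1
      (sub_mem (ih r' P) (smul_mem_hPow _ (partialSum_succ_sub _ _ _)))

/-- A basis modulo `h` is a topological basis. Completeness sums the series `∑ hᵐ B(Pₘ)`;
torsion-freeness allows the lowest nonzero coefficient to be isolated, giving injectivity; expanding
`c = B(v) + h d` again and again gives surjectivity. -/
theorem exists_formalSeries_equiv (htf : HTorsionFree k H) (hH : IsHComplete k H) (B : V →+ H)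
    (hB : ∀ (c : k) v, B (c • v) = (PowerSeries.C c : k⟦X⟧) • B v)
    (inj : ∀ v, B v ∈ hPow k H 1 → v = 0) (surj : ∀ c, ∃ v, c - B v ∈ hPow k H 1) :
    ∃ e : FormalSeries V ≃ₗ[k⟦X⟧] H, ∀ P N, e P - partialSum (k := k) B P N ∈ hPow k H N := by
  obtain ⟨e, he⟩ := exists_linearMap_of_rel (R := k⟦X⟧)
    (fun (P : FormalSeries V) (c : H) => ∀ N, c - partialSum (k := k) B P N ∈ hPow k H N)
    (fun P => hH.complete _ fun n => partialSum_succ_sub B P n)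
    (fun P c c' h h' => hH.eq fun n => sub_mem_hPow_trans (h n) (sub_mem_hPow_symm (h' n)))
    (fun P P' c c' h h' n => by
      rw [partialSum_add, add_sub_add_comm]
      exact add_mem (h n) (h' n))
    (fun r P c h n => by
      have := smul_mem_hPow r (h n)
      rw [smul_sub] at this
      exact sub_mem_hPow_trans this (sub_mem_hPow_symm (partialSum_smul B hB n r P)))
  have he' : ∀ P N, e P - partialSum (k := k) B P N ∈ hPow k H N := fun P => (he P _).2 rfl
  refine ⟨LinearEquiv.ofBijective e ⟨?_, ?_⟩, he'⟩
  · rw [← LinearMap.ker_eq_bot, LinearMap.ker_eq_bot']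
    intro P hP
    refine FormalSeries.ext' fun n => ?_
    induction n using Nat.strong_induction_on with
    | _ n ih =>
      have h1 := he' P (n + 1)
      rw [hP, zero_sub, neg_mem_iff, partialSum, Finset.sum_range_succ, Finset.sum_eq_zero,
        zero_add, add_comm n 1] at h1
      · exact inj _ (htf.mem_hPow_of_smul h1)
      · intro i hi
        rw [ih i (Finset.mem_range.1 hi), FormalSeries.coeff_zero, map_zero, smul_zero]
  · intro c
    have step : ∀ c : H, ∃ (v : V) (d : H), c = B v + (PowerSeries.X : k⟦X⟧) • d := by
      intro c
      obtain ⟨v, hv⟩ := surj c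
      obtain ⟨d, hd⟩ := mem_hPow_one.1 hv
      exact ⟨v, d, by rw [← hd]; abel⟩
    choose v d hvd using step
    -- The `n`-th digit of `c` is the leading coefficient of its `n`-th remainder.
    let P : FormalSeries V := fun n => v (d^[n] c)
    have key : ∀ N, c = partialSum (k := k) B P N + (PowerSeries.X ^ N : k⟦X⟧) • d^[N] c := by
      intro N
      induction N with
      | zero => simp [partialSum]
      | succ N ih =>
        rw [partialSum, Finset.sum_range_succ, ← partialSum]
        conv_lhs => rw [ih, hvd (d^[N] c)]
        rw [smul_add, smul_smul, ← pow_succ, Function.iterate_succ_apply', add_assoc]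
        rfl
    refine ⟨P, hH.eq fun N => sub_mem_hPow_trans (he' P N) (sub_mem_hPow_symm ?_)⟩
    rw [sub_eq_of_eq_add' (key N)]
    exact pow_smul_mem_hPow _ _

end FormalSeries

end HAdic

/-! ### Powers of two-sided ideals -/

section Ideals

variable {F : Type*} [Ring F]

theorem ideal_pow_mul_mem {J : Ideal F} [J.IsTwoSided] {m n : ℕ} {a b : F} (ha : a ∈ J ^ m)
    (hb : b ∈ J ^ n) : a * b ∈ J ^ (m + n) := by
  rw [Ideal.IsTwoSided.pow_add]
  exact Ideal.mul_mem_mul ha hb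

theorem ideal_mul_mem_pow_succ {J : Ideal F} [J.IsTwoSided] {n : ℕ} {a b : F} (ha : a ∈ J ^ n)
    (hb : b ∈ J) : a * b ∈ J ^ (n + 1) :=
  ideal_pow_mul_mem ha (by rwa [Submodule.pow_one])

theorem ideal_mul_mem_pow_succ' {J : Ideal F} [J.IsTwoSided] {n : ℕ} {a b : F} (ha : a ∈ J)
    (hb : b ∈ J ^ n) : a * b ∈ J ^ (n + 1) := by
  rw [add_comm]
  exact ideal_pow_mul_mem (by rwa [Submodule.pow_one]) hb

theorem ideal_pow_zero_mem {J : Ideal F} (a : F) : a ∈ J ^ 0 := by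
  rw [Submodule.pow_zero, Ideal.one_eq_top]
  trivial

/-- Induction on membership in a power of a two-sided ideal. -/
theorem ideal_pow_induction {J : Ideal F} [J.IsTwoSided] {p : ℕ → F → Prop}
    (zero : ∀ a, p 0 a) (add : ∀ n a b, p n a → p n b → p n (a + b))
    (mul : ∀ n a b, a ∈ J ^ n → b ∈ J → p n a → p (n + 1) (a * b)) :
    ∀ n a, a ∈ J ^ n → p n a := by
  intro n
  induction n with
  | zero => exact fun a _ => zero a
  | succ n ih =>
    intro a ha
    rw [Ideal.IsTwoSided.pow_add, Submodule.pow_one] at ha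
    exact Submodule.mul_induction_on ha (fun b hb c hc => mul n b c hb hc (ih b hb)) (add _)

theorem ideal_smul_mem {R : Type*} [CommRing R] [Algebra R F] {J : Ideal F} {f : F} (r : R)
    (hf : f ∈ J) : r • f ∈ J := by
  rw [Algebra.smul_def]
  exact J.mul_mem_left _ hf

end Ideals

/-! ### The subalgebra `F^×` -/

section Times

variable {k F A : Type*} [Field k] [Ring F] [Algebra k⟦X⟧ F] [TopologicalSpace F]
  [Ring A] [Algebra k⟦X⟧ A]

/-- The counit followed by reduction modulo `h`. -/
def counitZero (T : TopologicalHopfAlgebra k F) : F →+* k :=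
  (PowerSeries.constantCoeff (R := k)).comp (T.counit : F →+* k⟦X⟧)

theorem counitZero_apply (T : TopologicalHopfAlgebra k F) (f : F) :
    counitZero T f = PowerSeries.constantCoeff (T.counit f) := rfl

/-- The ideal `ε⁻¹(h k[[h]])`. -/
def augIdeal (T : TopologicalHopfAlgebra k F) : Ideal F := RingHom.ker (counitZero T)

instance (T : TopologicalHopfAlgebra k F) : (augIdeal T).IsTwoSided :=
  inferInstanceAs (RingHom.ker (counitZero T)).IsTwoSided

theorem mem_augIdeal {T : TopologicalHopfAlgebra k F} {f : F} :
    f ∈ augIdeal T ↔ PowerSeries.constantCoeff (T.counit f) = 0 := RingHom.mem_ker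

theorem counitZero_smul (T : TopologicalHopfAlgebra k F) (r : k⟦X⟧) (f : F) :
    counitZero T (r • f) = PowerSeries.constantCoeff r * counitZero T f := by
  simp [counitZero_apply]

theorem X_smul_mem_augIdeal (T : TopologicalHopfAlgebra k F) (f : F) :
    (PowerSeries.X : k⟦X⟧) • f ∈ augIdeal T := by
  rw [mem_augIdeal, map_smul]
  simp

theorem pow_smul_mem_augIdeal_pow (T : TopologicalHopfAlgebra k F) (n : ℕ) {m : ℕ} {f : F}
    (hf : f ∈ augIdeal T ^ m) : (PowerSeries.X ^ n : k⟦X⟧) • f ∈ augIdeal T ^ (n + m) := by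
  induction n with
  | zero => simpa using hf
  | succ n ih =>
    rw [pow_succ', mul_smul, ← one_mul ((PowerSeries.X ^ n : k⟦X⟧) • f), ← smul_mul_assoc,
      add_right_comm]
    exact ideal_mul_mem_pow_succ' (X_smul_mem_augIdeal T 1) ih

theorem hPow_le_augIdeal_pow (T : TopologicalHopfAlgebra k F) (n : ℕ) :
    hPow k F n ≤ augIdeal T ^ n := by
  rintro _ ⟨b, rfl⟩
  exact pow_smul_mem_augIdeal_pow T n (m := 0) (ideal_pow_zero_mem b)

theorem counit_pow_dvd (T : TopologicalHopfAlgebra k F) (n : ℕ) (f : F)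
    (hf : f ∈ augIdeal T ^ n) : (PowerSeries.X : k⟦X⟧) ^ n ∣ T.counit f := by
  refine ideal_pow_induction (J := augIdeal T)
    (p := fun n f => (PowerSeries.X : k⟦X⟧) ^ n ∣ T.counit f) (fun a => ?_)
    (fun n a b ha hb => ?_) (fun n a b _ hb ha => ?_) n f hf
  · simp
  · rw [map_add]
    exact dvd_add ha hb
  · rw [map_mul, pow_succ]
    exact mul_dvd_mul ha (PowerSeries.X_dvd_iff.2 (mem_augIdeal.1 hb))

theorem sub_counit_mem (T : TopologicalHopfAlgebra k F) (f : F) :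
    T.counit (f - algebraMap k⟦X⟧ F (T.counit f)) = 0 := by
  simp

theorem sub_counit_mem_augIdeal (T : TopologicalHopfAlgebra k F) (f : F) :
    f - algebraMap k⟦X⟧ F (T.counit f) ∈ augIdeal T := by
  rw [mem_augIdeal, sub_counit_mem, map_zero]

theorem mem_augIdeal_of_counit {T : TopologicalHopfAlgebra k F} {f : F} (h : T.counit f = 0) :
    f ∈ augIdeal T := by
  rw [mem_augIdeal, h, map_zero]

/-- `j : F → A` identifies `A` with the algebra `F^×`. -/
structure IsTimes (T : TopologicalHopfAlgebra k F) (j : F →ₐ[k⟦X⟧] A) : Prop where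
  torsionFree : HTorsionFree k A
  injective : Function.Injective j
  exists_div : ∀ f ∈ augIdeal T, ∃ b, (PowerSeries.X : k⟦X⟧) • b = j f
  adjoin : Algebra.adjoin k⟦X⟧ {b | ∃ f ∈ augIdeal T, (PowerSeries.X : k⟦X⟧) • b = j f} = ⊤

namespace IsTimes

variable {T : TopologicalHopfAlgebra k F} {j : F →ₐ[k⟦X⟧] A} (hj : IsTimes T j)
include hj

theorem induction {p : A → Prop} (scalar : ∀ r, p (algebraMap k⟦X⟧ A r))
    (gen : ∀ b, ∀ f ∈ augIdeal T, (PowerSeries.X : k⟦X⟧) • b = j f → p b)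
    (add : ∀ a b, p a → p b → p (a + b)) (mul : ∀ a b, p a → p b → p (a * b)) (a : A) : p a := by
  have ha : a ∈ Algebra.adjoin k⟦X⟧ {b | ∃ f ∈ augIdeal T, (PowerSeries.X : k⟦X⟧) • b = j f} := by
    rw [hj.adjoin]
    trivial
  induction ha using Algebra.adjoin_induction with
  | mem x hx =>
    obtain ⟨f, hf, h⟩ := hx
    exact gen x f hf h
  | algebraMap r => exact scalar r
  | add x y _ _ hx hy => exact add x y hx hy
  | mul x y _ _ hx hy => exact mul x y hx hy

/-- Induction with generators `h⁻¹ f`, `ε(f) = 0`. -/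
theorem induction' {p : A → Prop} (scalar : ∀ r, p (algebraMap k⟦X⟧ A r))
    (gen : ∀ b f, T.counit f = 0 → (PowerSeries.X : k⟦X⟧) • b = j f → p b)
    (add : ∀ a b, p a → p b → p (a + b)) (mul : ∀ a b, p a → p b → p (a * b)) (a : A) : p a := by
  refine hj.induction scalar (fun b f hf hb => ?_) add mul a
  obtain ⟨r, hr⟩ := PowerSeries.X_dvd_iff.2 (mem_augIdeal.1 hf)
  have h1 : b = (b - algebraMap k⟦X⟧ A r) + algebraMap k⟦X⟧ A r := by abel
  rw [h1]
  refine add _ _ (gen _ (f - algebraMap k⟦X⟧ F (T.counit f)) (sub_counit_mem T f) ?_) (scalar r)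
  rw [smul_sub, hb, map_sub, AlgHom.commutes, hr, map_mul, Algebra.smul_def]

/-- Elements of `F^×` are fractions `h⁻ⁿ f` with `f ∈ Iⁿ`. Different denominators can be equalised
within this form because `h` itself lies in `I`. -/
theorem exists_mem_pow (a : A) :
    ∃ n, ∃ f ∈ augIdeal T ^ n, (PowerSeries.X ^ n : k⟦X⟧) • a = j f := by
  refine hj.induction (p := fun a => ∃ n, ∃ f ∈ augIdeal T ^ n,
    (PowerSeries.X ^ n : k⟦X⟧) • a = j f) (fun r => ?_) (fun b f hf hb => ?_) (fun a b => ?_)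
    (fun a b => ?_) a
  · exact ⟨0, algebraMap _ _ r, ideal_pow_zero_mem _, by simp⟩
  · exact ⟨1, f, by rwa [Submodule.pow_one], by rwa [pow_one]⟩
  · rintro ⟨m, f, hf, ha⟩ ⟨n, g, hg, hb⟩
    refine ⟨n + m, (PowerSeries.X ^ n : k⟦X⟧) • f + (PowerSeries.X ^ m : k⟦X⟧) • g,
      add_mem (pow_smul_mem_augIdeal_pow T n hf) ?_, ?_⟩
    · rw [add_comm]
      exact pow_smul_mem_augIdeal_pow T m hg
    · rw [smul_add, map_add, map_smul, map_smul, ← ha, ← hb, smul_smul, smul_smul, ← pow_add,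
        ← pow_add, add_comm m n]
  · rintro ⟨m, f, hf, ha⟩ ⟨n, g, hg, hb⟩
    exact ⟨m + n, f * g, ideal_pow_mul_mem hf hg, by
      rw [map_mul, ← ha, ← hb, smul_mul_smul_comm, pow_add]⟩

theorem exists_pow (a : A) : ∃ (n : ℕ) (f : F), (PowerSeries.X ^ n : k⟦X⟧) • a = j f := by
  obtain ⟨n, f, -, h⟩ := hj.exists_mem_pow a
  exact ⟨n, f, h⟩

theorem exists_pow_div (n : ℕ) (f : F) (hf : f ∈ augIdeal T ^ n) :
    ∃ a, (PowerSeries.X ^ n : k⟦X⟧) • a = j f := by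
  refine ideal_pow_induction (J := augIdeal T)
    (p := fun n f => ∃ a, (PowerSeries.X ^ n : k⟦X⟧) • a = j f) (fun a => ⟨j a, by simp⟩)
    ?_ ?_ n f hf
  · rintro n f g ⟨a, ha⟩ ⟨b, hb⟩
    exact ⟨a + b, by rw [smul_add, ha, hb, map_add]⟩
  · rintro n f g - hg ⟨a, ha⟩
    obtain ⟨b, hb⟩ := hj.exists_div g hg
    exact ⟨a * b, by rw [map_mul, ← ha, ← hb, smul_mul_smul_comm, pow_succ]⟩

theorem map_mem_hPow {n : ℕ} {f : F} (hf : f ∈ augIdeal T ^ n) : j f ∈ hPow k A n := by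
  obtain ⟨a, ha⟩ := hj.exists_pow_div n f hf
  exact ⟨a, ha.symm⟩

theorem torsionFree_source : HTorsionFree k F :=
  hj.torsionFree.of_injective j.toLinearMap hj.injective

/-- Extension of a linear map from `F` to `F^×`. -/
theorem exists_extend {M : Type*} [AddCommGroup M] [Module k⟦X⟧ M] (hM : HTorsionFree k M)
    (θ : F →ₗ[k⟦X⟧] M)
    (hθ : ∀ a, ∃ (n : ℕ) (f : F) (m : M), (PowerSeries.X ^ n : k⟦X⟧) • a = j f ∧
      (PowerSeries.X ^ n : k⟦X⟧) • m = θ f) :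
    ∃ θ' : A →ₗ[k⟦X⟧] M, ∀ f, θ' (j f) = θ f := by
  suffices h : ∃ θ' : A →ₗ[k⟦X⟧] M, ∀ a m, (∃ (n : ℕ) (f : F),
      (PowerSeries.X ^ n : k⟦X⟧) • a = j f ∧ (PowerSeries.X ^ n : k⟦X⟧) • m = θ f) ↔ θ' a = m by
    obtain ⟨θ', h⟩ := h
    exact ⟨θ', fun f => (h _ _).1 ⟨0, f, by simp, by simp⟩⟩
  apply exists_linearMap_of_rel
  · intro a
    obtain ⟨n, f, m, h⟩ := hθ a
    exact ⟨m, n, f, h⟩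
  · rintro a m m' ⟨n, f, h1, h2⟩ ⟨n', f', h1', h2'⟩
    have e : (PowerSeries.X ^ n' : k⟦X⟧) • f = (PowerSeries.X ^ n : k⟦X⟧) • f' := by
      apply hj.injective
      rw [map_smul, map_smul, ← h1, ← h1', smul_comm]
    apply hM.pow_cancel (n + n')
    rw [pow_add, mul_smul, mul_smul, h2', ← map_smul, ← e, map_smul, ← h2, smul_comm]
  · rintro a a' m m' ⟨n, f, h1, h2⟩ ⟨n', f', h1', h2'⟩
    refine ⟨n + n', (PowerSeries.X ^ n' : k⟦X⟧) • f + (PowerSeries.X ^ n : k⟦X⟧) • f', ?_, ?_⟩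
    · rw [map_add, map_smul, map_smul, ← h1, ← h1', smul_add, smul_smul, smul_smul, ← pow_add,
        ← pow_add, add_comm n' n]
    · rw [map_add, map_smul, map_smul, ← h2, ← h2', smul_add, smul_smul, smul_smul, ← pow_add,
        ← pow_add, add_comm n' n]
  · rintro r a m ⟨n, f, h1, h2⟩
    exact ⟨n, r • f, by rw [map_smul, ← h1, smul_comm], by rw [map_smul, ← h2, smul_comm]⟩

end IsTimes

/-- Torsion-freeness makes `F` flat, so `F` embeds in `k((h)) ⊗ F`, which is again torsion-free.
After this only the abstract characterisation of `F^×` is used. -/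
theorem isTimes_times (hF : HTorsionFree k F) (T : TopologicalHopfAlgebra k F) :
    IsTimes (A := Times T) T ((Algebra.TensorProduct.includeRight :
      F →ₐ[k⟦X⟧] LaurentSeries k ⊗[k⟦X⟧] F).codRestrict (Times T) (one_tmul_mem_times T)) := by
  have hX : ((PowerSeries.X : k⟦X⟧) : LaurentSeries k) ≠ 0 := by
    rw [PowerSeries.coe_X]
    simp
  have hX' : ∀ a : F, (PowerSeries.X : k⟦X⟧) • ((((PowerSeries.X : k⟦X⟧) : LaurentSeries k)⁻¹)
      ⊗ₜ[k⟦X⟧] a) = (1 : LaurentSeries k) ⊗ₜ a := by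
    intro a
    rw [TensorProduct.smul_tmul']
    congr 1
    rw [Algebra.smul_def]
    exact mul_inv_cancel₀ hX
  have htf : HTorsionFree k (LaurentSeries k ⊗[k⟦X⟧] F) := by
    refine HTorsionFree.tensor (fun m hm => ?_) hF
    rw [Algebra.smul_def, mul_eq_zero] at hm
    exact hm.resolve_left hX
  have htfT : HTorsionFree k (Times T) :=
    htf.of_injective (Times T).val.toLinearMap Subtype.val_injective
  refine ⟨htfT, ?_, fun f hf => ?_, ?_⟩
  · have := hF.flat
    have hinj : Function.Injective (Algebra.TensorProduct.includeRight :
        F →ₐ[k⟦X⟧] LaurentSeries k ⊗[k⟦X⟧] F) :=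
      Algebra.TensorProduct.includeRight_injective (by
        intro a b hab
        exact HahnSeries.ofPowerSeries_injective hab)
    intro a b hab
    exact hinj (congrArg Subtype.val hab)
  · exact ⟨⟨_, Algebra.subset_adjoin ⟨f, mem_augIdeal.1 hf, rfl⟩⟩, Subtype.ext (hX' f)⟩
  · rw [eq_top_iff]
    rintro ⟨a, ha⟩ -
    change a ∈ Algebra.adjoin _ _ at ha
    induction ha using Algebra.adjoin_induction with
    | mem x hx =>
      obtain ⟨f, hf, rfl⟩ := hx
      exact Algebra.subset_adjoin ⟨f, mem_augIdeal.2 hf, Subtype.ext (hX' f)⟩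
    | algebraMap r => exact Subalgebra.algebraMap_mem _ r
    | add x y hx hy h h' => exact add_mem h h'
    | mul x y hx hy h h' => exact mul_mem h h'

end Times

/-! ### The topologies -/

theorem isOpen_hAdic_iff {k M : Type*} [Field k] [AddCommGroup M] [Module k⟦X⟧ M] {U : Set M} :
    IsOpen[hAdicTopology k M] U ↔
      ∀ x ∈ U, ∃ n : ℕ, ∀ y : M, x + (PowerSeries.X ^ n : k⟦X⟧) • y ∈ U := by
  let J : Ideal k⟦X⟧ := Ideal.span {(PowerSeries.X : k⟦X⟧)}
  let B := J.ringFilterBasis.moduleFilterBasis (J.adic_module_basis M)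
  let B' : AddGroupFilterBasis M :=
    @ModuleFilterBasis.toAddGroupFilterBasis k⟦X⟧ M _ J.adic_basis.topology _ _ B
  have hB : ∀ V : Set M, V ∈ B' ↔ ∃ n : ℕ, V = (J ^ n • (⊤ : Submodule k⟦X⟧ M) : Submodule _ M) :=
    fun V => Iff.rfl
  have hmem : ∀ (n : ℕ) (m : M), m ∈ (J ^ n • ⊤ : Submodule k⟦X⟧ M) ↔
        ∃ y, (PowerSeries.X ^ n : k⟦X⟧) • y = m := by
    intro n m
    rw [Ideal.span_singleton_pow, Submodule.ideal_span_singleton_smul,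
      Submodule.mem_smul_pointwise_iff_exists]
    simp
  let := hAdicTopology k M
  rw [isOpen_iff_mem_nhds]
  refine forall₂_congr fun x _ => ?_
  have := (B'.nhds_hasBasis x).mem_iff (t := U)
  refine this.trans ⟨?_, ?_⟩
  · rintro ⟨V, hV, h⟩
    obtain ⟨n, rfl⟩ := (hB V).1 hV
    exact ⟨n, fun y => h ⟨_, (hmem n _).2 ⟨y, rfl⟩, rfl⟩⟩
  · rintro ⟨n, h⟩
    refine ⟨_, (hB _).2 ⟨n, rfl⟩, ?_⟩
    rintro _ ⟨m, hm, rfl⟩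
    obtain ⟨y, rfl⟩ := (hmem n m).1 hm
    exact h y

theorem isOpen_hAdic_of_hPow_le {k M : Type*} [Field k] [Ring M] [Algebra k⟦X⟧ M]
    (S : AddSubgroup M) (n : ℕ) (h : ∀ a ∈ hPow k M n, a ∈ S) :
    IsOpen[hAdicTopology k M] (S : Set M) :=
  isOpen_hAdic_iff.2 fun _ hx => ⟨n, fun y => add_mem hx (h _ (pow_smul_mem_hPow n y))⟩

/-! ### The weak topology on `k[[h]]^E` -/

section WeakProduct

variable {k F : Type*} [Field k] [Ring F] [Algebra k⟦X⟧ F] [t : TopologicalSpace F]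

theorem isOpen_weak_iff {E : Type*} (e : F ≃ₗ[k⟦X⟧] (E → k⟦X⟧))
    (ht : t = TopologicalSpace.induced e (@Pi.topologicalSpace E _ fun _ => hAdicTopology k k⟦X⟧))
    {U : Set F} : IsOpen U ↔ ∀ x ∈ U, ∃ (S : Finset E) (n : ℕ), ∀ y,
      (∀ s ∈ S, (PowerSeries.X : k⟦X⟧) ^ n ∣ e y s) → x + y ∈ U := by
  let := hAdicTopology k k⟦X⟧
  subst ht
  rw [isOpen_induced_iff]
  constructor
  · rintro ⟨V, hV, rfl⟩ x hx
    obtain ⟨S, u, hu, hS⟩ := isOpen_pi_iff.1 hV _ hx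
    have h1 : ∀ s : E, ∃ n : ℕ, s ∈ S → ∀ y, e x s + (PowerSeries.X : k⟦X⟧) ^ n • y ∈ u s := by
      intro s
      by_cases hs : s ∈ S
      · obtain ⟨n, hn⟩ := isOpen_hAdic_iff.1 (hu s hs).1 _ (hu s hs).2
        exact ⟨n, fun _ => hn⟩
      · exact ⟨0, fun h => absurd h hs⟩
    choose n hn using h1
    refine ⟨S, S.sup n, fun y hy => hS fun s hs => ?_⟩
    obtain ⟨r, hr⟩ := (pow_dvd_pow _ (Finset.le_sup (f := n) hs)).trans (hy s hs)
    rw [map_add, Pi.add_apply, hr]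
    exact hn s hs r
  · intro h
    choose! S n hS using h
    refine ⟨⋃ x ∈ U, (S x : Set E).pi fun s => {z | (PowerSeries.X : k⟦X⟧) ^ n x ∣ z - e x s},
      ?_, ?_⟩
    · refine isOpen_biUnion fun x _ => isOpen_set_pi (S x).finite_toSet fun s _ => ?_
      refine isOpen_hAdic_iff.2 fun z hz => ⟨n x, fun y => ?_⟩
      change (PowerSeries.X : k⟦X⟧) ^ n x ∣ z + _ - e x s
      rw [add_sub_right_comm]
      exact dvd_add hz (Dvd.intro _ rfl)
    · ext y
      simp only [Set.mem_preimage, Set.mem_iUnion, exists_prop]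
      constructor
      · rintro ⟨x, hx, hy⟩
        have := hS x hx (y - x) fun s hs => by
          rw [map_sub]
          exact hy s hs
        rwa [add_sub_cancel] at this
      · intro hy
        exact ⟨y, hy, fun s _ => by simp⟩

variable (hW : IsWeakProduct k F)
include hW

theorem IsWeakProduct.torsionFree : HTorsionFree k F := by
  obtain ⟨E, e, -⟩ := hW
  refine HTorsionFree.of_injective (N := E → k⟦X⟧) (fun m hm => funext fun s => ?_) e.toLinearMap
    e.injective
  exact hTorsionFree_powerSeries _ (congrFun hm s)

theorem IsWeakProduct.isOpen_ideal (J : Ideal F) (U : Set F) (hU : IsOpen U) (h0 : 0 ∈ U)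
    (hUJ : U ⊆ J) : IsOpen (J : Set F) := by
  obtain ⟨E, e, ht⟩ := hW
  rw [isOpen_weak_iff e ht] at hU ⊢
  obtain ⟨S, n, h⟩ := hU 0 h0
  refine fun x hx => ⟨S, n, fun y hy => add_mem hx (hUJ ?_)⟩
  simpa using h y hy

theorem IsWeakProduct.exists_hPow_le (U : Set F) (hU : IsOpen U) (h0 : 0 ∈ U) :
    ∃ n, ∀ a ∈ hPow k F n, a ∈ U := by
  obtain ⟨E, e, ht⟩ := hW
  rw [isOpen_weak_iff e ht] at hU
  obtain ⟨S, n, h⟩ := hU 0 h0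
  refine ⟨n, ?_⟩
  rintro _ ⟨b, rfl⟩
  have := h ((PowerSeries.X ^ n : k⟦X⟧) • b) fun s _ => by
    rw [map_smul]
    exact Dvd.intro _ rfl
  simpa using this

/-- Division by `h` is continuous on `hF`: it suffices to raise by one the order required of the
finitely many coordinates defining a neighbourhood of `0`. -/
theorem IsWeakProduct.exists_isOpen_smul (U : Set F) (hU : IsOpen U) (h0 : 0 ∈ U) :
    ∃ V : Set F, IsOpen V ∧ 0 ∈ V ∧ ∀ f, (PowerSeries.X : k⟦X⟧) • f ∈ V → f ∈ U := by
  obtain ⟨E, e, ht⟩ := hW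
  rw [isOpen_weak_iff e ht] at hU
  obtain ⟨S, n, h⟩ := hU 0 h0
  refine ⟨{f | ∀ s ∈ S, (PowerSeries.X : k⟦X⟧) ^ (n + 1) ∣ e f s}, ?_, fun s _ => by simp, ?_⟩
  · rw [isOpen_weak_iff e ht]
    refine fun x hx => ⟨S, n + 1, fun y hy s hs => ?_⟩
    rw [map_add]
    exact dvd_add (hx s hs) (hy s hs)
  · intro f hf
    have := h f fun s hs => by
      have h1 := hf s hs
      rw [map_smul, pow_succ', Pi.smul_apply, smul_eq_mul] at h1
      exact (mul_dvd_mul_iff_left PowerSeries.X_ne_zero).1 h1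
    simpa using this

theorem IsWeakProduct.exists_isOpen_notMem (f : F) (hf : f ≠ 0) :
    ∃ U : Set F, IsOpen U ∧ 0 ∈ U ∧ f ∉ U := by
  obtain ⟨E, e, ht⟩ := hW
  obtain ⟨s, hs⟩ : ∃ s, e f s ≠ 0 := by
    by_contra! h
    exact hf (e.injective (by rw [map_zero]; exact funext h))
  obtain ⟨n, hn⟩ : ∃ n, ¬ (PowerSeries.X : k⟦X⟧) ^ n ∣ e f s := by
    by_contra! h
    exact hs (isHComplete_powerSeries.separated _ h)
  refine ⟨{f | (PowerSeries.X : k⟦X⟧) ^ n ∣ e f s}, ?_, by simp, hn⟩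
  rw [isOpen_weak_iff e ht]
  refine fun x hx => ⟨{s}, n, fun y hy => ?_⟩
  change (PowerSeries.X : k⟦X⟧) ^ n ∣ e (x + y) s
  rw [map_add]
  exact dvd_add hx (hy s (Finset.mem_singleton_self s))

end WeakProduct

/-! ### Division in power series rings -/

section PowerSeriesDivision

variable {k : Type*} [Field k] {n : ℕ}

/-- The exponents of degree `D`. -/
def expOfDegree (n D : ℕ) : Finset (Fin n →₀ ℕ) := (Finsupp.finite_of_degree_eq D).toFinset

@[simp] theorem mem_expOfDegree {D : ℕ} {d : Fin n →₀ ℕ} :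
    d ∈ expOfDegree n D ↔ d.degree = D := by
  simp [expOfDegree]

/-- A chosen exponent of degree `D` below `e`. -/
def expBelow (D : ℕ) (e : Fin n →₀ ℕ) : Fin n →₀ ℕ :=
  if h : D ≤ e.degree then (Finsupp.exists_le_degree_eq e D h).choose else 0

/-- The default value `0` also lies below `e`, so no condition on the degree is needed. -/
theorem expBelow_le (D : ℕ) (e : Fin n →₀ ℕ) : expBelow D e ≤ e := by
  rw [expBelow]
  split_ifs with h
  · exact (Finsupp.exists_le_degree_eq e D h).choose_spec.1
  · exact zero_le

theorem expBelow_degree {D : ℕ} {e : Fin n →₀ ℕ} (h : D ≤ e.degree) :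
    (expBelow D e).degree = D := by
  rw [expBelow, dif_pos h]
  exact (Finsupp.exists_le_degree_eq e D h).choose_spec.2

/-- Power series all of whose terms have degree at least `D`. -/
def OrderGE (D : ℕ) (f : MvPowerSeries (Fin n) k) : Prop :=
  ∀ e, e.degree < D → MvPowerSeries.coeff e f = 0

/-- Every exponent of degree at least `D` is assigned to one divisor of degree `D` by `expBelow`;
the terms of `f` assigned to `d`, divided by `x^d`, make up the quotient `q d`. -/
theorem exists_eq_sum_monomial_mul (D : ℕ) (f : MvPowerSeries (Fin n) k) (hf : OrderGE D f) :
    ∃ q : (Fin n →₀ ℕ) → MvPowerSeries (Fin n) k,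
      f = ∑ d ∈ expOfDegree n D, MvPowerSeries.monomial d 1 * q d := by
  classical
  let q : (Fin n →₀ ℕ) → MvPowerSeries (Fin n) k := fun d p =>
    if expBelow D (p + d) = d then MvPowerSeries.coeff (p + d) f else 0
  have hq : ∀ d p, MvPowerSeries.coeff p (q d)
      = if expBelow D (p + d) = d then MvPowerSeries.coeff (p + d) f else 0 := fun _ _ => rfl
  refine ⟨q, ?_⟩
  ext e
  rw [map_sum]
  have h1 : ∀ d ∈ expOfDegree n D, MvPowerSeries.coeff e (MvPowerSeries.monomial d (1 : k) * q d) = if expBelow D e = d then MvPowerSeries.coeff e f else 0 := by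
    intro d _
    rw [MvPowerSeries.coeff_monomial_mul]
    by_cases h : d ≤ e
    · rw [if_pos h, one_mul, hq, tsub_add_cancel_of_le h]
    · rw [if_neg h, if_neg]
      rintro rfl
      exact h (expBelow_le D e)
  rw [Finset.sum_congr rfl h1, Finset.sum_ite_eq]
  split_ifs with h
  · rfl
  · refine hf e ?_
    by_contra hlt
    exact h (mem_expOfDegree.2 (expBelow_degree (not_lt.1 hlt)))

/-- The syzygies between the monomials of degree `D` are generated by the obvious ones. -/
theorem exists_syzygy (D : ℕ) (f : (Fin n →₀ ℕ) → MvPowerSeries (Fin n) k)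
    (hf : ∑ d ∈ expOfDegree n D, MvPowerSeries.monomial d 1 * f d = 0) :
    ∃ q : (Fin n →₀ ℕ) → (Fin n →₀ ℕ) → MvPowerSeries (Fin n) k,
      (∀ d ∈ expOfDegree n D, f d =
        ∑ d' ∈ expOfDegree n D, MvPowerSeries.monomial (d ⊔ d' - d) 1 * q d d') ∧
      ∀ d' ∈ expOfDegree n D,
        ∑ d ∈ expOfDegree n D, MvPowerSeries.monomial (d ⊔ d' - d') 1 * q d d' = 0 := by
  classical
  -- `q d d'` collects the terms of `f d` whose product with `x^d` is assigned to `d'`. Such a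
  -- product is divisible by both `x^d` and `x^{d'}`, so the term itself is divisible by `x^{d ⊔ d'
  -- - d}`.
  let q : (Fin n →₀ ℕ) → (Fin n →₀ ℕ) → MvPowerSeries (Fin n) k := fun d d' p =>
    if expBelow D (p + (d ⊔ d')) = d' then MvPowerSeries.coeff (p + (d ⊔ d' - d)) (f d) else 0
  have hq : ∀ d d' p, MvPowerSeries.coeff p (q d d') = if expBelow D (p + (d ⊔ d')) = d' then
      MvPowerSeries.coeff (p + (d ⊔ d' - d)) (f d) else 0 := fun _ _ _ => rfl
  refine ⟨q, fun d hd => ?_, fun d' hd' => ?_⟩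
  · ext p
    rw [map_sum]
    have h1 : ∀ d' ∈ expOfDegree n D, MvPowerSeries.coeff p
        (MvPowerSeries.monomial (d ⊔ d' - d) (1 : k) * q d d')
        = if expBelow D (p + d) = d' then MvPowerSeries.coeff p (f d) else 0 := by
      intro d' _
      rw [MvPowerSeries.coeff_monomial_mul]
      by_cases h : d ⊔ d' - d ≤ p
      · rw [if_pos h, one_mul, hq, tsub_add_cancel_of_le h]
        have : p - (d ⊔ d' - d) + (d ⊔ d') = p + d := by
          ext i
          have := h i
          simp only [Finsupp.coe_tsub, Finsupp.coe_add, Pi.add_apply, Pi.sub_apply,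
            Finsupp.sup_apply] at *
          omega
        rw [this]
      · rw [if_neg h, if_neg]
        rintro rfl
        apply h
        have h2 := expBelow_le D (p + d)
        rw [tsub_le_iff_right]
        exact sup_le le_add_self h2
    rw [Finset.sum_congr rfl h1, Finset.sum_ite_eq, if_pos]
    rw [mem_expOfDegree] at hd ⊢
    exact expBelow_degree (by rw [map_add, hd]; exact le_add_self)
  · ext p
    rw [map_sum, map_zero]
    -- After multiplication by `x^{d'}` the sum becomes the part of `∑ x^d f_d` assigned to `d'`,
    -- and the whole of `∑ x^d f_d` vanishes.
    have h1 : ∀ d ∈ expOfDegree n D, MvPowerSeries.coeff p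
        (MvPowerSeries.monomial (d ⊔ d' - d') (1 : k) * q d d')
        = if expBelow D (p + d') = d' then MvPowerSeries.coeff (p + d')
          (MvPowerSeries.monomial d (1 : k) * f d) else 0 := by
      intro d _
      rw [MvPowerSeries.coeff_monomial_mul, MvPowerSeries.coeff_monomial_mul]
      have hiff : d ⊔ d' - d' ≤ p ↔ d ≤ p + d' := by
        rw [tsub_le_iff_right, sup_le_iff]
        exact and_iff_left le_add_self
      simp only [hiff]
      by_cases h : d ≤ p + d'
      · have h2 := hiff.2 h
        have e1 : p - (d ⊔ d' - d') + (d ⊔ d') = p + d' := by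
          ext i
          have := h2 i
          simp only [Finsupp.coe_tsub, Finsupp.coe_add, Pi.add_apply, Pi.sub_apply,
            Finsupp.sup_apply] at *
          omega
        have e2 : p - (d ⊔ d' - d') + (d ⊔ d' - d) = p + d' - d := by
          ext i
          have := h2 i
          have := h i
          simp only [Finsupp.coe_tsub, Finsupp.coe_add, Pi.add_apply, Pi.sub_apply,
            Finsupp.sup_apply] at *
          omega
        rw [if_pos h, if_pos h, hq, e1, e2, one_mul, one_mul]
      · rw [if_neg h, if_neg h, ite_self]
    rw [Finset.sum_congr rfl h1]
    by_cases hc : expBelow D (p + d') = d'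
    · simp only [if_pos hc]
      rw [← map_sum, hf, map_zero]
    · simp only [if_neg hc, Finset.sum_const_zero]

end PowerSeriesDivision

/-! ### Formal coordinates -/

section FormalCoordinates

/-- The ordered monomial `y₁^{d₁} ⋯ yₙ^{dₙ}`. -/
def orderedMonomial {A : Type*} [Monoid A] {n : ℕ} (y : Fin n → A) (d : Fin n →₀ ℕ) : A :=
  (List.ofFn fun j => y j ^ d j).prod

theorem map_orderedMonomial {A B G : Type*} [Monoid A] [Monoid B] [FunLike G A B]
    [MonoidHomClass G A B] (f : G) {n : ℕ} (y : Fin n → A) (d : Fin n →₀ ℕ) :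
    f (orderedMonomial y d) = orderedMonomial (fun j => f (y j)) d := by
  rw [orderedMonomial, map_list_prod, List.map_ofFn]
  simp only [orderedMonomial, Function.comp_def, map_pow]

theorem orderedMonomial_X {k : Type*} [Field k] {n : ℕ} (d : Fin n →₀ ℕ) :
    orderedMonomial (fun j => (MvPowerSeries.X j : MvPowerSeries (Fin n) k)) d
      = MvPowerSeries.monomial d 1 := by
  rw [orderedMonomial, List.prod_ofFn, MvPowerSeries.monomial_one_eq, Finsupp.prod_fintype]
  simp

theorem list_ofFn_prod_mem {F : Type*} [Ring F] {J : Ideal F} [J.IsTwoSided] :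
    ∀ {n : ℕ} (y : Fin n → F) (m : Fin n → ℕ), (∀ j, y j ∈ J ^ m j) →
      (List.ofFn y).prod ∈ J ^ (∑ j, m j) := by
  intro n
  induction n with
  | zero => exact fun y m _ => by simpa using ideal_pow_zero_mem _
  | succ n ih =>
    intro y m h
    rw [List.ofFn_succ, List.prod_cons, Fin.sum_univ_succ]
    exact ideal_pow_mul_mem (h 0) (ih _ _ fun j => h j.succ)

theorem pow_mem_ideal_pow {F : Type*} [Ring F] {J : Ideal F} [J.IsTwoSided] {a : F} (ha : a ∈ J)
    (n : ℕ) : a ^ n ∈ J ^ n := by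
  induction n with
  | zero => exact ideal_pow_zero_mem _
  | succ n ih =>
    rw [pow_succ]
    exact ideal_mul_mem_pow_succ ih ha

theorem orderedMonomial_mem {F : Type*} [Ring F] {J : Ideal F} [J.IsTwoSided] {n : ℕ}
    {y : Fin n → F} (hy : ∀ j, y j ∈ J) (d : Fin n →₀ ℕ) :
    orderedMonomial y d ∈ J ^ d.degree := by
  rw [Finsupp.degree_eq_sum]
  exact list_ofFn_prod_mem _ _ fun j => pow_mem_ideal_pow (hy j) _

variable {k F : Type*} [Field k] [Ring F] [Algebra k⟦X⟧ F] [t : TopologicalSpace F] {n : ℕ}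
  {π : F →+* MvPowerSeries (Fin n) k}

namespace IsFormalCoordinates

variable (hπ : IsFormalCoordinates k π)
include hπ

theorem surjective : Function.Surjective π :=
  @IsOpenQuotientMap.surjective _ _ _ (_) _ hπ.2.2

theorem map_X_smul (f : F) : π ((PowerSeries.X : k⟦X⟧) • f) = 0 := (hπ.1 _).2 ⟨f, rfl⟩

theorem exists_smul_of_map_eq {f g : F} (h : π f = π g) :
    ∃ b, f - g = (PowerSeries.X : k⟦X⟧) • b := (hπ.1 _).1 (by rw [map_sub, h, sub_self])

theorem exists_commutator (f g : F) : ∃ b, f * g - g * f = (PowerSeries.X : k⟦X⟧) • b :=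
  (hπ.1 _).1 (by rw [map_sub, map_mul, map_mul, mul_comm, sub_self])

/-- A power series with nonzero constant term is a unit. If `ε(f)` vanished modulo `h` while `π f`
were a unit, an equation `f g = 1 + h b` would give `0 = 1` under the counit. So the residue of the
counit is the constant term in every system of coordinates. -/
theorem constantCoeff_eq (T : TopologicalHopfAlgebra k F) (f : F) :
    MvPowerSeries.constantCoeff (π f) = counitZero T f := by
  have key : ∀ f, counitZero T f = 0 → MvPowerSeries.constantCoeff (π f) = 0 := by
    intro f hf
    by_contra hne
    have hu : IsUnit (π f) := by
      rw [MvPowerSeries.isUnit_iff_constantCoeff]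
      exact isUnit_iff_ne_zero.2 hne
    obtain ⟨q, hq⟩ := hu.exists_right_inv
    obtain ⟨g, rfl⟩ := hπ.surjective q
    rw [← map_mul, ← map_one π] at hq
    obtain ⟨b, hb⟩ := hπ.exists_smul_of_map_eq hq
    have := congrArg (counitZero T) hb
    rw [map_sub, map_mul, hf, counitZero_smul] at this
    simp at this
  have h1 := key (f - algebraMap k⟦X⟧ F (PowerSeries.C (counitZero T f))) (by
    rw [map_sub, sub_eq_zero]
    simp [counitZero_apply])
  rw [map_sub, map_sub, hπ.2.1] at h1
  simpa [sub_eq_zero] using h1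

theorem mem_augIdeal_iff (T : TopologicalHopfAlgebra k F) (f : F) :
    f ∈ augIdeal T ↔ MvPowerSeries.constantCoeff (π f) = 0 := by
  rw [hπ.constantCoeff_eq T]
  exact mem_augIdeal

theorem orderGE_of_mem (T : TopologicalHopfAlgebra k F) (D : ℕ) (f : F)
    (hf : f ∈ augIdeal T ^ D) : OrderGE D (π f) := by
  classical
  refine ideal_pow_induction (J := augIdeal T) (p := fun D f => OrderGE D (π f))
    (fun a e he => absurd he (Nat.not_lt_zero _)) (fun D a b ha hb e he => ?_)
    (fun D a b _ hb ha e he => ?_) D f hf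
  · rw [map_add, map_add, ha e he, hb e he, add_zero]
  · rw [map_mul, MvPowerSeries.coeff_mul]
    refine Finset.sum_eq_zero fun p hp => ?_
    rw [Finset.HasAntidiagonal.mem_antidiagonal] at hp
    by_cases h : p.1.degree < D
    · rw [ha _ h, zero_mul]
    · have h0 : p.2.degree = 0 := by
        rw [← hp, map_add] at he
        omega
      rw [Finsupp.degree_eq_zero_iff] at h0
      rw [h0, MvPowerSeries.coeff_zero_eq_constantCoeff_apply, (hπ.mem_augIdeal_iff T b).1 hb,
        mul_zero]

theorem mem_augIdeal_of_X (T : TopologicalHopfAlgebra k F) {x : F} {j : Fin n}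
    (hx : π x = MvPowerSeries.X j) : x ∈ augIdeal T := by
  rw [hπ.mem_augIdeal_iff T, hx, MvPowerSeries.constantCoeff_X]

theorem map_orderedMonomial_eq {x : Fin n → F} (hx : ∀ j, π (x j) = MvPowerSeries.X j)
    (d : Fin n →₀ ℕ) : π (orderedMonomial x d) = MvPowerSeries.monomial d 1 := by
  rw [map_orderedMonomial]
  simp only [hx]
  exact orderedMonomial_X d

theorem exists_eq_sum_add {x : Fin n → F} (hx : ∀ j, π (x j) = MvPowerSeries.X j) (D : ℕ) (f : F)
    (hf : OrderGE D (π f)) : ∃ (q : (Fin n →₀ ℕ) → F) (b : F),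
      f = ∑ d ∈ expOfDegree n D, orderedMonomial x d * q d + (PowerSeries.X : k⟦X⟧) • b := by
  obtain ⟨p, hp⟩ := exists_eq_sum_monomial_mul D (π f) hf
  choose q hq using fun d => hπ.surjective (p d)
  obtain ⟨b, hb⟩ := hπ.exists_smul_of_map_eq
    (f := f) (g := ∑ d ∈ expOfDegree n D, orderedMonomial x d * q d) (by
      rw [hp, map_sum]
      exact Finset.sum_congr rfl fun d _ => by rw [map_mul, hπ.map_orderedMonomial_eq hx, hq])
  exact ⟨q, b, by rw [← hb]; abel⟩

theorem exists_lift : ∃ x : Fin n → F, ∀ j, π (x j) = MvPowerSeries.X j := by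
  choose x hx using fun j : Fin n => hπ.surjective (MvPowerSeries.X j)
  exact ⟨x, hx⟩

theorem sum_orderedMonomial_mem (T : TopologicalHopfAlgebra k F) {x : Fin n → F}
    (hx : ∀ j, π (x j) = MvPowerSeries.X j) (D : ℕ) (q : (Fin n →₀ ℕ) → F) :
    ∑ d ∈ expOfDegree n D, orderedMonomial x d * q d ∈ augIdeal T ^ D := by
  refine sum_mem fun d hd => ?_
  have := ideal_pow_mul_mem (J := augIdeal T) (n := 0)
    (orderedMonomial_mem (fun j => hπ.mem_augIdeal_of_X T (hx j)) d) (ideal_pow_zero_mem (q d))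
  rwa [mem_expOfDegree.1 hd] at this

/-- The map `π` is open, so the image of `U` is a neighbourhood of `0`, and such a neighbourhood
constrains only finitely many coefficients. -/
theorem exists_orderGE_lift (U : Set F) (hU : IsOpen U) (h0 : 0 ∈ U) :
    ∃ D, ∀ p, OrderGE D p → ∃ f ∈ U, π f = p := by
  let : TopologicalSpace k := ⊥
  have : DiscreteTopology k := ⟨rfl⟩
  let := MvPowerSeries.WithPiTopology.instTopologicalSpace (σ := Fin n) k
  have h1 : IsOpen (π '' U) :=
    hπ.2.2.isOpenMap U hU
  obtain ⟨S, u, hu, hS⟩ := isOpen_pi_iff.1 h1 0 ⟨0, h0, map_zero π⟩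
  refine ⟨S.sup (fun d => d.degree) + 1, fun p hp => hS fun d hd => ?_⟩
  have : p d = 0 := hp d (Nat.lt_succ_of_le (Finset.le_sup (f := fun d => d.degree) hd))
  rw [this]
  exact (hu d hd).2

theorem isOpen_orderGE (D : ℕ) : IsOpen {f : F | OrderGE D (π f)} := by
  let : TopologicalSpace k := ⊥
  have : DiscreteTopology k := ⟨rfl⟩
  let := MvPowerSeries.WithPiTopology.instTopologicalSpace (σ := Fin n) k
  have hc : Continuous π := hπ.2.2.continuous
  have h1 : {f : F | OrderGE D (π f)} = ⋂ e ∈ {e : Fin n →₀ ℕ | e.degree < D},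
      {f : F | MvPowerSeries.coeff e (π f) = 0} := by
    ext f
    simp [OrderGE]
  rw [h1]
  refine (Finsupp.finite_of_degree_lt D).isOpen_biInter fun e _ => ?_
  exact (isOpen_discrete ({0} : Set k)).preimage
    ((MvPowerSeries.WithPiTopology.continuous_coeff k e).comp hc)

end IsFormalCoordinates

/-! ### The powers of the augmentation ideal define the topology -/

/-- Modulo `h`, the image of `I^D` consists of series of order at least `D`, which for large `D`
lift into `O`; so `I^D ⊆ O + hF`. Taking powers gives `I^{Dm} ⊆ O + h^m F`, and `h^M F ⊆ O` for some
`M`. -/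
theorem exists_augIdeal_pow_le (hW : IsWeakProduct k F) (hπ : IsFormalCoordinates k π)
    (T : TopologicalHopfAlgebra k F) (O : OpenIdeal F) : ∃ D, augIdeal T ^ D ≤ O.toIdeal := by
  obtain ⟨D, hD⟩ := hπ.exists_orderGE_lift _ O.isOpen (zero_mem _)
  obtain ⟨M, hM⟩ := hW.exists_hPow_le _ O.isOpen (zero_mem _)
  have h1 : augIdeal T ^ D ≤ O.toIdeal ⊔ hPow k F 1 := by
    intro f hf
    obtain ⟨g, hg, hgf⟩ := hD _ (hπ.orderGE_of_mem T D f hf)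
    obtain ⟨b, hb⟩ := hπ.exists_smul_of_map_eq hgf.symm
    exact Submodule.mem_sup.2 ⟨g, hg, f - g, mem_hPow_one.2 ⟨b, hb⟩, by abel⟩
  have h2 : ∀ m, augIdeal T ^ (D * m) ≤ O.toIdeal ⊔ hPow k F m := by
    intro m
    induction m with
    | zero => exact fun f _ => Submodule.mem_sup_right (mem_hPow_zero f)
    | succ m ih =>
      rw [Nat.mul_succ, Ideal.IsTwoSided.pow_add, Ideal.mul_le]
      intro r hr s hs
      obtain ⟨o, ho, a, ha, rfl⟩ := Submodule.mem_sup.1 (ih hr)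
      obtain ⟨o', ho', b, hb, rfl⟩ := Submodule.mem_sup.1 (h1 hs)
      refine Submodule.mem_sup.2 ⟨o * (o' + b) + a * o', add_mem (O.toIdeal.mul_mem_right _ ho)
        (O.toIdeal.mul_mem_left _ ho'), a * b, hPow_mul_mem ha hb, by noncomm_ring⟩
  exact ⟨D * M, (h2 M).trans (sup_le le_rfl fun a ha => hM a ha)⟩

/-- By induction on `m`, the ideal `Iᴺ + h^m F` contains an open ideal; at `m = N` it is `Iᴺ`, as
`hᴺ F ⊆ Iᴺ`. In the inductive step an `f` of high order is `s + h b` with `s` in a high power of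
`I`. That power lies in the small open ideal `O'`, so `h b ∈ O'`, and continuity of division by `h`
brings `b` into the open ideal already found. -/
theorem isOpen_augIdeal_pow (hW : IsWeakProduct k F) (hπ : IsFormalCoordinates k π)
    (T : TopologicalHopfAlgebra k F) (N : ℕ) : IsOpen ((augIdeal T ^ N : Ideal F) : Set F) := by
  obtain ⟨x, hx⟩ := hπ.exists_lift
  have key : ∀ m, ∃ O : OpenIdeal F, O.toIdeal ≤ augIdeal T ^ N ⊔ hPow k F m := by
    intro m
    induction m with
    | zero =>
      obtain ⟨O, -⟩ := T.ideal_basis Set.univ Filter.univ_mem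
      exact ⟨O, fun f _ => Submodule.mem_sup_right (mem_hPow_zero f)⟩
    | succ m ih =>
      obtain ⟨O, hO⟩ := ih
      obtain ⟨V, hV, hV0, hVO⟩ := hW.exists_isOpen_smul _ O.isOpen (zero_mem _)
      obtain ⟨O', hO'⟩ := T.ideal_basis V (hV.mem_nhds hV0)
      obtain ⟨D, hD⟩ := exists_augIdeal_pow_le hW hπ T O'
      obtain ⟨P, hP⟩ := T.ideal_basis ({f | OrderGE (max N D) (π f)} ∩ O'.toIdeal)
        (((hπ.isOpen_orderGE _).inter O'.isOpen).mem_nhds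
          ⟨fun e _ => by rw [map_zero, map_zero], zero_mem _⟩)
      refine ⟨P, fun f hf => ?_⟩
      obtain ⟨hf1, hf2⟩ := hP hf
      obtain ⟨q, b, hqb⟩ := hπ.exists_eq_sum_add hx _ f hf1
      have hs := hπ.sum_orderedMonomial_mem T hx (max N D) q
      set s := ∑ d ∈ expOfDegree n (max N D), orderedMonomial x d * q d
      have hb : (PowerSeries.X : k⟦X⟧) • b ∈ O'.toIdeal := by
        rw [← sub_eq_of_eq_add' hqb]
        exact sub_mem hf2 (hD (Ideal.pow_le_pow_right (le_max_right N D) hs))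
      obtain ⟨c, hc, d, hd, hcd⟩ := Submodule.mem_sup.1 (hO (hVO b (hO' hb)))
      refine Submodule.mem_sup.2 ⟨s + (PowerSeries.X : k⟦X⟧) • c,
        add_mem (Ideal.pow_le_pow_right (le_max_left N D) hs) (ideal_smul_mem _ hc),
        (PowerSeries.X : k⟦X⟧) • d, ?_, ?_⟩
      · simpa using pow_smul_mem_hPow_add 1 hd
      · rw [hqb, ← hcd, smul_add, add_assoc]
  obtain ⟨O, hO⟩ := key N
  exact hW.isOpen_ideal _ O.toIdeal O.isOpen (zero_mem _)
    (hO.trans (sup_le le_rfl (hPow_le_augIdeal_pow T N)))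

theorem eq_zero_of_mem_augIdeal_pow (hW : IsWeakProduct k F) (hπ : IsFormalCoordinates k π)
    (T : TopologicalHopfAlgebra k F) (f : F) (hf : ∀ N, f ∈ augIdeal T ^ N) : f = 0 := by
  by_contra hne
  obtain ⟨U, hU, h0, hfU⟩ := hW.exists_isOpen_notMem f hne
  obtain ⟨O, hO⟩ := T.ideal_basis U (hU.mem_nhds h0)
  obtain ⟨D, hD⟩ := exists_augIdeal_pow_le hW hπ T O
  exact hfU (hO (hD (hf D)))

end FormalCoordinates

/-! ### Ordered monomials -/

section OrderedMonomials

variable {n : ℕ}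

/-- The indices of the factors of an ordered monomial. -/
def expList (d : Fin n →₀ ℕ) : List (Fin n) :=
  (List.ofFn fun j => List.replicate (d j) j).flatten

theorem count_expList (d : Fin n →₀ ℕ) (j : Fin n) : (expList d).count j = d j := by
  rw [expList, List.count_flatten, List.map_ofFn, List.sum_ofFn, Finset.sum_eq_single j]
  · simp
  · intro i _ hij
    simp [List.count_replicate, hij]
  · simp

theorem length_expList (d : Fin n →₀ ℕ) : (expList d).length = d.degree := by
  rw [expList, List.length_flatten, List.map_ofFn, List.sum_ofFn, Finsupp.degree_eq_sum]
  simp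

theorem orderedMonomial_eq_prod {A : Type*} [Monoid A] (y : Fin n → A) (d : Fin n →₀ ℕ) :
    orderedMonomial y d = ((expList d).map y).prod := by
  rw [orderedMonomial, expList, List.map_flatten, List.prod_flatten, List.map_map, List.map_ofFn]
  simp [Function.comp_def]

theorem expList_add_perm (d e : Fin n →₀ ℕ) : (expList d ++ expList e).Perm (expList (d + e)) := by
  rw [List.perm_iff_count]
  intro j
  rw [List.count_append, count_expList, count_expList, count_expList, Finsupp.add_apply]

theorem orderedMonomial_zero {A : Type*} [Monoid A] (y : Fin n → A) :
    orderedMonomial y 0 = 1 := by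
  simp [orderedMonomial]

theorem smul_list_map_prod {R A ι : Type*} [CommRing R] [Ring A] [Algebra R A] (r : R)
    (y : ι → A) (l : List ι) :
    (l.map fun i => r • y i).prod = r ^ l.length • (l.map y).prod := by
  induction l with
  | nil => simp
  | cons i l ih =>
    rw [List.map_cons, List.prod_cons, ih, List.map_cons, List.prod_cons, List.length_cons,
      smul_mul_smul_comm, pow_succ']

theorem orderedMonomial_smul {R A : Type*} [CommRing R] [Ring A] [Algebra R A] (r : R)
    (y : Fin n → A) (d : Fin n →₀ ℕ) :
    orderedMonomial (fun j => r • y j) d = r ^ d.degree • orderedMonomial y d := by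
  rw [orderedMonomial_eq_prod, orderedMonomial_eq_prod, smul_list_map_prod, length_expList]

end OrderedMonomials

section OrderedEval

variable {k A : Type*} [Field k] [Ring A] [Algebra k⟦X⟧ A] {n : ℕ}

theorem orderedEval_eq_sum (y : Fin n → A) (P : MvPolynomial (Fin n) k)
    (S : Finset (Fin n →₀ ℕ)) (hS : P.support ⊆ S) :
    orderedEval y P = ∑ d ∈ S, (PowerSeries.C (P.coeff d) : k⟦X⟧) • orderedMonomial y d := by
  refine Finset.sum_subset hS fun d _ hd => ?_
  rw [MvPolynomial.notMem_support_iff.1 hd, map_zero, zero_smul]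

/-- Evaluation on ordered monomials, as an additive map. -/
def orderedEvalHom (y : Fin n → A) : MvPolynomial (Fin n) k →+ A where
  toFun := orderedEval y
  map_zero' := by simp [orderedEval]
  map_add' P Q := by
    classical
    rw [orderedEval_eq_sum y P (P.support ∪ Q.support) Finset.subset_union_left,
      orderedEval_eq_sum y Q (P.support ∪ Q.support) Finset.subset_union_right,
      orderedEval_eq_sum y (P + Q) _ MvPolynomial.support_add, ← Finset.sum_add_distrib]
    simp only [MvPolynomial.coeff_add, map_add, add_smul]

@[simp] theorem orderedEvalHom_apply (y : Fin n → A) (P : MvPolynomial (Fin n) k) :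
    orderedEvalHom y P = orderedEval y P := rfl

theorem orderedEval_smul (y : Fin n → A) (c : k) (P : MvPolynomial (Fin n) k) :
    orderedEval y (c • P) = (PowerSeries.C c : k⟦X⟧) • orderedEval y P := by
  rw [orderedEval_eq_sum y (c • P) P.support MvPolynomial.support_smul,
    orderedEval_eq_sum y P _ le_rfl, Finset.smul_sum]
  simp only [MvPolynomial.coeff_smul, smul_eq_mul, map_mul, mul_smul]

theorem orderedEval_monomial (y : Fin n → A) (d : Fin n →₀ ℕ) (c : k) :
    orderedEval y (MvPolynomial.monomial d c) = (PowerSeries.C c : k⟦X⟧) • orderedMonomial y d := by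
  classical
  rw [orderedEval_eq_sum y _ {d} MvPolynomial.support_monomial_subset, Finset.sum_singleton,
    MvPolynomial.coeff_monomial, if_pos rfl]

theorem map_orderedEval {B : Type*} [Ring B] [Algebra k⟦X⟧ B] (f : A →ₐ[k⟦X⟧] B) (y : Fin n → A)
    (P : MvPolynomial (Fin n) k) :
    f (orderedEval y P) = orderedEval (fun j => f (y j)) P := by
  rw [orderedEval_eq_sum _ _ _ le_rfl, orderedEval_eq_sum _ _ _ le_rfl, map_sum]
  exact Finset.sum_congr rfl fun d _ => by rw [map_smul, map_orderedMonomial]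

end OrderedEval

/-! ### The filtration by powers of the augmentation ideal -/

section Filtration

variable {k F : Type*} [Field k] [Ring F] [Algebra k⟦X⟧ F] [TopologicalSpace F] {n : ℕ}
  {π : F →+* MvPowerSeries (Fin n) k}

namespace IsFormalCoordinates

variable (hπ : IsFormalCoordinates k π) (T : TopologicalHopfAlgebra k F)
include hπ

/-- Commutators are divisible by `h` because `F/hF` is commutative. The counit kills them, its
target being commutative, hence it kills the quotient by `h` too. The gain over a bare multiple of
`h` is that `b` lies in `I`. -/
theorem exists_commutator_mem (f g : F) :
    ∃ b, T.counit b = 0 ∧ f * g - g * f = (PowerSeries.X : k⟦X⟧) • b := by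
  obtain ⟨b, hb⟩ := hπ.exists_commutator f g
  refine ⟨b, ?_, hb⟩
  have := congrArg T.counit hb
  rw [map_sub, map_mul, map_mul, mul_comm, sub_self, map_smul] at this
  exact hTorsionFree_powerSeries _ this.symm

/-- An adjacent transposition replaces two factors from `I` by `h` times a single element of `I`:
one degree is lost and one factor `h` gained. -/
theorem exists_perm_prod {l l' : List F} (h : l.Perm l') (hl : ∀ a ∈ l, a ∈ augIdeal T) :
    ∃ b ∈ augIdeal T ^ (l.length - 1), l.prod - l'.prod = (PowerSeries.X : k⟦X⟧) • b := by
  have hprod : ∀ l : List F, (∀ a ∈ l, a ∈ augIdeal T) → l.prod ∈ augIdeal T ^ l.length := by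
    intro l
    induction l with
    | nil => exact fun _ => ideal_pow_zero_mem _
    | cons a l ih =>
      intro h
      rw [List.prod_cons, List.length_cons]
      exact ideal_mul_mem_pow_succ' (h a (by simp)) (ih fun b hb => h b (by simp [hb]))
  induction h with
  | nil => exact ⟨0, zero_mem _, by simp⟩
  | cons a h ih =>
    rename_i l₁ l₂
    obtain ⟨b, hb, e⟩ := ih fun c hc => hl c (by simp [hc])
    -- The subtraction is truncated, so the exponents `(l₁.length - 1) + 1` and `l₁.length` differ
    -- when the tail is empty; an inequality between them is enough.
    refine ⟨a * b, Ideal.pow_le_pow_right ?_ (ideal_mul_mem_pow_succ' (hl a (by simp)) hb), ?_⟩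
    · rw [List.length_cons]
      omega
    · rw [List.prod_cons, List.prod_cons, ← mul_sub, e, mul_smul_comm]
  | swap a b l =>
    obtain ⟨c, hc, e⟩ := hπ.exists_commutator_mem T b a
    refine ⟨c * l.prod, ?_, ?_⟩
    · exact ideal_mul_mem_pow_succ' (mem_augIdeal_of_counit hc)
        (hprod l fun d hd => hl d (by simp [hd]))
    · rw [List.prod_cons, List.prod_cons, List.prod_cons, List.prod_cons, ← mul_assoc,
        ← mul_assoc, ← sub_mul, e, smul_mul_assoc]
  | trans h h' ih ih' =>
    obtain ⟨b, hb, e⟩ := ih hl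
    obtain ⟨b', hb', e'⟩ := ih' fun a ha => hl a (h.mem_iff.2 ha)
    rw [← h.length_eq] at hb'
    exact ⟨b + b', add_mem hb hb', by rw [smul_add, ← e, ← e', sub_add_sub_cancel]⟩

variable {x : Fin n → F} (hx : ∀ j, π (x j) = MvPowerSeries.X j)
include hx

theorem orderedMonomial_mem_pow (d : Fin n →₀ ℕ) : orderedMonomial x d ∈ augIdeal T ^ d.degree :=
  orderedMonomial_mem (fun j => hπ.mem_augIdeal_of_X T (hx j)) d

theorem exists_orderedMonomial_mul (d e : Fin n →₀ ℕ) :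
    ∃ b ∈ augIdeal T ^ (d.degree + e.degree - 1),
      orderedMonomial x d * orderedMonomial x e - orderedMonomial x (d + e)
        = (PowerSeries.X : k⟦X⟧) • b := by
  obtain ⟨b, hb, h⟩ := hπ.exists_perm_prod T ((expList_add_perm d e).map x) (by
    intro a ha
    obtain ⟨j, -, rfl⟩ := List.mem_map.1 ha
    exact hπ.mem_augIdeal_of_X T (hx j))
  rw [List.length_map, List.length_append, length_expList, length_expList] at hb
  refine ⟨b, hb, ?_⟩
  rw [← h, orderedMonomial_eq_prod, orderedMonomial_eq_prod, orderedMonomial_eq_prod,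
    List.map_append, List.prod_append]

/-- To pass from `D` to `D + 1`, multiply by `c ∈ I` and expand each `q_d c ∈ I` to first order as
`∑ x^e r_e + h r'` with `|e| = 1`. Merging `x^d x^e` into `x^{d+e}` costs only an element of `h
I^D`. -/
theorem exists_eq_sum_add_of_mem_pow (D : ℕ) (a : F) (ha : a ∈ augIdeal T ^ D) :
    ∃ (q : (Fin n →₀ ℕ) → F), ∃ b ∈ augIdeal T ^ (D - 1),
      a = ∑ d ∈ expOfDegree n D, orderedMonomial x d * q d + (PowerSeries.X : k⟦X⟧) • b := by
  classical
  let S : ℕ → AddSubmonoid F := fun D =>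
    { carrier := {a | ∃ (q : (Fin n →₀ ℕ) → F), ∃ b ∈ augIdeal T ^ (D - 1),
        a = ∑ d ∈ expOfDegree n D, orderedMonomial x d * q d + (PowerSeries.X : k⟦X⟧) • b}
      zero_mem' := ⟨0, 0, zero_mem _, by simp⟩
      add_mem' := by
        rintro _ _ ⟨q, b, hb, rfl⟩ ⟨q', b', hb', rfl⟩
        refine ⟨q + q', b + b', add_mem hb hb', ?_⟩
        simp only [Pi.add_apply, mul_add, Finset.sum_add_distrib, smul_add]
        abel }
  have hmon : ∀ (d : Fin n →₀ ℕ) (r : F), orderedMonomial x d * r ∈ S d.degree := by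
    intro d r
    refine ⟨Pi.single d r, 0, zero_mem _, ?_⟩
    rw [Finset.sum_eq_single d]
    · simp
    · intro e _ he
      simp [he]
    · simp
  have hX : ∀ (D : ℕ) (b : F), b ∈ augIdeal T ^ (D - 1) → (PowerSeries.X : k⟦X⟧) • b ∈ S D :=
    fun D b hb => ⟨0, b, hb, by simp⟩
  refine ideal_pow_induction (J := augIdeal T) (p := fun D a => a ∈ S D) (fun a => ?_)
    (fun D a b => add_mem) (fun D a c _ hc h => ?_) D a ha
  · have := hmon 0 a
    rwa [orderedMonomial_zero, one_mul, map_zero] at this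
  · obtain ⟨q, b, hb, rfl⟩ := h
    rw [add_mul, Finset.sum_mul, smul_mul_assoc]
    refine add_mem (sum_mem fun d hd => ?_)
      (hX _ _ (Ideal.pow_le_pow_right (by omega) (ideal_mul_mem_pow_succ hb hc)))
    rw [mem_expOfDegree] at hd
    have hqc : q d * c ∈ augIdeal T ^ 1 := by
      rw [Submodule.pow_one]
      exact (augIdeal T).mul_mem_left _ hc
    obtain ⟨r, r', hr⟩ := hπ.exists_eq_sum_add hx 1 _ (hπ.orderGE_of_mem T 1 _ hqc)
    rw [mul_assoc, hr, mul_add, Finset.mul_sum, mul_smul_comm]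
    have hdm := hπ.orderedMonomial_mem_pow T hx d
    refine add_mem (sum_mem fun e he => ?_) (hX _ _ ?_)
    · rw [mem_expOfDegree] at he
      obtain ⟨b', hb', e'⟩ := hπ.exists_orderedMonomial_mul T hx d e
      rw [← mul_assoc, sub_eq_iff_eq_add'.1 e', add_mul, smul_mul_assoc]
      refine add_mem ?_ (hX _ _ ?_)
      · have := hmon (d + e) (r e)
        rwa [map_add, hd, he] at this
      · rw [hd, he] at hb'
        exact (augIdeal T ^ D).mul_mem_right _ hb'
    · rw [hd] at hdm
      exact (augIdeal T ^ D).mul_mem_right _ hdm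

/-- Multiplication by `h` is injective on the graded ring of the filtration by the powers of the
augmentation ideal. -/
theorem mem_pow_of_X_smul_mem (hF : HTorsionFree k F) (D : ℕ) (a : F)
    (ha : (PowerSeries.X : k⟦X⟧) • a ∈ augIdeal T ^ D) : a ∈ augIdeal T ^ (D - 1) := by
  obtain ⟨q, b, hb, hab⟩ := hπ.exists_eq_sum_add_of_mem_pow T hx D _ ha
  -- It is enough to place the sum in `Z = h I^{D-1}`, since `h` can then be cancelled. Modulo `Z`
  -- the monomials involved may be reordered freely, and `h x^d` with `|d| = D` vanishes.
  let Z : AddSubgroup F :=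
    { carrier := {z | ∃ b ∈ augIdeal T ^ (D - 1), z = (PowerSeries.X : k⟦X⟧) • b}
      zero_mem' := ⟨0, zero_mem _, by simp⟩
      add_mem' := by
        rintro _ _ ⟨b, hb, rfl⟩ ⟨b', hb', rfl⟩
        exact ⟨b + b', add_mem hb hb', by rw [smul_add]⟩
      neg_mem' := by
        rintro _ ⟨b, hb, rfl⟩
        exact ⟨-b, neg_mem hb, by rw [smul_neg]⟩ }
  suffices h : ∑ d ∈ expOfDegree n D, orderedMonomial x d * q d ∈ Z by
    obtain ⟨c, hc, h⟩ := h
    have : a = c + b := hF.cancel (by rw [hab, h, smul_add])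
    rw [this]
    exact add_mem hc hb
  have hsyz : ∑ d ∈ expOfDegree n D, MvPowerSeries.monomial d 1 * π (q d) = 0 := by
    have := congrArg π hab
    rw [hπ.map_X_smul, map_add, hπ.map_X_smul, add_zero, map_sum] at this
    rw [this]
    exact Finset.sum_congr rfl fun d _ => by rw [map_mul, hπ.map_orderedMonomial_eq hx]
  obtain ⟨p, hp1, hp2⟩ := exists_syzygy D (fun d => π (q d)) hsyz
  choose P hP using fun d d' => hπ.surjective (p d d')
  have hmem : ∀ d ∈ expOfDegree n D, ∀ b : F,
      (PowerSeries.X : k⟦X⟧) • (orderedMonomial x d * b) ∈ Z := by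
    intro d hd b
    refine ⟨_, Ideal.mul_mem_right _ _ ?_, rfl⟩
    have := hπ.orderedMonomial_mem_pow T hx d
    rw [mem_expOfDegree.1 hd] at this
    exact Ideal.pow_le_pow_right (Nat.sub_le _ _) this
  have hmul : ∀ d ∈ expOfDegree n D, ∀ m, d ≤ m → ∀ r : F,
      orderedMonomial x d * (orderedMonomial x (m - d) * r) - orderedMonomial x m * r ∈ Z := by
    intro d hd m hdm r
    obtain ⟨b', hb', e'⟩ := hπ.exists_orderedMonomial_mul T hx d (m - d)
    rw [add_tsub_cancel_of_le hdm] at e'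
    rw [← mul_assoc, ← sub_mul, e', smul_mul_assoc]
    refine ⟨_, Ideal.mul_mem_right _ _ (Ideal.pow_le_pow_right ?_ hb'), rfl⟩
    rw [mem_expOfDegree.1 hd]
    omega
  -- The first family of relations between the `p d d'`, lifted to `F`: each `q d` is replaced by
  -- its expansion, and `x^d x^{d ⊔ d' - d}` by `x^{d ⊔ d'}`.
  have h1 : ∀ d ∈ expOfDegree n D, orderedMonomial x d * q d
      - ∑ d' ∈ expOfDegree n D, orderedMonomial x (d ⊔ d') * P d d' ∈ Z := by
    intro d hd
    obtain ⟨r, hr⟩ := hπ.exists_smul_of_map_eq (f := q d)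
      (g := ∑ d' ∈ expOfDegree n D, orderedMonomial x (d ⊔ d' - d) * P d d') (by
        rw [hp1 d hd, map_sum]
        exact Finset.sum_congr rfl fun d' _ => by
          rw [map_mul, hπ.map_orderedMonomial_eq hx, hP])
    rw [sub_eq_iff_eq_add'.1 hr, mul_add, Finset.mul_sum, add_sub_right_comm,
      ← Finset.sum_sub_distrib, mul_smul_comm]
    exact add_mem (sum_mem fun d' _ => hmul d hd _ le_sup_left _) (hmem d hd r)
  -- The second family, lifted to `F`: after `x^{d'}` is factored out, the sum over `d` is a
  -- multiple of `h`.
  have h2 : ∀ d' ∈ expOfDegree n D,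
      ∑ d ∈ expOfDegree n D, orderedMonomial x (d ⊔ d') * P d d' ∈ Z := by
    intro d' hd'
    obtain ⟨s, hs⟩ := (hπ.1 (∑ d ∈ expOfDegree n D, orderedMonomial x (d ⊔ d' - d') * P d d')).1 (by
      rw [map_sum, ← hp2 d' hd']
      exact Finset.sum_congr rfl fun d _ => by rw [map_mul, hπ.map_orderedMonomial_eq hx, hP])
    have h3 := hmem d' hd' s
    rw [← mul_smul_comm, ← hs, Finset.mul_sum] at h3
    have h4 : ∑ d ∈ expOfDegree n D, (orderedMonomial x d' *
        (orderedMonomial x (d ⊔ d' - d') * P d d') - orderedMonomial x (d ⊔ d') * P d d') ∈ Z :=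
      sum_mem fun d _ => hmul d' hd' _ le_sup_right _
    rw [Finset.sum_sub_distrib] at h4
    have := sub_mem h3 h4
    rwa [sub_sub_cancel] at this
  have h3 := sum_mem h1
  rw [Finset.sum_sub_distrib, Finset.sum_comm] at h3
  have := add_mem h3 (sum_mem h2)
  rwa [sub_add_cancel] at this

theorem coeff_map_smul_orderedMonomial (c : k) (m : ℕ) (d e : Fin n →₀ ℕ) [Decidable (d = e)] :
    MvPowerSeries.coeff e (π ((PowerSeries.C c * PowerSeries.X ^ m : k⟦X⟧) • orderedMonomial x d))
      = if m = 0 ∧ d = e then c else 0 := by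
  classical
  rw [Algebra.smul_def, map_mul, hπ.2.1, hπ.map_orderedMonomial_eq hx, MvPowerSeries.coeff_C_mul,
    MvPowerSeries.coeff_monomial]
  rcases eq_or_ne m 0 with rfl | hm
  · by_cases h : d = e
    · simp [h]
    · simp [h, Ne.symm h]
  · simp [hm]

/-- Only the terms of degree `N` carry no factor `h`, and `π` sends `I^{N+1}` to series of order
above `N`, so their coefficients vanish. What remains is `h` times a sum of the same kind for `N -
1`, and `mem_pow_of_X_smul_mem` removes that factor. -/
theorem eq_zero_of_sum_mem_pow (hF : HTorsionFree k F) (N : ℕ) : ∀ (S : Finset (Fin n →₀ ℕ))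
    (c : (Fin n →₀ ℕ) → k), (∀ d ∈ S, d.degree ≤ N) →
    ∑ d ∈ S, (PowerSeries.C (c d) * PowerSeries.X ^ (N - d.degree) : k⟦X⟧) • orderedMonomial x d
      ∈ augIdeal T ^ (N + 1) → ∀ d ∈ S, c d = 0 := by
  classical
  have htop : ∀ (N : ℕ) (S : Finset (Fin n →₀ ℕ))
    (c : (Fin n →₀ ℕ) → k), (∀ d ∈ S, d.degree ≤ N) →
    ∑ d ∈ S, (PowerSeries.C (c d) * PowerSeries.X ^ (N - d.degree) : k⟦X⟧) • orderedMonomial x d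
      ∈ augIdeal T ^ (N + 1) → ∀ d ∈ S, d.degree = N → c d = 0 := by
    intro N S c hS h e he heN
    have h1 := hπ.orderGE_of_mem T _ _ h e (by omega)
    rw [map_sum, map_sum, Finset.sum_eq_single e] at h1
    · rwa [hπ.coeff_map_smul_orderedMonomial hx, if_pos ⟨by omega, rfl⟩] at h1
    · intro d _ hde
      rw [hπ.coeff_map_smul_orderedMonomial hx, if_neg]
      exact fun h => hde h.2
    · exact fun h => absurd he h
  induction N with
  | zero => exact fun S c hS h d hd => htop 0 S c hS h d hd (Nat.le_zero.1 (hS d hd))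
  | succ N ih =>
    intro S c hS h d hd
    have h0 := htop (N + 1) S c hS h
    by_cases hdN : d.degree = N + 1
    · exact h0 d hd hdN
    · refine ih (S.filter fun d => d.degree ≤ N) c (fun d hd => (Finset.mem_filter.1 hd).2) ?_ d
        (Finset.mem_filter.2 ⟨hd, by have := hS d hd; omega⟩)
      refine hπ.mem_pow_of_X_smul_mem T hx hF (N + 1 + 1) _ ?_
      rw [Finset.smul_sum]
      convert h using 1
      rw [Finset.sum_filter]
      refine Finset.sum_congr rfl fun d hd => ?_
      split_ifs with hle
      · rw [smul_smul, mul_left_comm, ← pow_succ']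
        congr 3
        omega
      · rw [h0 d hd (by have := hS d hd; omega)]
        simp

end IsFormalCoordinates

end Filtration

/-! ### A basis of `F^×` modulo `h` -/

section TimesBasis

variable {k F A : Type*} [Field k] [Ring F] [Algebra k⟦X⟧ F] [TopologicalSpace F]
  [Ring A] [Algebra k⟦X⟧ A] {n : ℕ} {π : F →+* MvPowerSeries (Fin n) k}
  {T : TopologicalHopfAlgebra k F} {j : F →ₐ[k⟦X⟧] A}

theorem smul_orderedMonomial_eq {x : Fin n → F} {y : Fin n → A}
    (hy : ∀ i, (PowerSeries.X : k⟦X⟧) • y i = j (x i)) (d : Fin n →₀ ℕ) :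
    (PowerSeries.X ^ d.degree : k⟦X⟧) • orderedMonomial y d = j (orderedMonomial x d) := by
  rw [map_orderedMonomial, ← orderedMonomial_smul]
  simp only [hy]

variable (hj : IsTimes T j) (hπ : IsFormalCoordinates k π) {x : Fin n → F} {y : Fin n → A}
  (hx : ∀ i, π (x i) = MvPowerSeries.X i) (hy : ∀ i, (PowerSeries.X : k⟦X⟧) • y i = j (x i))
include hj

theorem IsTimes.map_sub_counitZero_mem (f : F) :
    j f - algebraMap k⟦X⟧ A (PowerSeries.C (counitZero T f)) ∈ hPow k A 1 := by
  rw [← j.commutes, ← map_sub]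
  refine hj.map_mem_hPow ?_
  rw [Submodule.pow_one, mem_augIdeal]
  simp [counitZero_apply]

include hπ hx hy

/-- Clear denominators. If `P(y) = h a` and `h^m a = f ∈ I^m`, multiplication by `hᴺ`, with `N` at
least `m` and the degree of `P`, gives `∑ c_d h^{N-|d|} x^d = h^{N+1-m} f ∈ I^{N+1}`, to which
`eq_zero_of_sum_mem_pow` applies. -/
theorem IsTimes.eq_zero_of_orderedEval_mem (P : MvPolynomial (Fin n) k)
    (hP : orderedEval y P ∈ hPow k A 1) : P = 0 := by
  obtain ⟨a, ha⟩ := mem_hPow_one.1 hP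
  obtain ⟨m, f, hf, hfa⟩ := hj.exists_mem_pow a
  set N := m + P.support.sup fun d => d.degree with hN
  have hle : ∀ d ∈ P.support, d.degree ≤ N := fun d hd =>
    (Finset.le_sup (f := fun d : Fin n →₀ ℕ => d.degree) hd).trans (Nat.le_add_left _ _)
  have key : j (∑ d ∈ P.support, (PowerSeries.C (P.coeff d) * PowerSeries.X ^ (N - d.degree)
      : k⟦X⟧) • orderedMonomial x d) = j ((PowerSeries.X ^ (N + 1 - m) : k⟦X⟧) • f) := by
    rw [map_smul, ← hfa, smul_smul, ← pow_add, Nat.sub_add_cancel (by omega), pow_succ, mul_smul,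
      ← ha, orderedEval_eq_sum y P _ le_rfl, Finset.smul_sum, map_sum]
    refine Finset.sum_congr rfl fun d hd => ?_
    rw [map_smul, ← smul_orderedMonomial_eq hy, smul_smul, smul_smul, mul_assoc, ← pow_add,
      Nat.sub_add_cancel (hle d hd), mul_comm]
  have h1 := hj.injective key
  have h2 := hπ.eq_zero_of_sum_mem_pow T hx hj.torsionFree_source N P.support
    (fun d => P.coeff d) hle (by
      rw [h1]
      have := pow_smul_mem_augIdeal_pow T (N + 1 - m) hf
      rwa [Nat.sub_add_cancel (by omega)] at this)
  ext d
  rw [MvPolynomial.coeff_zero]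
  by_cases hd : d ∈ P.support
  · exact h2 d hd
  · exact MvPolynomial.notMem_support_iff.1 hd

/-- Induction on the denominator: `f = ∑ x^d q_d + h b` with `b ∈ I^m`, divided by `h^{m+1}`, reads
`a = ∑ y^d q_d + h⁻ᵐ b`. Modulo `h` each `q_d` is the constant `ε(q_d)`, because `I` becomes
divisible by `h`. -/
theorem IsTimes.exists_sub_orderedEval_mem (a : A) :
    ∃ P : MvPolynomial (Fin n) k, a - orderedEval y P ∈ hPow k A 1 := by
  obtain ⟨m, f, hf, hfa⟩ := hj.exists_mem_pow a
  induction m generalizing a f with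
  | zero =>
    refine ⟨MvPolynomial.monomial 0 (counitZero T f), ?_⟩
    rw [orderedEval_monomial, orderedMonomial_zero, ← Algebra.algebraMap_eq_smul_one]
    have := hj.map_sub_counitZero_mem f
    rwa [← hfa, pow_zero, one_smul] at this
  | succ m ih =>
    obtain ⟨q, b, hb, hab⟩ := hπ.exists_eq_sum_add_of_mem_pow T hx _ _ hf
    obtain ⟨a', ha'⟩ := hj.exists_pow_div m b hb
    obtain ⟨P, hP⟩ := ih a' b hb ha'
    have ha : a = ∑ d ∈ expOfDegree n (m + 1), orderedMonomial y d * j (q d) + a' := by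
      apply hj.torsionFree.pow_cancel (m + 1)
      rw [hfa, hab, map_add, map_sum, smul_add, Finset.smul_sum, map_smul, ← ha', smul_smul,
        ← pow_succ']
      congr 1
      refine Finset.sum_congr rfl fun d hd => ?_
      rw [map_mul, ← smul_orderedMonomial_eq hy, mem_expOfDegree.1 hd, smul_mul_assoc]
    refine ⟨∑ d ∈ expOfDegree n (m + 1), MvPolynomial.monomial d (counitZero T (q d)) + P, ?_⟩
    have h1 : orderedEval y
        (∑ d ∈ expOfDegree n (m + 1), MvPolynomial.monomial d (counitZero T (q d)) + P)
        = ∑ d ∈ expOfDegree n (m + 1), (PowerSeries.C (counitZero T (q d)) : k⟦X⟧)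
          • orderedMonomial y d + orderedEval y P := by
      rw [← orderedEvalHom_apply, map_add, map_sum]
      simp only [orderedEvalHom_apply, orderedEval_monomial]
    rw [h1, ha, add_sub_add_comm, ← Finset.sum_sub_distrib]
    refine add_mem (sum_mem fun d _ => ?_) hP
    rw [Algebra.smul_def, Algebra.commutes, ← mul_sub]
    exact Ideal.mul_mem_left _ _ (hj.map_sub_counitZero_mem _)

end TimesBasis

/-! ### Representatives of elements of completed tensor squares -/

section Tensor

variable {R M N M' N' Q : Type*} [CommRing R] [AddCommGroup M] [AddCommGroup N] [AddCommGroup M']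
  [AddCommGroup N'] [AddCommGroup Q] [Module R M] [Module R N] [Module R M'] [Module R N']
  [Module R Q]

/-- A linear map vanishing on `ker f ⊗ N` and `M ⊗ ker g` vanishes on the kernel of `f ⊗ g`. -/
theorem eq_zero_of_map_eq_zero (f : M →ₗ[R] M') (g : N →ₗ[R] N') (hf : Function.Surjective f)
    (hg : Function.Surjective g) (τ : M ⊗[R] N →ₗ[R] Q) (h1 : ∀ m n, f m = 0 → τ (m ⊗ₜ n) = 0)
    (h2 : ∀ m n, g n = 0 → τ (m ⊗ₜ n) = 0) (z : M ⊗[R] N) (hz : TensorProduct.map f g z = 0) :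
    τ z = 0 := by
  have h := TensorProduct.map_ker f.exact_subtype_ker_map hf g.exact_subtype_ker_map hg
  have hz' : z ∈ LinearMap.ker (TensorProduct.map f g) := hz
  rw [h] at hz'
  suffices h : LinearMap.range (LinearMap.lTensor M (LinearMap.ker g).subtype) ⊔
      LinearMap.range (LinearMap.rTensor N (LinearMap.ker f).subtype) ≤ LinearMap.ker τ from h hz'
  refine sup_le ?_ ?_
  · rw [LinearMap.range_le_ker_iff]
    exact TensorProduct.ext' fun m n => h2 m n n.2
  · rw [LinearMap.range_le_ker_iff]
    exact TensorProduct.ext' fun m n => h1 m n m.2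

theorem exists_fin_sum_tmul (z : M ⊗[R] N) :
    ∃ (n : ℕ) (u : Fin n → M) (v : Fin n → N), z = ∑ i, u i ⊗ₜ[R] v i := by
  induction z with
  | zero => exact ⟨0, Fin.elim0, Fin.elim0, by simp⟩
  | tmul a b => exact ⟨1, fun _ => a, fun _ => b, by simp⟩
  | add z z' h h' =>
    obtain ⟨n, u, v, rfl⟩ := h
    obtain ⟨n', u', v', rfl⟩ := h'
    exact ⟨n + n', Fin.append u u', Fin.append v v', by simp [Fin.sum_univ_add]⟩

variable {A : Type*} [Ring A] [Algebra R A]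

/-- The map `a ⊗ b ↦ φ(a) ψ(b)`. -/
def convMap (φ ψ : M →ₗ[R] A) : M ⊗[R] M →ₗ[R] A := LinearMap.mul' R A ∘ₗ TensorProduct.map φ ψ

@[simp] theorem convMap_tmul (φ ψ : M →ₗ[R] A) (a b : M) :
    convMap φ ψ (a ⊗ₜ b) = φ a * ψ b := rfl

end Tensor

/-! ### Quotients of tensor squares and representatives -/

section Represents

variable {k H : Type*} [Field k] [Ring H] [Algebra k⟦X⟧ H]

/-- The quotient map `H ⊗ H → H/P ⊗ H/Q`. -/
def quotMap (k : Type*) {H : Type*} [Field k] [Ring H] [Algebra k⟦X⟧ H] (P Q : Ideal H)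
    [P.IsTwoSided] [Q.IsTwoSided] : H ⊗[k⟦X⟧] H →ₐ[k⟦X⟧] (H ⧸ P) ⊗[k⟦X⟧] (H ⧸ Q) :=
  Algebra.TensorProduct.map (Ideal.Quotient.mkₐ k⟦X⟧ P) (Ideal.Quotient.mkₐ k⟦X⟧ Q)

@[simp] theorem quotMap_tmul (P Q : Ideal H) [P.IsTwoSided] [Q.IsTwoSided] (a b : H) :
    quotMap k P Q (a ⊗ₜ b) = Ideal.Quotient.mk P a ⊗ₜ Ideal.Quotient.mk Q b := rfl

theorem quotMap_surjective (P Q : Ideal H) [P.IsTwoSided] [Q.IsTwoSided] :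
    Function.Surjective (quotMap k P Q) :=
  TensorProduct.map_surjective Ideal.Quotient.mk_surjective Ideal.Quotient.mk_surjective

theorem eq_zero_of_quotMap_eq_zero {M : Type*} [AddCommGroup M] [Module k⟦X⟧ M] {P Q : Ideal H}
    [P.IsTwoSided] [Q.IsTwoSided] (τ : H ⊗[k⟦X⟧] H →ₗ[k⟦X⟧] M)
    (h1 : ∀ a ∈ P, ∀ b, τ (a ⊗ₜ b) = 0) (h2 : ∀ a, ∀ b ∈ Q, τ (a ⊗ₜ b) = 0) {z : H ⊗[k⟦X⟧] H}
    (hz : quotMap k P Q z = 0) : τ z = 0 :=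
  eq_zero_of_map_eq_zero (Ideal.Quotient.mkₐ k⟦X⟧ P).toLinearMap
    (Ideal.Quotient.mkₐ k⟦X⟧ Q).toLinearMap Ideal.Quotient.mk_surjective
    Ideal.Quotient.mk_surjective τ (fun a b h => h1 a (Ideal.Quotient.eq_zero_iff_mem.1 h) b)
    (fun a b h => h2 a b (Ideal.Quotient.eq_zero_iff_mem.1 h)) z hz

/-- The kernel of the quotient map is generated by `P ⊗ H` and `H ⊗ Q`. Thus any linear expression
killing both may be evaluated on whichever representative of `Δ(a)` is convenient. -/
theorem eq_of_quotMap_eq {M : Type*} [AddCommGroup M] [Module k⟦X⟧ M] {P Q : Ideal H}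
    [P.IsTwoSided] [Q.IsTwoSided] (τ : H ⊗[k⟦X⟧] H →ₗ[k⟦X⟧] M)
    (h1 : ∀ a ∈ P, ∀ b, τ (a ⊗ₜ b) = 0) (h2 : ∀ a, ∀ b ∈ Q, τ (a ⊗ₜ b) = 0)
    {z z' : H ⊗[k⟦X⟧] H} (hz : quotMap k P Q z = quotMap k P Q z') : τ z = τ z' := by
  rw [← sub_eq_zero, ← map_sub]
  exact eq_zero_of_quotMap_eq_zero τ h1 h2 (by rw [map_sub, hz, sub_self])

/-- The quotient map `H ⊗ (H ⊗ H) → H/P ⊗ (H/Q ⊗ H/S)`. -/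
def quotMapThree (k : Type*) {H : Type*} [Field k] [Ring H] [Algebra k⟦X⟧ H] (P Q S : Ideal H)
    [P.IsTwoSided] [Q.IsTwoSided] [S.IsTwoSided] :
    H ⊗[k⟦X⟧] (H ⊗[k⟦X⟧] H) →ₗ[k⟦X⟧] (H ⧸ P) ⊗[k⟦X⟧] ((H ⧸ Q) ⊗[k⟦X⟧] (H ⧸ S)) :=
  TensorProduct.map (Ideal.Quotient.mkₐ k⟦X⟧ P).toLinearMap (quotMap k Q S).toLinearMap

@[simp] theorem quotMapThree_tmul (P Q S : Ideal H) [P.IsTwoSided] [Q.IsTwoSided] [S.IsTwoSided]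
    (a : H) (z : H ⊗[k⟦X⟧] H) :
    quotMapThree k P Q S (a ⊗ₜ z) = Ideal.Quotient.mk P a ⊗ₜ quotMap k Q S z := rfl

theorem quotMapThree_assoc (P Q S : Ideal H) [P.IsTwoSided] [Q.IsTwoSided] [S.IsTwoSided]
    (z : H ⊗[k⟦X⟧] H) (a : H) :
    quotMapThree k P Q S (TensorProduct.assoc k⟦X⟧ _ _ _ (z ⊗ₜ a))
      = TensorProduct.assoc k⟦X⟧ _ _ _ (quotMap k P Q z ⊗ₜ Ideal.Quotient.mk S a) := by
  induction z with
  | zero => simp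
  | tmul b c => rfl
  | add z z' h h' =>
    rw [TensorProduct.add_tmul, map_add, map_add, h, h', map_add, TensorProduct.add_tmul, map_add]

theorem eq_of_quotMapThree_eq {M : Type*} [AddCommGroup M] [Module k⟦X⟧ M] {P Q S : Ideal H}
    [P.IsTwoSided] [Q.IsTwoSided] [S.IsTwoSided] (τ : H ⊗[k⟦X⟧] (H ⊗[k⟦X⟧] H) →ₗ[k⟦X⟧] M)
    (h1 : ∀ a ∈ P, ∀ b c, τ (a ⊗ₜ (b ⊗ₜ c)) = 0) (h2 : ∀ a, ∀ b ∈ Q, ∀ c, τ (a ⊗ₜ (b ⊗ₜ c)) = 0)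
    (h3 : ∀ a b, ∀ c ∈ S, τ (a ⊗ₜ (b ⊗ₜ c)) = 0) {z z' : H ⊗[k⟦X⟧] (H ⊗[k⟦X⟧] H)}
    (hz : quotMapThree k P Q S z = quotMapThree k P Q S z') : τ z = τ z' := by
  rw [← sub_eq_zero, ← map_sub]
  refine eq_zero_of_map_eq_zero (Ideal.Quotient.mkₐ k⟦X⟧ P).toLinearMap
    (quotMap k Q S).toLinearMap Ideal.Quotient.mk_surjective (quotMap_surjective Q S) τ
    (fun a w ha => ?_) (fun a w hw => ?_) _
    (show quotMapThree k P Q S _ = 0 by rw [map_sub, hz, sub_self])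
  · induction w with
    | zero => simp
    | tmul b c => exact h1 a (Ideal.Quotient.eq_zero_iff_mem.1 ha) b c
    | add w w' h h' => rw [TensorProduct.tmul_add, map_add, h, h', add_zero]
  · exact eq_zero_of_quotMap_eq_zero (τ ∘ₗ TensorProduct.mk k⟦X⟧ _ _ a) (fun b hb c => h2 a b hb c)
      (fun b c hc => h3 a b c hc) hw

variable [TopologicalSpace H]

/-- `z ∈ H ⊗ H` represents `c` modulo `P ⊗ H + H ⊗ Q`. -/
def Represents (c : CompletedTensor k H) (P Q : OpenIdeal H) (z : H ⊗[k⟦X⟧] H) : Prop :=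
  component c P Q = quotMap k P.toIdeal Q.toIdeal z

theorem exists_represents (c : CompletedTensor k H) (P Q : OpenIdeal H) :
    ∃ z, Represents c P Q z := by
  obtain ⟨z, hz⟩ := quotMap_surjective (k := k) P.toIdeal Q.toIdeal (component c P Q)
  exact ⟨z, hz.symm⟩

theorem approximates_iff {c : CompletedTensor k H} {P Q : OpenIdeal H} {N : ℕ} {u v : Fin N → H} :
    Approximates u v c P Q ↔ Represents c P Q (∑ i, u i ⊗ₜ v i) := by
  rw [Represents, map_sum]
  exact Iff.rfl

theorem component_map {c : CompletedTensor k H} {P Q P' Q' : OpenIdeal H}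
    (hP : P.toIdeal ≤ P'.toIdeal) (hQ : Q.toIdeal ≤ Q'.toIdeal) :
    Algebra.TensorProduct.map (Ideal.Quotient.factorₐ k⟦X⟧ hP) (Ideal.Quotient.factorₐ k⟦X⟧ hQ)
      (component c P Q) = component c P' Q' := c.2 (P, Q) (P', Q') hP hQ

theorem factor_quotMap {P Q P' Q' : Ideal H} [P.IsTwoSided] [Q.IsTwoSided] [P'.IsTwoSided]
    [Q'.IsTwoSided] (hP : P ≤ P') (hQ : Q ≤ Q') (z : H ⊗[k⟦X⟧] H) :
    Algebra.TensorProduct.map (Ideal.Quotient.factorₐ k⟦X⟧ hP) (Ideal.Quotient.factorₐ k⟦X⟧ hQ)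
      (quotMap k P Q z) = quotMap k P' Q' z := by
  induction z with
  | zero => simp
  | tmul a b => rfl
  | add z z' h h' => rw [map_add, map_add, h, h', map_add]

theorem Represents.mono {c : CompletedTensor k H} {P Q P' Q' : OpenIdeal H} {z : H ⊗[k⟦X⟧] H}
    (h : Represents c P Q z) (hP : P.toIdeal ≤ P'.toIdeal) (hQ : Q.toIdeal ≤ Q'.toIdeal) :
    Represents c P' Q' z := by
  rw [Represents, ← component_map hP hQ, h, factor_quotMap]

theorem Represents.mul {c c' : CompletedTensor k H} {P Q : OpenIdeal H} {z z' : H ⊗[k⟦X⟧] H}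
    (h : Represents c P Q z) (h' : Represents c' P Q z') : Represents (c * c') P Q (z * z') := by
  rw [Represents, map_mul, ← h, ← h']
  rfl

end Represents

/-! ### The Hopf algebra axioms on representatives -/

section HopfF

variable {k F : Type*} [Field k] [Ring F] [Algebra k⟦X⟧ F] [TopologicalSpace F]

/-- The map `a ↦ ε(a) 1`. -/
def unitCounit (T : TopologicalHopfAlgebra k F) : F →ₗ[k⟦X⟧] F :=
  Algebra.linearMap k⟦X⟧ F ∘ₗ T.counit.toLinearMap

@[simp] theorem unitCounit_apply (T : TopologicalHopfAlgebra k F) (a : F) :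
    unitCounit T a = algebraMap k⟦X⟧ F (T.counit a) := rfl

/-- The topology is defined by the powers of the augmentation ideal, and is separated. -/
structure IsAugAdic (T : TopologicalHopfAlgebra k F) : Prop where
  isOpen : ∀ N, IsOpen ((augIdeal T ^ N : Ideal F) : Set F)
  exists_le : ∀ O : OpenIdeal F, ∃ N, augIdeal T ^ N ≤ O.toIdeal
  separated : ∀ f, (∀ N, f ∈ augIdeal T ^ N) → f = 0

variable {T : TopologicalHopfAlgebra k F}

namespace IsAugAdic

variable (hT : IsAugAdic T)

/-- The open ideal `Iᴺ`. -/
def openPow (N : ℕ) : OpenIdeal F := ⟨augIdeal T ^ N, inferInstance, hT.isOpen N⟩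

theorem openPow_anti {M N : ℕ} (h : M ≤ N) : (hT.openPow N).toIdeal ≤ (hT.openPow M).toIdeal :=
  Ideal.pow_le_pow_right h

/-- `z` represents `Δ(a)` modulo `Iᴺ ⊗ F + F ⊗ Iᴺ`. -/
def Rep (N : ℕ) (a : F) (z : F ⊗[k⟦X⟧] F) : Prop :=
  Represents (T.comul a) (hT.openPow N) (hT.openPow N) z

variable {hT}

theorem Rep.mono {M N : ℕ} {a : F} {z : F ⊗[k⟦X⟧] F} (h : hT.Rep N a z) (hMN : M ≤ N) :
    hT.Rep M a z := Represents.mono h (hT.openPow_anti hMN) (hT.openPow_anti hMN)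

theorem Rep.mul {N : ℕ} {a b : F} {z w : F ⊗[k⟦X⟧] F} (h : hT.Rep N a z) (h' : hT.Rep N b w) :
    hT.Rep N (a * b) (z * w) := by
  rw [Rep, map_mul]
  exact Represents.mul h h'

variable (hT)
include hT

theorem exists_rep (N : ℕ) (a : F) : ∃ z, hT.Rep N a z := exists_represents _ _ _

theorem exists_antipode_mem (L : ℕ) :
    ∃ N, ∀ a ∈ augIdeal T ^ N, T.antipode a ∈ augIdeal T ^ L := by
  obtain ⟨O, hO⟩ := T.ideal_basis (T.antipode ⁻¹' (augIdeal T ^ L : Ideal F))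
    (((hT.isOpen L).preimage T.antipode_continuous).mem_nhds (by simp))
  obtain ⟨N, hN⟩ := hT.exists_le O
  exact ⟨N, fun a ha => hO (hN ha)⟩

theorem exists_component_eq_zero (L : ℕ) : ∃ N, ∀ a ∈ augIdeal T ^ N,
    component (T.comul a) (hT.openPow L) (hT.openPow L) = 0 := by
  obtain ⟨O, hO⟩ := T.ideal_basis _ ((T.comul_continuous (hT.openPow L) (hT.openPow L)).mem_nhds (by
    rw [Set.mem_ofPred_eq, map_zero]
    rfl))
  obtain ⟨N, hN⟩ := hT.exists_le O
  exact ⟨N, fun a ha => hO (hN ha)⟩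

theorem unitCounit_mem {N : ℕ} {a : F} (ha : a ∈ augIdeal T ^ N) :
    unitCounit T a ∈ augIdeal T ^ N := by
  obtain ⟨r, hr⟩ := counit_pow_dvd T N a ha
  rw [unitCounit_apply, hr, map_mul, ← Algebra.smul_def, Algebra.algebraMap_eq_smul_one, smul_smul,
    mul_comm, mul_smul]
  have := pow_smul_mem_augIdeal_pow T N (ideal_pow_zero_mem (1 : F))
  exact ideal_smul_mem r this

theorem convMap_counit_left {N : ℕ} {a : F} {z : F ⊗[k⟦X⟧] F} (h : hT.Rep N a z) :
    convMap (unitCounit T) LinearMap.id z - a ∈ augIdeal T ^ N := by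
  obtain ⟨n, u, v, rfl⟩ := exists_fin_sum_tmul z
  have := T.counit_left (hT.openPow N) (hT.openPow N) (fun b hb => hT.unitCounit_mem hb) a n u v
    (approximates_iff.2 h)
  rw [map_sum]
  simp only [convMap_tmul, unitCounit_apply, LinearMap.id_apply, ← Algebra.smul_def]
  exact Ideal.Quotient.eq.1 this

theorem convMap_counit_right {N : ℕ} {a : F} {z : F ⊗[k⟦X⟧] F} (h : hT.Rep N a z) :
    convMap LinearMap.id (unitCounit T) z - a ∈ augIdeal T ^ N := by
  obtain ⟨n, u, v, rfl⟩ := exists_fin_sum_tmul z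
  have := T.counit_right (hT.openPow N) (hT.openPow N) (fun b hb => hT.unitCounit_mem hb) a n u v
    (approximates_iff.2 h)
  rw [map_sum]
  simp only [convMap_tmul, unitCounit_apply, LinearMap.id_apply, ← Algebra.commutes,
    ← Algebra.smul_def]
  exact Ideal.Quotient.eq.1 this

theorem exists_convMap_antipode_left (L : ℕ) : ∃ M, ∀ N ≥ M, ∀ a z, hT.Rep N a z →
    convMap T.antipode LinearMap.id z - unitCounit T a ∈ augIdeal T ^ L := by
  obtain ⟨M, hM⟩ := hT.exists_antipode_mem L
  refine ⟨max M L, fun N hN a z h => ?_⟩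
  obtain ⟨n, u, v, rfl⟩ := exists_fin_sum_tmul z
  have := T.antipode_left (hT.openPow N) (hT.openPow N) (hT.openPow L)
    (fun b hb => hM b (Ideal.pow_le_pow_right (by omega) hb)) (hT.openPow_anti (by omega)) a n u v
    (approximates_iff.2 h)
  rw [map_sum]
  exact Ideal.Quotient.eq.1 this

theorem exists_convMap_antipode_right (L : ℕ) : ∃ M, ∀ N ≥ M, ∀ a z, hT.Rep N a z →
    convMap LinearMap.id T.antipode z - unitCounit T a ∈ augIdeal T ^ L := by
  obtain ⟨M, hM⟩ := hT.exists_antipode_mem L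
  refine ⟨max M L, fun N hN a z h => ?_⟩
  obtain ⟨n, u, v, rfl⟩ := exists_fin_sum_tmul z
  have := T.antipode_right (hT.openPow N) (hT.openPow N) (hT.openPow L)
    (hT.openPow_anti (by omega)) (fun b hb => hM b (Ideal.pow_le_pow_right (by omega) hb)) a n u v
    (approximates_iff.2 h)
  rw [map_sum]
  exact Ideal.Quotient.eq.1 this

/-- `M` is chosen so that `Δ(I^M)` vanishes in `F/Iᴸ ⊗ F/Iᴸ`. The axiom then applies with `Iᴺ` as
both auxiliary ideals, and the inner coproducts are needed only at precision `L`. -/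
theorem exists_coassoc (L : ℕ) : ∃ M, ∀ N ≥ M, ∀ (a : F) (n : ℕ) (u v : Fin n → F)
    (w w' : Fin n → F ⊗[k⟦X⟧] F), hT.Rep N a (∑ i, u i ⊗ₜ v i) → (∀ i, hT.Rep L (u i) (w i)) →
    (∀ i, hT.Rep L (v i) (w' i)) →
    quotMapThree k (augIdeal T ^ L) (augIdeal T ^ L) (augIdeal T ^ L)
        (TensorProduct.assoc k⟦X⟧ _ _ _ (∑ i, w i ⊗ₜ v i))
      = quotMapThree k (augIdeal T ^ L) (augIdeal T ^ L) (augIdeal T ^ L) (∑ i, u i ⊗ₜ w' i) := by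
  obtain ⟨M, hM⟩ := hT.exists_component_eq_zero L
  refine ⟨max M L, fun N hN a n u v w w' h hw hw' => ?_⟩
  have h0 : ∀ b ∈ (hT.openPow N).toIdeal,
      component (T.comul b) (hT.openPow L) (hT.openPow L) = 0 :=
    fun b hb => hM b (Ideal.pow_le_pow_right (by omega) hb)
  have hNL := hT.openPow_anti (show L ≤ N by omega)
  have := T.coassoc (hT.openPow L) (hT.openPow L) (hT.openPow L) (hT.openPow N) (hT.openPow N)
    h0 h0 a n n u v u v (approximates_iff.2 (Represents.mono h le_rfl hNL))
    (approximates_iff.2 (Represents.mono h hNL le_rfl))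
  rw [map_sum, map_sum, map_sum]
  simp only [quotMapThree_assoc, quotMapThree_tmul]
  rw [map_sum] at this
  refine Eq.trans ?_ (this.trans ?_)
  · refine Finset.sum_congr rfl fun i _ => ?_
    rw [hw i]
    rfl
  · refine Finset.sum_congr rfl fun i _ => ?_
    rw [hw' i]
    rfl

/-! ### The antipode -/

/-- If `ψ = φ * id` then `φ = ψ * S`, for the convolution product. -/
theorem convolution_antipode (φ ψ : F →ₗ[k⟦X⟧] F) (L : ℕ)
    (hφ : ∃ M, ∀ a ∈ augIdeal T ^ M, φ a ∈ augIdeal T ^ L)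
    (h : ∃ M, ∀ a z, hT.Rep M a z → convMap φ LinearMap.id z - ψ a ∈ augIdeal T ^ L) :
    ∃ M, ∀ N ≥ M, ∀ a z, hT.Rep N a z → convMap ψ T.antipode z - φ a ∈ augIdeal T ^ L := by
  obtain ⟨M₀, hM₀⟩ := hφ
  obtain ⟨M₁, hM₁⟩ := h
  obtain ⟨M₂, hM₂⟩ := hT.exists_antipode_mem L
  obtain ⟨M₃, hM₃⟩ := hT.exists_convMap_antipode_right L
  obtain ⟨K, hK⟩ : ∃ K, K = max (max M₀ M₁) (max (max M₂ M₃) L) := ⟨_, rfl⟩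
  obtain ⟨M₄, hM₄⟩ := hT.exists_coassoc K
  refine ⟨max M₄ K, fun N hN a z hz => ?_⟩
  obtain ⟨n, u, v, rfl⟩ := exists_fin_sum_tmul z
  choose w hw using fun i => hT.exists_rep K (u i)
  choose w' hw' using fun i => hT.exists_rep K (v i)
  let q : F →ₐ[k⟦X⟧] F ⧸ augIdeal T ^ L := Ideal.Quotient.mkₐ k⟦X⟧ _
  have hq : ∀ a, q a = 0 ↔ a ∈ augIdeal T ^ L := fun a => Ideal.Quotient.eq_zero_iff_mem
  -- Coassociativity is tested against `a ⊗ b ⊗ c ↦ φ(a) b S(c)` modulo `Iᴸ`. One bracketing gives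
  -- `(φ * id) * S = ψ * S`, the other `φ * (id * S) = φ * ε = φ`.
  let τ : F ⊗[k⟦X⟧] (F ⊗[k⟦X⟧] F) →ₗ[k⟦X⟧] F ⧸ augIdeal T ^ L := q.toLinearMap ∘ₗ
    LinearMap.mul' k⟦X⟧ F ∘ₗ TensorProduct.map φ (convMap LinearMap.id T.antipode)
  have hτ : ∀ a z, τ (a ⊗ₜ z) = q (φ a * convMap LinearMap.id T.antipode z) := fun _ _ => rfl
  have hτ' : ∀ z a, τ (TensorProduct.assoc k⟦X⟧ _ _ _ (z ⊗ₜ a))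
      = q (convMap φ LinearMap.id z * T.antipode a) := by
    intro z a
    induction z with
    | zero => simp
    | tmul b c =>
      rw [TensorProduct.assoc_tmul, hτ, convMap_tmul, convMap_tmul, mul_assoc]
    | add z z' h h' => rw [TensorProduct.add_tmul, map_add, map_add, h, h', map_add, add_mul, map_add]
  have key := eq_of_quotMapThree_eq τ ?_ ?_ ?_
    (hM₄ N (by omega) a n u v w w' hz hw hw')
  · rw [map_sum, map_sum, map_sum] at key
    simp only [hτ, hτ'] at key
    have e1 : ∀ i, q (convMap φ LinearMap.id (w i) * T.antipode (v i))
        = q (ψ (u i) * T.antipode (v i)) := by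
      intro i
      rw [← sub_eq_zero, ← map_sub, hq, ← sub_mul]
      exact Ideal.mul_mem_right _ _ (hM₁ _ _ ((hw i).mono (by omega)))
    have e2 : ∀ i, q (φ (u i) * convMap LinearMap.id T.antipode (w' i))
        = q (φ (u i * unitCounit T (v i))) := by
      intro i
      rw [unitCounit_apply, ← Algebra.commutes, ← Algebra.smul_def, map_smul, Algebra.smul_def,
        Algebra.commutes, ← sub_eq_zero, ← map_sub, hq, ← mul_sub]
      exact Ideal.mul_mem_left _ _ (hM₃ K (by omega) _ _ (hw' i))
    simp only [e1, e2] at key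
    rw [← hq, map_sub, map_sum, map_sum]
    simp only [convMap_tmul]
    rw [key, ← map_sum, ← map_sum, ← map_sub, hq, ← map_sub]
    refine hM₀ _ ?_
    have := hT.convMap_counit_right hz
    rw [map_sum] at this
    exact Ideal.pow_le_pow_right (by omega) this
  · intro b hb c d
    rw [hτ, hq]
    exact Ideal.mul_mem_right _ _ (hM₀ _ (Ideal.pow_le_pow_right (by omega) hb))
  · intro b c hc d
    rw [hτ, hq, convMap_tmul]
    exact Ideal.mul_mem_left _ _ (Ideal.mul_mem_right _ _
      (Ideal.pow_le_pow_right (by omega) hc))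
  · intro b c d hd
    rw [hτ, hq, convMap_tmul]
    exact Ideal.mul_mem_left _ _ (Ideal.mul_mem_left _ _
      (hM₂ _ (Ideal.pow_le_pow_right (by omega) hd)))

/-- In Sweedler notation, `S(a₍₁₎ b) a₍₂₎ = ε(a) S(b)`. With `∑ uᵢ ⊗ vᵢ` representing `Δ(a)`, the
map `φ(c) = ∑ S(uᵢ c) vᵢ` satisfies `φ * id = ε(a) ε`, since `Δ(a)Δ(c) = Δ(ac)`; cancelling `id` by
`convolution_antipode` gives `φ = ε(a) S`. -/
theorem exists_convMap_antipode_mul (L : ℕ) : ∃ M, ∀ N ≥ M, ∀ a b z, hT.Rep N a z →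
    convMap (T.antipode ∘ₗ LinearMap.mulRight k⟦X⟧ b) LinearMap.id z
      - T.counit a • T.antipode b ∈ augIdeal T ^ L := by
  obtain ⟨M₁, hM₁⟩ := hT.exists_convMap_antipode_left L
  obtain ⟨M₂, hM₂⟩ := hT.exists_antipode_mem L
  refine ⟨max M₁ M₂, fun N hN a b z hz => ?_⟩
  obtain ⟨n, u, v, rfl⟩ := exists_fin_sum_tmul z
  let φ : F →ₗ[k⟦X⟧] F := ∑ i, LinearMap.mulRight k⟦X⟧ (v i) ∘ₗ T.antipode ∘ₗ
    LinearMap.mulLeft k⟦X⟧ (u i)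
  have hφ : ∀ c, φ c = ∑ i, T.antipode (u i * c) * v i := fun c => by simp [φ]
  let ψ : F →ₗ[k⟦X⟧] F := T.counit a • unitCounit T
  have hφψ : ∀ c w, hT.Rep N c w → convMap φ LinearMap.id w - ψ c ∈ augIdeal T ^ L := by
    intro c w hw
    have h1 := hM₁ N (by omega) _ _ (hz.mul hw)
    have h2 : ∀ w, convMap φ LinearMap.id w
        = convMap T.antipode LinearMap.id ((∑ i, u i ⊗ₜ v i) * w) := by
      intro w
      induction w with
      | zero => simp
      | tmul p q =>
        rw [Finset.sum_mul, map_sum, convMap_tmul, hφ, Finset.sum_mul]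
        refine Finset.sum_congr rfl fun i _ => ?_
        rw [Algebra.TensorProduct.tmul_mul_tmul, convMap_tmul, LinearMap.id_apply,
          LinearMap.id_apply, mul_assoc]
      | add w w' h h' => rw [map_add, h, h', mul_add, map_add]
    have h3 : ψ c = unitCounit T (a * c) := by
      simp [ψ, Algebra.smul_def]
    rwa [h2, h3]
  obtain ⟨M₃, hM₃⟩ := hT.convolution_antipode φ ψ L ⟨M₂, fun c hc => by
    rw [hφ]
    exact sum_mem fun i _ => Ideal.mul_mem_right _ _ (hM₂ _ (Ideal.mul_mem_left _ _ hc))⟩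
    ⟨N, hφψ⟩
  obtain ⟨w, hw⟩ := hT.exists_rep (max M₂ M₃) b
  have h1 := hM₃ _ (by omega) b w hw
  have h2 : convMap ψ T.antipode w
      = T.counit a • T.antipode (convMap (unitCounit T) LinearMap.id w) := by
    clear hw h1
    induction w with
    | zero => simp
    | tmul p q =>
      rw [convMap_tmul, convMap_tmul, unitCounit_apply, ← Algebra.smul_def, map_smul]
      simp [ψ, Algebra.smul_def, mul_assoc]
    | add w w' h h' => rw [map_add, h, h', map_add, map_add, smul_add]
  have h3 := ideal_smul_mem (T.counit a) (hM₂ _ (Ideal.pow_le_pow_right (le_max_left M₂ M₃)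
    (hT.convMap_counit_left hw)))
  rw [map_sum]
  simp only [convMap_tmul, LinearMap.coe_comp, Function.comp_apply, LinearMap.mulRight_apply,
    LinearMap.id_apply]
  rw [← hφ]
  rw [map_sub, smul_sub, ← h2] at h3
  have := sub_mem h3 h1
  rwa [sub_sub_sub_cancel_left] at this

/-- The antipode is antimultiplicative. -/
theorem antipode_mul (a b : F) : T.antipode (a * b) = T.antipode b * T.antipode a := by
  rw [← sub_eq_zero]
  refine hT.separated _ fun L => ?_
  obtain ⟨M₂, hM₂⟩ := hT.exists_antipode_mem L
  -- With `φ(a) = S(ab)` and `ψ(a) = ε(a) S(b)`, the preceding lemma says `φ * id = ψ`. Hence `φ = ψ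
  -- * S`, and `ψ * S` sends `a` to `S(b) S(a)`.
  let φ : F →ₗ[k⟦X⟧] F := T.antipode ∘ₗ LinearMap.mulRight k⟦X⟧ b
  let ψ : F →ₗ[k⟦X⟧] F := T.counit.toLinearMap.smulRight (T.antipode b)
  obtain ⟨M₁, hM₁⟩ := hT.exists_convMap_antipode_mul L
  obtain ⟨M₃, hM₃⟩ := hT.convolution_antipode φ ψ L
    ⟨M₂, fun c hc => hM₂ _ (Ideal.mul_mem_right _ _ hc)⟩ ⟨M₁, fun a z h => hM₁ _ le_rfl a b z h⟩
  obtain ⟨w, hw⟩ := hT.exists_rep (max M₂ M₃) a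
  have h1 := hM₃ _ (le_max_right M₂ M₃) a w hw
  have h2 : convMap ψ T.antipode w
      = T.antipode b * T.antipode (convMap (unitCounit T) LinearMap.id w) := by
    clear hw h1
    induction w with
    | zero => simp
    | tmul p q =>
      rw [convMap_tmul, convMap_tmul, unitCounit_apply, ← Algebra.smul_def, map_smul]
      simp [ψ]
    | add w w' h h' => rw [map_add, h, h', map_add, map_add, mul_add]
  have h3 := Ideal.mul_mem_left (augIdeal T ^ L) (T.antipode b)
    (hM₂ _ (Ideal.pow_le_pow_right (le_max_left M₂ M₃) (hT.convMap_counit_left hw)))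
  rw [map_sub, mul_sub, ← h2] at h3
  have := sub_mem h3 h1
  rwa [sub_sub_sub_cancel_left] at this

/-- Apply `ε` to `S(a₍₁₎) a₍₂₎ = ε(a)`: the left side becomes `ε(S(a₍₁₎ ε(a₍₂₎))) = ε(S(a))`. This
holds modulo every power of `h`. -/
theorem counit_antipode (a : F) : T.counit (T.antipode a) = T.counit a := by
  refine isHComplete_powerSeries.eq fun L => ?_
  obtain ⟨M₁, hM₁⟩ := hT.exists_convMap_antipode_left L
  obtain ⟨M₂, hM₂⟩ := hT.exists_antipode_mem L
  obtain ⟨z, hz⟩ := hT.exists_rep (max M₁ M₂) a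
  have h1 := counit_pow_dvd T _ _ (hM₁ _ (le_max_left M₁ M₂) a z hz)
  have h2 := counit_pow_dvd T _ _ (hM₂ _ (Ideal.pow_le_pow_right (le_max_right M₁ M₂)
    (hT.convMap_counit_right hz)))
  have h3 : T.counit (convMap T.antipode LinearMap.id z)
      = T.counit (T.antipode (convMap LinearMap.id (unitCounit T) z)) := by
    clear hz h1 h2
    induction z with
    | zero => simp
    | tmul p q =>
      rw [convMap_tmul, convMap_tmul, unitCounit_apply, ← Algebra.commutes, ← Algebra.smul_def,
        map_smul, map_smul, map_mul, mul_comm]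
      rfl
    | add w w' h h' => rw [map_add, map_add, h, h', map_add, map_add, map_add]
  rw [map_sub, h3, unitCounit_apply, AlgHom.commutes] at h1
  rw [map_sub, map_sub] at h2
  have := dvd_sub h1 h2
  rw [sub_sub_sub_cancel_left] at this
  exact this

theorem antipode_mem_augIdeal {a : F} (ha : a ∈ augIdeal T) : T.antipode a ∈ augIdeal T := by
  rw [mem_augIdeal] at ha ⊢
  rwa [hT.counit_antipode]

end IsAugAdic

end HopfF

/-! ### The coproduct of `F^×` -/

section TimesHopf

variable {k F A : Type*} [Field k] [Ring F] [Algebra k⟦X⟧ F] [TopologicalSpace F]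
  [Ring A] [Algebra k⟦X⟧ A] {T : TopologicalHopfAlgebra k F}

theorem tmul_mem_hPow_left {B C : Type*} [Ring B] [Algebra k⟦X⟧ B] [Ring C] [Algebra k⟦X⟧ C]
    {n : ℕ} {a : B} (ha : a ∈ hPow k B n) (b : C) : a ⊗ₜ[k⟦X⟧] b ∈ hPow k (B ⊗[k⟦X⟧] C) n := by
  obtain ⟨c, rfl⟩ := ha
  exact ⟨c ⊗ₜ b, TensorProduct.smul_tmul' _ _ _⟩

theorem tmul_mem_hPow_right {B C : Type*} [Ring B] [Algebra k⟦X⟧ B] [Ring C] [Algebra k⟦X⟧ C]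
    {n : ℕ} (a : B) {b : C} (hb : b ∈ hPow k C n) : a ⊗ₜ[k⟦X⟧] b ∈ hPow k (B ⊗[k⟦X⟧] C) n := by
  obtain ⟨c, rfl⟩ := hb
  exact ⟨a ⊗ₜ c, TensorProduct.tmul_smul _ _ _⟩

/-- The map `j ⊗ j`. -/
abbrev tensorSq {B C : Type*} [Ring B] [Algebra k⟦X⟧ B] [Ring C] [Algebra k⟦X⟧ C]
    (j : B →ₐ[k⟦X⟧] C) : B ⊗[k⟦X⟧] B →ₐ[k⟦X⟧] C ⊗[k⟦X⟧] C := Algebra.TensorProduct.map j j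

/-- `z ∈ F^× ⊗ F^×` represents `Δ(a)` modulo `hᴺ`. -/
def IsAugAdic.TRep (hT : IsAugAdic T) (j : F →ₐ[k⟦X⟧] A) (N : ℕ) (a : A) (z : A ⊗[k⟦X⟧] A) : Prop :=
  ∃ (n : ℕ) (f : F) (w : F ⊗[k⟦X⟧] F), (PowerSeries.X ^ n : k⟦X⟧) • a = j f ∧
    hT.Rep (N + n) f w ∧
    tensorSq j w - (PowerSeries.X ^ n : k⟦X⟧) • z ∈ hPow k (A ⊗[k⟦X⟧] A) (N + n)

theorem IsAugAdic.Rep.smul {hT : IsAugAdic T} {N : ℕ} {a : F} {z : F ⊗[k⟦X⟧] F} (h : hT.Rep N a z)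
    (r : k⟦X⟧) : hT.Rep N (r • a) (r • z) := by
  rw [IsAugAdic.Rep, Represents, map_smul, map_smul, ← h]
  rfl

theorem IsAugAdic.Rep.add {hT : IsAugAdic T} {N : ℕ} {a b : F} {z w : F ⊗[k⟦X⟧] F}
    (h : hT.Rep N a z) (h' : hT.Rep N b w) : hT.Rep N (a + b) (z + w) := by
  rw [IsAugAdic.Rep, Represents, map_add, map_add, ← h, ← h']
  rfl

theorem IsAugAdic.rep_algebraMap (hT : IsAugAdic T) (N : ℕ) (r : k⟦X⟧) :
    hT.Rep N (algebraMap _ _ r) (algebraMap _ _ r) := by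
  rw [IsAugAdic.Rep, Represents, AlgHom.commutes, AlgHom.commutes]
  rfl

namespace IsTimes

variable {j : F →ₐ[k⟦X⟧] A} (hj : IsTimes T j) (hT : IsAugAdic T)
include hj

theorem tensor_torsionFree : HTorsionFree k (A ⊗[k⟦X⟧] A) := hj.torsionFree.tensor hj.torsionFree

/-- `Iᴺ` becomes divisible by `hᴺ` in `A`, so the indeterminacy `Iᴺ ⊗ F + F ⊗ Iᴺ` of a
representative turns into multiples of `hᴺ`. -/
theorem tensorSq_sub_mem {N : ℕ} {f : F} {w w' : F ⊗[k⟦X⟧] F} (h : hT.Rep N f w)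
    (h' : hT.Rep N f w') : tensorSq j w - tensorSq j w' ∈ hPow k (A ⊗[k⟦X⟧] A) N := by
  rw [← Ideal.Quotient.eq]
  refine eq_of_quotMap_eq (P := augIdeal T ^ N) (Q := augIdeal T ^ N)
    ((Ideal.Quotient.mkₐ k⟦X⟧ (hPow k (A ⊗[k⟦X⟧] A) N)).comp (tensorSq j)).toLinearMap
    (fun a ha b => ?_) (fun a b hb => ?_) (h.symm.trans h')
  · exact Ideal.Quotient.eq_zero_iff_mem.2 (tmul_mem_hPow_left (hj.map_mem_hPow ha) _)
  · exact Ideal.Quotient.eq_zero_iff_mem.2 (tmul_mem_hPow_right _ (hj.map_mem_hPow hb))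

/-- The denominator `hⁿ` may be enlarged and the precision `L` in `F ⊗ F` raised at will, the defect
being absorbed in `hᴺ t`. Two representatives can thus be compared, added or multiplied over
suitable denominators. -/
theorem trep_normalForm {N : ℕ} {a : A} {z : A ⊗[k⟦X⟧] A} (h : hT.TRep j N a z) :
    ∃ n₀, ∀ n ≥ n₀, ∀ L, ∃ (f : F) (w : F ⊗[k⟦X⟧] F) (t : A ⊗[k⟦X⟧] A),
      (PowerSeries.X ^ n : k⟦X⟧) • a = j f ∧ hT.Rep L f w ∧
      tensorSq j w = (PowerSeries.X ^ n : k⟦X⟧) • (z + (PowerSeries.X ^ N : k⟦X⟧) • t) := by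
  obtain ⟨n₀, f, w, ha, hw, hz⟩ := h
  refine ⟨n₀, fun n hn L => ?_⟩
  obtain ⟨d, rfl⟩ := Nat.exists_eq_add_of_le hn
  obtain ⟨w', hw'⟩ := hT.exists_rep (max L (N + n₀)) f
  obtain ⟨t, ht⟩ := sub_mem_hPow_trans
    (hj.tensorSq_sub_mem hT (hw'.mono (le_max_right _ _)) hw) hz
  refine ⟨(PowerSeries.X ^ d : k⟦X⟧) • f, (PowerSeries.X ^ d : k⟦X⟧) • w', t, ?_,
    (hw'.mono (le_max_left _ _)).smul _, ?_⟩
  · rw [map_smul, ← ha, smul_smul, ← pow_add, add_comm]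
  · rw [map_smul, sub_eq_iff_eq_add'.1 ht, add_comm n₀ d]
    simp only [smul_add, smul_smul, ← pow_add]
    rw [add_comm N n₀, ← add_assoc]

omit hj in
theorem trep_of_normalForm {N n : ℕ} {a : A} {z z' : A ⊗[k⟦X⟧] A} {f : F} {w : F ⊗[k⟦X⟧] F}
    (ha : (PowerSeries.X ^ n : k⟦X⟧) • a = j f) (hw : hT.Rep (N + n) f w)
    (hz : tensorSq j w = (PowerSeries.X ^ n : k⟦X⟧) • z')
    (hzz : z' - z ∈ hPow k (A ⊗[k⟦X⟧] A) N) : hT.TRep j N a z :=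
  ⟨n, f, w, ha, hw, by
    rw [hz, ← smul_sub]
    exact pow_smul_mem_hPow_add n hzz⟩

omit hj in
theorem trep_map {N : ℕ} {f : F} {w : F ⊗[k⟦X⟧] F} (h : hT.Rep N f w) :
    hT.TRep j N (j f) (tensorSq j w) := ⟨0, f, w, by simp, h, by simp⟩

omit hj in
theorem trep_mono {M N : ℕ} (hMN : M ≤ N) {a : A} {z : A ⊗[k⟦X⟧] A} (h : hT.TRep j N a z) :
    hT.TRep j M a z := by
  obtain ⟨n, f, w, ha, hw, hz⟩ := h
  exact ⟨n, f, w, ha, hw.mono (by omega), hPow_anti (by omega) hz⟩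

omit hj in
theorem trep_congr {N : ℕ} {a : A} {z z' : A ⊗[k⟦X⟧] A} (h : hT.TRep j N a z)
    (hz : z - z' ∈ hPow k (A ⊗[k⟦X⟧] A) N) : hT.TRep j N a z' := by
  obtain ⟨n, f, w, ha, hw, h⟩ := h
  refine ⟨n, f, w, ha, hw, sub_mem_hPow_trans h ?_⟩
  rw [← smul_sub]
  exact pow_smul_mem_hPow_add n hz

theorem trep_unique {N : ℕ} {a : A} {z z' : A ⊗[k⟦X⟧] A} (h : hT.TRep j N a z)
    (h' : hT.TRep j N a z') : z - z' ∈ hPow k (A ⊗[k⟦X⟧] A) N := by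
  obtain ⟨n, hn⟩ := hj.trep_normalForm hT h
  obtain ⟨n', hn'⟩ := hj.trep_normalForm hT h'
  obtain ⟨f, w, t, ha, hw, hz⟩ := hn (max n n') (le_max_left _ _) (N + max n n')
  obtain ⟨f', w', t', ha', hw', hz'⟩ := hn' (max n n') (le_max_right _ _) (N + max n n')
  obtain rfl : f = f' := hj.injective (ha.symm.trans ha')
  have h1 := hj.tensorSq_sub_mem hT hw hw'
  rw [hz, hz', ← smul_sub] at h1
  have h2 := hj.tensor_torsionFree.mem_hPow_of_smul h1
  rw [add_sub_add_comm, ← smul_sub] at h2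
  have := sub_mem h2 (pow_smul_mem_hPow N (t - t'))
  rwa [add_sub_cancel_right] at this

theorem trep_add {N : ℕ} {a b : A} {z z' : A ⊗[k⟦X⟧] A} (h : hT.TRep j N a z)
    (h' : hT.TRep j N b z') : hT.TRep j N (a + b) (z + z') := by
  obtain ⟨n, hn⟩ := hj.trep_normalForm hT h
  obtain ⟨n', hn'⟩ := hj.trep_normalForm hT h'
  obtain ⟨f, w, t, ha, hw, hz⟩ := hn (max n n') (le_max_left _ _) (N + max n n')
  obtain ⟨f', w', t', ha', hw', hz'⟩ := hn' (max n n') (le_max_right _ _) (N + max n n')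
  refine trep_of_normalForm hT (by rw [smul_add, ha, ha', ← map_add]) (hw.add hw')
    (by rw [map_add, hz, hz', ← smul_add]) ?_
  rw [add_add_add_comm, add_sub_cancel_left, ← smul_add]
  exact pow_smul_mem_hPow _ _

theorem trep_mul {N : ℕ} {a b : A} {z z' : A ⊗[k⟦X⟧] A} (h : hT.TRep j N a z)
    (h' : hT.TRep j N b z') : hT.TRep j N (a * b) (z * z') := by
  obtain ⟨n, hn⟩ := hj.trep_normalForm hT h
  obtain ⟨n', hn'⟩ := hj.trep_normalForm hT h'
  obtain ⟨f, w, t, ha, hw, hz⟩ := hn n le_rfl (N + (n + n'))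
  obtain ⟨f', w', t', ha', hw', hz'⟩ := hn' n' le_rfl (N + (n + n'))
  refine trep_of_normalForm (n := n + n') hT
    (by rw [pow_add, ← smul_mul_smul_comm, ha, ha', ← map_mul]) (hw.mul hw')
    (by rw [map_mul, hz, hz', smul_mul_smul_comm, ← pow_add]) ?_
  refine mul_sub_mul_mem_hPow ?_ ?_
  · rw [add_sub_cancel_left]
    exact pow_smul_mem_hPow _ _
  · rw [add_sub_cancel_left]
    exact pow_smul_mem_hPow _ _

omit hj in
theorem trep_algebraMap (N : ℕ) (r : k⟦X⟧) :
    hT.TRep j N (algebraMap _ _ r) (algebraMap _ _ r) := by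
  have := trep_map (j := j) hT (hT.rep_algebraMap N r)
  rwa [AlgHom.commutes, AlgHom.commutes] at this

theorem trep_pow_smul {N : ℕ} (m : ℕ) {a : A} {z : A ⊗[k⟦X⟧] A} (h : hT.TRep j N a z) :
    hT.TRep j (N + m) ((PowerSeries.X ^ m : k⟦X⟧) • a) ((PowerSeries.X ^ m : k⟦X⟧) • z) := by
  obtain ⟨n, hn⟩ := hj.trep_normalForm hT h
  obtain ⟨f, w, t, ha, hw, hz⟩ := hn n le_rfl (N + m + n)
  refine trep_of_normalForm (n := n) hT (by rw [smul_comm, ha, ← map_smul]) (hw.smul _)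
    (by rw [map_smul, hz, smul_comm]) ?_
  rw [← smul_sub, add_sub_cancel_left]
  exact pow_smul_mem_hPow_add m (pow_smul_mem_hPow _ _)

/-- In `A` every `j(u)` is congruent to `ε(u)` modulo `h`, so modulo `h` the map `j ⊗ j` becomes `ε
⊗ ε`. For a representative of `Δ(f)` with `f ∈ I` this yields divisibility by `h`. -/
theorem tensorSq_sub_counit_mem (w : F ⊗[k⟦X⟧] F) :
    tensorSq j w - algebraMap _ _ (T.counit (convMap (unitCounit T) LinearMap.id w))
      ∈ hPow k (A ⊗[k⟦X⟧] A) 1 := by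
  have h1 : ∀ u : F, j u - algebraMap k⟦X⟧ A (T.counit u) ∈ hPow k A 1 := by
    intro u
    rw [← j.commutes, ← map_sub]
    refine hj.map_mem_hPow ?_
    rw [Submodule.pow_one]
    exact sub_counit_mem_augIdeal T u
  induction w with
  | zero => simp
  | tmul u v =>
    have e : tensorSq j (u ⊗ₜ v) - algebraMap k⟦X⟧ (A ⊗[k⟦X⟧] A)
        (T.counit (convMap (unitCounit T) LinearMap.id (u ⊗ₜ v)))
        = (j u - algebraMap k⟦X⟧ A (T.counit u)) ⊗ₜ j v
          + algebraMap k⟦X⟧ A (T.counit u) ⊗ₜ (j v - algebraMap k⟦X⟧ A (T.counit v)) := by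
      rw [Algebra.TensorProduct.map_tmul, convMap_tmul, unitCounit_apply, map_mul,
        AlgHom.commutes, LinearMap.id_apply, TensorProduct.sub_tmul, TensorProduct.tmul_sub,
        Algebra.TensorProduct.algebraMap_apply, Algebra.algebraMap_eq_smul_one (T.counit v),
        TensorProduct.tmul_smul, TensorProduct.smul_tmul', Algebra.algebraMap_self_apply,
        Algebra.smul_def (T.counit v), ← (algebraMap k⟦X⟧ A).map_mul, mul_comm (T.counit v)]
      abel
    rw [e]
    exact add_mem (tmul_mem_hPow_left (h1 u) _) (tmul_mem_hPow_right _ (h1 v))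
  | add w w' h h' =>
    rw [map_add, map_add, map_add, map_add, add_sub_add_comm]
    exact add_mem h h'

/-- At precision `0` the content is that `(j ⊗ j)Δ(f)` is divisible by the denominator of `h⁻ⁿ f`.
This holds for the generators `h⁻¹ f` and passes to sums and products. Higher precision is then
free, by taking a finer representative in `F ⊗ F`. -/
theorem exists_trep (N : ℕ) (a : A) : ∃ z, hT.TRep j N a z := by
  have key : ∀ a, ∃ z, hT.TRep j 0 a z := by
    refine hj.induction (fun r => ⟨_, trep_algebraMap hT 0 r⟩) (fun b f hf hb => ?_)
      (fun a b ha hb => ?_) (fun a b ha hb => ?_)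
    · obtain ⟨w, hw⟩ := hT.exists_rep 1 f
      -- At precision `0` with denominator `h` the claim is only that `(j ⊗ j)(w)` is divisible by
      -- `h`; the value `0` for `z` is as good as any.
      refine ⟨0, 1, f, w, by rwa [pow_one], hw, ?_⟩
      rw [smul_zero, sub_zero]
      have h1 := hj.tensorSq_sub_counit_mem w
      have h2 := hT.convMap_counit_left hw
      rw [Submodule.pow_one] at h2
      have h3 := mem_augIdeal.1 ((Submodule.add_mem_iff_right _ h2).2 hf)
      rw [sub_add_cancel] at h3
      obtain ⟨r, hr⟩ := PowerSeries.X_dvd_iff.2 h3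
      rw [hr, map_mul, ← Algebra.smul_def] at h1
      have h4 : (PowerSeries.X : k⟦X⟧) • algebraMap k⟦X⟧ (A ⊗[k⟦X⟧] A) r ∈ hPow k _ 1 :=
        mem_hPow_one.2 ⟨_, rfl⟩
      have := add_mem h1 h4
      rwa [sub_add_cancel] at this
    · obtain ⟨z, hz⟩ := ha
      obtain ⟨z', hz'⟩ := hb
      exact ⟨_, hj.trep_add hT hz hz'⟩
    · obtain ⟨z, hz⟩ := ha
      obtain ⟨z', hz'⟩ := hb
      exact ⟨_, hj.trep_mul hT hz hz'⟩
  -- The exact quotient of `(j ⊗ j)(w)` by `hⁿ`, for `w` at precision `N + n`, represents `Δ(a)`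
  -- modulo `hᴺ`.
  obtain ⟨z, hz⟩ := key a
  obtain ⟨n, hn⟩ := hj.trep_normalForm hT hz
  obtain ⟨f, w, t, ha, hw, hz⟩ := hn n le_rfl (N + n)
  exact ⟨_, trep_of_normalForm hT ha hw hz (by rw [sub_self]; exact zero_mem _)⟩

theorem trep_congr_left {N : ℕ} {a a' : A} {z : A ⊗[k⟦X⟧] A} (h : hT.TRep j N a z)
    (ha : a' - a ∈ hPow k A N) : hT.TRep j N a' z := by
  obtain ⟨b, hb⟩ := ha
  obtain ⟨w, hw⟩ := hj.exists_trep hT 0 b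
  have h1 := hj.trep_pow_smul hT N hw
  rw [zero_add] at h1
  have := hj.trep_add hT h h1
  rw [← hb, add_sub_cancel] at this
  refine trep_congr hT this ?_
  rw [add_sub_cancel_left]
  exact pow_smul_mem_hPow _ _

theorem trep_smul {N : ℕ} {a : A} {z : A ⊗[k⟦X⟧] A} (r : k⟦X⟧) (h : hT.TRep j N a z) :
    hT.TRep j N (r • a) (r • z) := by
  rw [Algebra.smul_def, Algebra.smul_def]
  exact hj.trep_mul hT (trep_algebraMap hT N r) h

/-! ### The Hopf algebra axioms for `F^×` -/

/-- A convolution identity `φ * ψ = θ` passes from `F` to `F^×`: clear the denominator `hⁿ`, use the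
identity in `F` at precision `N + n`, and divide by `hⁿ`. The counit and antipode axioms are all of
this form. -/
theorem convMap_sub_mem {φ ψ θ : F →ₗ[k⟦X⟧] F} {φ' ψ' θ' : A →ₗ[k⟦X⟧] A}
    (hφ : ∀ f, φ' (j f) = j (φ f)) (hψ : ∀ f, ψ' (j f) = j (ψ f)) (hθ : ∀ f, θ' (j f) = j (θ f))
    (h : ∀ L, ∃ M, ∀ N ≥ M, ∀ a z, hT.Rep N a z → convMap φ ψ z - θ a ∈ augIdeal T ^ L)
    {N : ℕ} {a : A} {z : A ⊗[k⟦X⟧] A} (hz : hT.TRep j N a z) :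
    convMap φ' ψ' z - θ' a ∈ hPow k A N := by
  obtain ⟨n, hn⟩ := hj.trep_normalForm hT hz
  obtain ⟨M, hM⟩ := h (N + n)
  obtain ⟨f, w, t, ha, hw, hz⟩ := hn n le_rfl M
  have h1 := hj.map_mem_hPow (hM M le_rfl f w hw)
  have h2 : ∀ w, j (convMap φ ψ w) = convMap φ' ψ' (tensorSq j w) := by
    intro w
    induction w with
    | zero => simp
    | tmul u v =>
      rw [convMap_tmul, Algebra.TensorProduct.map_tmul, convMap_tmul, hφ, hψ, map_mul]
    | add w w' h h' => rw [map_add, map_add, h, h', map_add, map_add]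
  rw [map_sub, h2, hz, ← hθ, ← ha, map_smul, map_smul, ← smul_sub] at h1
  have h3 := hj.torsionFree.mem_hPow_of_smul h1
  rw [map_add, map_smul, add_sub_right_comm] at h3
  have := sub_mem h3 (pow_smul_mem_hPow N (convMap φ' ψ' t))
  rwa [add_sub_cancel_right] at this

theorem exists_counit : ∃ ε : A →ₗ[k⟦X⟧] k⟦X⟧, ∀ f, ε (j f) = T.counit f := by
  refine hj.exists_extend hTorsionFree_powerSeries T.counit.toLinearMap fun a => ?_
  obtain ⟨n, f, hf, ha⟩ := hj.exists_mem_pow a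
  obtain ⟨r, hr⟩ := counit_pow_dvd T n f hf
  exact ⟨n, f, r, ha, hr.symm⟩

include hT in
-- Since `S` reverses products and preserves `I`, it maps `Iⁿ` into `Iⁿ`; hence `S(f)` is divisible
-- by `hⁿ` in `F^×` whenever `f ∈ Iⁿ`.
theorem exists_antipode : ∃ S : A →ₗ[k⟦X⟧] A, ∀ f, S (j f) = j (T.antipode f) := by
  refine hj.exists_extend hj.torsionFree (j.toLinearMap ∘ₗ T.antipode) fun a => ?_
  obtain ⟨n, f, hf, ha⟩ := hj.exists_mem_pow a
  have h : T.antipode f ∈ augIdeal T ^ n := by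
    refine ideal_pow_induction (J := augIdeal T) (p := fun n f => T.antipode f ∈ augIdeal T ^ n)
      (fun a => ideal_pow_zero_mem _) (fun n a b ha hb => ?_) (fun n a b _ hb ha => ?_) n f hf
    · rw [map_add]
      exact add_mem ha hb
    · rw [hT.antipode_mul]
      exact ideal_mul_mem_pow_succ' (hT.antipode_mem_augIdeal hb) ha
  obtain ⟨m, hm⟩ := hj.exists_pow_div n _ h
  exact ⟨n, f, m, ha, hm⟩

/-- A chosen representative of `Δ(a)` modulo `hᴺ`. -/
def comulRep (N : ℕ) (a : A) : A ⊗[k⟦X⟧] A := (hj.exists_trep hT N a).choose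

theorem comulRep_spec (N : ℕ) (a : A) : hT.TRep j N a (hj.comulRep hT N a) :=
  (hj.exists_trep hT N a).choose_spec

/-- The map `Δ ⊗ id` modulo `hᴺ`. -/
def comulLeft (N : ℕ) : A ⊗[k⟦X⟧] A →ₗ[k⟦X⟧]
    (A ⊗[k⟦X⟧] (A ⊗[k⟦X⟧] A)) ⧸ hPow k (A ⊗[k⟦X⟧] (A ⊗[k⟦X⟧] A)) N :=
  TensorProduct.lift (LinearMap.mk₂ k⟦X⟧
    (fun p q => Ideal.Quotient.mkₐ k⟦X⟧ (hPow k (A ⊗[k⟦X⟧] (A ⊗[k⟦X⟧] A)) N)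
      (TensorProduct.assoc k⟦X⟧ _ _ _ (hj.comulRep hT N p ⊗ₜ q)))
    (fun p p' q => by
      rw [← map_add, ← map_add, ← TensorProduct.add_tmul]
      refine Ideal.Quotient.eq.2 ?_
      rw [← map_sub, ← TensorProduct.sub_tmul]
      exact _root_.QuantumDuality.map_mem_hPow ((TensorProduct.assoc k⟦X⟧ A A A).toLinearMap)
        (tmul_mem_hPow_left (hj.trep_unique hT (hj.comulRep_spec hT N (p + p'))
        (hj.trep_add hT (hj.comulRep_spec hT N p) (hj.comulRep_spec hT N p'))) q))
    (fun r p q => by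
      rw [← map_smul, ← map_smul, TensorProduct.smul_tmul']
      refine Ideal.Quotient.eq.2 ?_
      rw [← map_sub, ← TensorProduct.sub_tmul]
      exact _root_.QuantumDuality.map_mem_hPow ((TensorProduct.assoc k⟦X⟧ A A A).toLinearMap)
        (tmul_mem_hPow_left (hj.trep_unique hT (hj.comulRep_spec hT N (r • p))
        (hj.trep_smul hT r (hj.comulRep_spec hT N p))) q))
    (fun p q q' => by rw [TensorProduct.tmul_add, map_add, map_add])
    (fun r p q => by rw [TensorProduct.tmul_smul, map_smul, map_smul]))

theorem comulLeft_tmul {N : ℕ} {p : A} {z : A ⊗[k⟦X⟧] A} (h : hT.TRep j N p z) (q : A) :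
    hj.comulLeft hT N (p ⊗ₜ q)
      = Ideal.Quotient.mk _ (TensorProduct.assoc k⟦X⟧ _ _ _ (z ⊗ₜ q)) := by
  refine Ideal.Quotient.eq.2 ?_
  rw [← map_sub, ← TensorProduct.sub_tmul]
  exact _root_.QuantumDuality.map_mem_hPow ((TensorProduct.assoc k⟦X⟧ A A A).toLinearMap)
    (tmul_mem_hPow_left (hj.trep_unique hT (hj.comulRep_spec hT N p) h) q)

/-- The map `id ⊗ Δ` modulo `hᴺ`. -/
def comulRight (N : ℕ) : A ⊗[k⟦X⟧] A →ₗ[k⟦X⟧]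
    (A ⊗[k⟦X⟧] (A ⊗[k⟦X⟧] A)) ⧸ hPow k (A ⊗[k⟦X⟧] (A ⊗[k⟦X⟧] A)) N :=
  TensorProduct.lift (LinearMap.mk₂ k⟦X⟧
    (fun p q => Ideal.Quotient.mkₐ k⟦X⟧ (hPow k (A ⊗[k⟦X⟧] (A ⊗[k⟦X⟧] A)) N)
      (p ⊗ₜ hj.comulRep hT N q))
    (fun p p' q => by rw [TensorProduct.add_tmul, map_add])
    (fun r p q => by rw [← TensorProduct.smul_tmul', map_smul])
    (fun p q q' => by
      rw [← map_add, ← TensorProduct.tmul_add]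
      refine Ideal.Quotient.eq.2 ?_
      rw [← TensorProduct.tmul_sub]
      exact tmul_mem_hPow_right _ (hj.trep_unique hT (hj.comulRep_spec hT N (q + q'))
        (hj.trep_add hT (hj.comulRep_spec hT N q) (hj.comulRep_spec hT N q'))))
    (fun r p q => by
      rw [← map_smul, ← TensorProduct.tmul_smul]
      refine Ideal.Quotient.eq.2 ?_
      rw [← TensorProduct.tmul_sub]
      exact tmul_mem_hPow_right _ (hj.trep_unique hT (hj.comulRep_spec hT N (r • q))
        (hj.trep_smul hT r (hj.comulRep_spec hT N q)))))

theorem comulRight_tmul {N : ℕ} {q : A} {z : A ⊗[k⟦X⟧] A} (h : hT.TRep j N q z) (p : A) :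
    hj.comulRight hT N (p ⊗ₜ q) = Ideal.Quotient.mk _ (p ⊗ₜ z) := by
  refine Ideal.Quotient.eq.2 ?_
  rw [← TensorProduct.tmul_sub]
  exact tmul_mem_hPow_right _ (hj.trep_unique hT (hj.comulRep_spec hT N q) h)

theorem factor_comulLeft {M N : ℕ} (hMN : M ≤ N) (z : A ⊗[k⟦X⟧] A) :
    Ideal.Quotient.factorₐ k⟦X⟧ (hPow_anti hMN) (hj.comulLeft hT N z) = hj.comulLeft hT M z := by
  induction z with
  | zero => rw [map_zero, map_zero, map_zero]
  | tmul p q =>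
    have h := hj.comulRep_spec hT N p
    rw [hj.comulLeft_tmul hT h, hj.comulLeft_tmul hT (trep_mono hT hMN h)]
    rfl
  | add z z' h h' => rw [map_add, map_add, h, h', map_add]

theorem factor_comulRight {M N : ℕ} (hMN : M ≤ N) (z : A ⊗[k⟦X⟧] A) :
    Ideal.Quotient.factorₐ k⟦X⟧ (hPow_anti hMN) (hj.comulRight hT N z) = hj.comulRight hT M z := by
  induction z with
  | zero => rw [map_zero, map_zero, map_zero]
  | tmul p q =>
    have h := hj.comulRep_spec hT N q
    rw [hj.comulRight_tmul hT h, hj.comulRight_tmul hT (trep_mono hT hMN h)]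
    rfl
  | add z z' h h' => rw [map_add, map_add, h, h', map_add]

theorem comulLeft_eq_comulRight_map (K : ℕ) : ∃ M, ∀ (f : F) (w : F ⊗[k⟦X⟧] F), hT.Rep M f w →
    hj.comulLeft hT K (tensorSq j w) = hj.comulRight hT K (tensorSq j w) := by
  obtain ⟨M, hM⟩ := hT.exists_coassoc K
  refine ⟨M, fun f w hw => ?_⟩
  obtain ⟨n, u, v, rfl⟩ := exists_fin_sum_tmul w
  choose w hw using fun i => hT.exists_rep K (u i)
  choose w' hw' using fun i => hT.exists_rep K (v i)
  have h1 := hM M le_rfl f n u v w w' ‹_› hw hw'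
  let τ : F ⊗[k⟦X⟧] (F ⊗[k⟦X⟧] F) →ₗ[k⟦X⟧] _ :=
    (Ideal.Quotient.mkₐ k⟦X⟧ (hPow k (A ⊗[k⟦X⟧] (A ⊗[k⟦X⟧] A)) K)).toLinearMap ∘ₗ
      TensorProduct.map j.toLinearMap (tensorSq j).toLinearMap
  have hτ : ∀ a z, τ (a ⊗ₜ z) = Ideal.Quotient.mk _ (j a ⊗ₜ tensorSq j z) := fun _ _ => rfl
  have hτ' : ∀ z a, τ (TensorProduct.assoc k⟦X⟧ _ _ _ (z ⊗ₜ a))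
      = Ideal.Quotient.mk _ (TensorProduct.assoc k⟦X⟧ _ _ _ (tensorSq j z ⊗ₜ j a)) := by
    intro z a
    induction z with
    | zero => simp
    | tmul b c => rfl
    | add z z' h h' =>
      rw [TensorProduct.add_tmul, map_add, map_add, h, h', map_add, TensorProduct.add_tmul,
        map_add, map_add]
  have h2 := eq_of_quotMapThree_eq τ (fun a ha b c => ?_) (fun a b hb c => ?_)
    (fun a b c hc => ?_) h1
  · rw [map_sum, map_sum, map_sum] at h2
    simp only [hτ, hτ'] at h2
    rw [map_sum, map_sum, map_sum]
    refine Eq.trans ?_ (h2.trans ?_)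
    · exact Finset.sum_congr rfl fun i _ => hj.comulLeft_tmul hT (trep_map hT (hw i)) _
    · exact Finset.sum_congr rfl fun i _ => (hj.comulRight_tmul hT (trep_map hT (hw' i)) _).symm
  · exact Ideal.Quotient.eq_zero_iff_mem.2 (tmul_mem_hPow_left (hj.map_mem_hPow ha) _)
  · exact Ideal.Quotient.eq_zero_iff_mem.2 (tmul_mem_hPow_right _
      (tmul_mem_hPow_left (hj.map_mem_hPow hb) _))
  · exact Ideal.Quotient.eq_zero_iff_mem.2 (tmul_mem_hPow_right _
      (tmul_mem_hPow_right _ (hj.map_mem_hPow hc)))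

/-- Multiplication by a power `hⁿ` moves `a` into `F`, where coassociativity is known. It is used
modulo `h^{N+n}` because the division by `hⁿ`, legitimate in the torsion-free triple tensor product,
loses `n` orders of precision. -/
theorem comulLeft_eq_comulRight {N : ℕ} {a : A} {z : A ⊗[k⟦X⟧] A} (h : hT.TRep j N a z) :
    hj.comulLeft hT N z = hj.comulRight hT N z := by
  obtain ⟨n, hn⟩ := hj.trep_normalForm hT h
  obtain ⟨M, hM⟩ := hj.comulLeft_eq_comulRight_map hT (N + n)
  obtain ⟨f, w, t, ha, hw, hz⟩ := hn n le_rfl M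
  have h1 := hM f w hw
  rw [hz, map_smul, map_smul] at h1
  have htf : HTorsionFree k (A ⊗[k⟦X⟧] (A ⊗[k⟦X⟧] A)) :=
    hj.torsionFree.tensor hj.tensor_torsionFree
  have h2 : hj.comulLeft hT N (z + (PowerSeries.X ^ N : k⟦X⟧) • t)
      = hj.comulRight hT N (z + (PowerSeries.X ^ N : k⟦X⟧) • t) := by
    rw [← hj.factor_comulLeft hT (Nat.le_add_right N n),
      ← hj.factor_comulRight hT (Nat.le_add_right N n)]
    obtain ⟨y, hy⟩ := Ideal.Quotient.mk_surjective
      (hj.comulLeft hT (N + n) (z + (PowerSeries.X ^ N : k⟦X⟧) • t))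
    obtain ⟨y', hy'⟩ := Ideal.Quotient.mk_surjective
      (hj.comulRight hT (N + n) (z + (PowerSeries.X ^ N : k⟦X⟧) • t))
    rw [← hy, ← hy'] at h1 ⊢
    have h3 := Ideal.Quotient.eq.1 (show Ideal.Quotient.mk _ ((PowerSeries.X ^ n : k⟦X⟧) • y)
      = Ideal.Quotient.mk _ ((PowerSeries.X ^ n : k⟦X⟧) • y') from h1)
    refine Ideal.Quotient.eq.2 (htf.mem_hPow_of_smul (n := n) ?_)
    rw [smul_sub]
    exact h3
  have hkill : ∀ y : (A ⊗[k⟦X⟧] (A ⊗[k⟦X⟧] A)) ⧸ hPow k (A ⊗[k⟦X⟧] (A ⊗[k⟦X⟧] A)) N,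
      (PowerSeries.X ^ N : k⟦X⟧) • y = 0 := by
    intro y
    obtain ⟨y, rfl⟩ := Ideal.Quotient.mk_surjective y
    exact Ideal.Quotient.eq_zero_iff_mem.2 (pow_smul_mem_hPow N y)
  rwa [map_add, map_add, map_smul, map_smul, hkill, hkill, add_zero, add_zero] at h2

theorem trep_coassoc {N : ℕ} {a : A} {n : ℕ} {p q : Fin n → A} {w w' : Fin n → A ⊗[k⟦X⟧] A}
    (h : hT.TRep j N a (∑ i, p i ⊗ₜ q i)) (hp : ∀ i, hT.TRep j N (p i) (w i))
    (hq : ∀ i, hT.TRep j N (q i) (w' i)) :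
    TensorProduct.assoc k⟦X⟧ _ _ _ (∑ i, w i ⊗ₜ q i) - ∑ i, p i ⊗ₜ w' i
      ∈ hPow k (A ⊗[k⟦X⟧] (A ⊗[k⟦X⟧] A)) N := by
  have h1 := hj.comulLeft_eq_comulRight hT h
  rw [map_sum, map_sum, Finset.sum_congr rfl fun i _ => hj.comulLeft_tmul hT (hp i) (q i),
    Finset.sum_congr rfl fun i _ => hj.comulRight_tmul hT (hq i) (p i), ← map_sum, ← map_sum] at h1
  exact Ideal.Quotient.eq.1 (h1.trans (map_sum (Ideal.Quotient.mk _) _ _).symm)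

/-! ### The coproduct of `h⁻¹ f` -/

/-- The map `f ↦ h⁻¹ (f - ε(f))`. -/
theorem exists_check : ∃ χ : F →ₗ[k⟦X⟧] A,
    ∀ f, (PowerSeries.X : k⟦X⟧) • χ f = j f - algebraMap _ _ (T.counit f) := by
  suffices h : ∃ χ : F →ₗ[k⟦X⟧] A, ∀ f b,
      (PowerSeries.X : k⟦X⟧) • b = j f - algebraMap _ _ (T.counit f) ↔ χ f = b by
    obtain ⟨χ, hχ⟩ := h
    exact ⟨χ, fun f => (hχ _ _).2 rfl⟩
  apply exists_linearMap_of_rel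
  · intro f
    obtain ⟨b, hb⟩ := hj.exists_div _ (sub_counit_mem_augIdeal T f)
    exact ⟨b, by rw [hb, map_sub, AlgHom.commutes]⟩
  · exact fun f b b' h h' => hj.torsionFree.cancel (h.trans h'.symm)
  · intro f f' b b' h h'
    rw [smul_add, h, h', map_add, map_add, map_add, add_sub_add_comm]
  · intro r f b h
    rw [smul_comm, h, smul_sub, map_smul, map_smul, smul_eq_mul, map_mul, Algebra.smul_def,
      Algebra.smul_def]


/-- Substitute `u = h χ(u) + ε(u)` in both factors of `w`. The quadratic part is `h² (χ ⊗ χ)(w)`,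
the mixed parts collapse to `f ⊗ 1` and `1 ⊗ f` by the counit axioms, and the constant part is `ε(f)
= 0`, all up to `h^{N+1}`. Division by `h` costs one order, whence the precision `N + 1` for `w`. -/
theorem trep_check {χ : F →ₗ[k⟦X⟧] A}
    (hχ : ∀ f, (PowerSeries.X : k⟦X⟧) • χ f = j f - algebraMap _ _ (T.counit f))
    {N : ℕ} {f : F} (hf : T.counit f = 0) {w : F ⊗[k⟦X⟧] F} (hw : hT.Rep (N + 1) f w) :
    hT.TRep j N (χ f) (χ f ⊗ₜ 1 + 1 ⊗ₜ χ f
      + (PowerSeries.X : k⟦X⟧) • TensorProduct.map χ χ w) := by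
  have hXf : (PowerSeries.X : k⟦X⟧) • χ f = j f := by rw [hχ, hf, map_zero, sub_zero]
  have key : ∀ w : F ⊗[k⟦X⟧] F, tensorSq j w
      = (PowerSeries.X : k⟦X⟧) • (PowerSeries.X : k⟦X⟧) • TensorProduct.map χ χ w
        + j (convMap LinearMap.id (unitCounit T) w) ⊗ₜ 1
        + 1 ⊗ₜ j (convMap (unitCounit T) LinearMap.id w)
        - algebraMap _ _ (T.counit (convMap (unitCounit T) LinearMap.id w)) := by
    intro w
    induction w with
    | zero => simp
    | tmul u v =>
      have hu : j u = (PowerSeries.X : k⟦X⟧) • χ u + T.counit u • (1 : A) := by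
        rw [hχ, ← Algebra.algebraMap_eq_smul_one, sub_add_cancel]
      have hv : j v = (PowerSeries.X : k⟦X⟧) • χ v + T.counit v • (1 : A) := by
        rw [hχ, ← Algebra.algebraMap_eq_smul_one, sub_add_cancel]
      rw [Algebra.TensorProduct.map_tmul, TensorProduct.map_tmul, convMap_tmul, convMap_tmul,
        unitCounit_apply, unitCounit_apply, LinearMap.id_apply, LinearMap.id_apply,
        ← Algebra.commutes, ← Algebra.smul_def, ← Algebra.smul_def, map_smul, map_smul, map_smul,
        hu, hv, Algebra.TensorProduct.algebraMap_apply, Algebra.algebraMap_eq_smul_one]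
      simp only [TensorProduct.add_tmul, TensorProduct.tmul_add, ← TensorProduct.smul_tmul',
        TensorProduct.tmul_smul, smul_add, smul_smul, smul_eq_mul]
      rw [mul_comm (T.counit v) PowerSeries.X, mul_comm (T.counit v) (T.counit u),
        mul_comm PowerSeries.X (T.counit u)]
      abel
    | add w w' h h' =>
      rw [map_add, h, h']
      simp only [map_add, smul_add, TensorProduct.add_tmul, TensorProduct.tmul_add]
      abel
  refine ⟨1, f, w, by rwa [pow_one], hw, ?_⟩
  have h1 := hj.map_mem_hPow (hT.convMap_counit_right hw)
  have h2 := hj.map_mem_hPow (hT.convMap_counit_left hw)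
  have h3 := counit_pow_dvd T _ _ (hT.convMap_counit_left hw)
  rw [map_sub, hf, sub_zero] at h3
  obtain ⟨r, hr⟩ := h3
  have h4 : algebraMap k⟦X⟧ (A ⊗[k⟦X⟧] A) (T.counit (convMap (unitCounit T) LinearMap.id w))
      ∈ hPow k (A ⊗[k⟦X⟧] A) (N + 1) := by
    rw [hr, map_mul, ← Algebra.smul_def]
    exact pow_smul_mem_hPow _ _
  have h5 := sub_mem (add_mem (tmul_mem_hPow_left h1 (1 : A)) (tmul_mem_hPow_right (1 : A) h2)) h4
  rw [map_sub, map_sub, TensorProduct.sub_tmul, TensorProduct.tmul_sub] at h5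
  rw [key, pow_one, smul_add, smul_add, TensorProduct.smul_tmul', hXf, ← TensorProduct.tmul_smul,
    hXf]
  convert h5 using 1
  abel

end IsTimes

end TimesHopf

/-! ### Open ideals for the `h`-adic topology -/

section HAdic

variable {k H : Type*} [Field k] [Ring H] [Algebra k⟦X⟧ H] [t : TopologicalSpace H]

theorem isOpen_iff_of_eq_hAdic (ht : t = hAdicTopology k H) {U : Set H} :
    IsOpen U ↔ ∀ x ∈ U, ∃ n : ℕ, ∀ y : H, x + (PowerSeries.X ^ n : k⟦X⟧) • y ∈ U := by
  rw [ht]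
  exact isOpen_hAdic_iff

theorem OpenIdeal.exists_hPow_le (ht : t = hAdicTopology k H) (P : OpenIdeal H) :
    ∃ N, ∀ n ≥ N, hPow k H n ≤ P.toIdeal := by
  obtain ⟨N, hN⟩ := (isOpen_iff_of_eq_hAdic ht).1 P.isOpen 0 (zero_mem _)
  refine ⟨N, fun n hn => (hPow_anti hn).trans ?_⟩
  rintro _ ⟨b, rfl⟩
  simpa using hN b

/-- The open ideal `hᴺ H`. -/
def hOpen (ht : t = hAdicTopology k H) (N : ℕ) : OpenIdeal H :=
  ⟨hPow k H N, inferInstance, by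
    subst ht
    exact isOpen_hAdic_of_hPow_le (hPow k H N).toAddSubgroup N fun _ h => h⟩

theorem continuous_hAdic_linearMap {M N : Type*} [AddCommGroup M] [Module k⟦X⟧ M] [AddCommGroup N]
    [Module k⟦X⟧ N] (f : M →ₗ[k⟦X⟧] N) :
    Continuous[hAdicTopology k M, hAdicTopology k N] f := by
  let := hAdicTopology k M
  let := hAdicTopology k N
  refine continuous_def.2 fun U hU => isOpen_hAdic_iff.2 fun x hx => ?_
  obtain ⟨n, hn⟩ := isOpen_hAdic_iff.1 hU _ hx
  refine ⟨n, fun y => ?_⟩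
  rw [Set.mem_preimage, map_add, map_smul]
  exact hn _

theorem pow_smul_tmul_quotient_eq_zero {P : Ideal H} [P.IsTwoSided] {N : ℕ} (hP : hPow k H N ≤ P)
    {M : Type*} [AddCommGroup M] [Module k⟦X⟧ M] (z : (H ⧸ P) ⊗[k⟦X⟧] M) :
    (PowerSeries.X ^ N : k⟦X⟧) • z = 0 := by
  induction z with
  | zero => rw [smul_zero]
  | tmul a m =>
    obtain ⟨a, rfl⟩ := Ideal.Quotient.mk_surjective a
    have : (PowerSeries.X ^ N : k⟦X⟧) • Ideal.Quotient.mk P a = 0 :=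
      Ideal.Quotient.eq_zero_iff_mem.2 (hP (pow_smul_mem_hPow N a))
    rw [TensorProduct.smul_tmul', this, TensorProduct.zero_tmul]
  | add z z' h h' => rw [smul_add, h, h', add_zero]

theorem map_eq_of_sub_mem_hPow {P : Ideal H} [P.IsTwoSided] {N : ℕ} (hP : hPow k H N ≤ P)
    {B M : Type*} [Ring B] [Algebra k⟦X⟧ B] [AddCommGroup M] [Module k⟦X⟧ M]
    (f : B →ₗ[k⟦X⟧] (H ⧸ P) ⊗[k⟦X⟧] M) {z z' : B} (h : z - z' ∈ hPow k B N) : f z = f z' := by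
  obtain ⟨b, hb⟩ := h
  rw [← sub_eq_zero, ← map_sub, hb, map_smul, pow_smul_tmul_quotient_eq_zero hP]

end HAdic

/-! ### The Hopf algebra structure of `F^∨` -/

section VeeHopf

variable {k F A H : Type*} [Field k] [Ring F] [Algebra k⟦X⟧ F] [TopologicalSpace F]
  [Ring A] [Algebra k⟦X⟧ A] [Ring H] [Algebra k⟦X⟧ H] [t : TopologicalSpace H]
  {T : TopologicalHopfAlgebra k F}

/-- `z ∈ F^× ⊗ F^×` represents `Δ(c)` modulo `hᴺ`, for `c ∈ F^∨`. -/
def IsAugAdic.HRep (hT : IsAugAdic T) (j : F →ₐ[k⟦X⟧] A) (ι : A →ₐ[k⟦X⟧] H) (N : ℕ) (c : H)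
    (z : A ⊗[k⟦X⟧] A) : Prop :=
  ∃ a, c - ι a ∈ hPow k H N ∧ hT.TRep j N a z

/-- The Hopf algebra structure of `F^∨` induced by that of `F`. -/
structure IsVeeHopf (hT : IsAugAdic T) (j : F →ₐ[k⟦X⟧] A) (ι : A →ₐ[k⟦X⟧] H)
    (T' : TopologicalHopfAlgebra k H) : Prop where
  comul_spec : ∀ {N : ℕ} {P Q : OpenIdeal H} {c : H} {z : A ⊗[k⟦X⟧] A}, hPow k H N ≤ P.toIdeal →
    hPow k H N ≤ Q.toIdeal → hT.HRep j ι N c z → Represents (T'.comul c) P Q (tensorSq ι z)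
  counit_spec : ∀ f, T'.counit (ι (j f)) = T.counit f
  antipode_spec : ∀ f, T'.antipode (ι (j f)) = ι (j (T.antipode f))

namespace IsTimes

variable {j : F →ₐ[k⟦X⟧] A} {ι : A →ₐ[k⟦X⟧] H} (hj : IsTimes T j) (hT : IsAugAdic T)
  (hι : IsHCompletion ι)

theorem hrep_of_trep {N : ℕ} {a : A} {z : A ⊗[k⟦X⟧] A} (h : hT.TRep j N a z) :
    hT.HRep j ι N (ι a) z := ⟨a, by rw [sub_self]; exact zero_mem _, h⟩

theorem hrep_mono {M N : ℕ} (hMN : M ≤ N) {c : H} {z : A ⊗[k⟦X⟧] A} (h : hT.HRep j ι N c z) :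
    hT.HRep j ι M c z := by
  obtain ⟨a, ha, h⟩ := h
  exact ⟨a, hPow_anti hMN ha, trep_mono hT hMN h⟩

include hj hι

theorem exists_hrep (N : ℕ) (c : H) : ∃ z, hT.HRep j ι N c z := by
  obtain ⟨a, ha⟩ := hι.dense c N
  obtain ⟨z, hz⟩ := hj.exists_trep hT N a
  exact ⟨z, a, ha, hz⟩

theorem hrep_unique {N : ℕ} {c : H} {z z' : A ⊗[k⟦X⟧] A} (h : hT.HRep j ι N c z)
    (h' : hT.HRep j ι N c z') : z - z' ∈ hPow k (A ⊗[k⟦X⟧] A) N := by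
  obtain ⟨a, ha, h⟩ := h
  obtain ⟨a', ha', h'⟩ := h'
  have h1 := hι.reflect_sub ha ha'
  exact hj.trep_unique hT h (hj.trep_congr_left hT h' h1)

omit hι in
theorem hrep_add {N : ℕ} {c d : H} {z z' : A ⊗[k⟦X⟧] A} (h : hT.HRep j ι N c z)
    (h' : hT.HRep j ι N d z') : hT.HRep j ι N (c + d) (z + z') := by
  obtain ⟨a, ha, h⟩ := h
  obtain ⟨a', ha', h'⟩ := h'
  refine ⟨_, ?_, hj.trep_add hT h h'⟩
  rw [map_add, add_sub_add_comm]
  exact add_mem ha ha'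

omit hι in
theorem hrep_mul {N : ℕ} {c d : H} {z z' : A ⊗[k⟦X⟧] A} (h : hT.HRep j ι N c z)
    (h' : hT.HRep j ι N d z') : hT.HRep j ι N (c * d) (z * z') := by
  obtain ⟨a, ha, h⟩ := h
  obtain ⟨a', ha', h'⟩ := h'
  refine ⟨_, ?_, hj.trep_mul hT h h'⟩
  rw [map_mul]
  exact mul_sub_mul_mem_hPow ha ha'

/-- The component is read off a representative in `A ⊗ A` at a precision `hᴺ` contained in both `P`
and `Q`. `hrep_unique` makes it independent of the representative, and `hrep_add` and `hrep_mul`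
make it an algebra map. -/
theorem exists_comul_component (ht : t = hAdicTopology k H) (P Q : OpenIdeal H) :
    ∃ Δ : H →ₐ[k⟦X⟧] (H ⧸ P.toIdeal) ⊗[k⟦X⟧] (H ⧸ Q.toIdeal), ∀ {N : ℕ} {c : H}
      {z : A ⊗[k⟦X⟧] A}, hPow k H N ≤ P.toIdeal → hPow k H N ≤ Q.toIdeal → hT.HRep j ι N c z →
      Δ c = quotMap k P.toIdeal Q.toIdeal (tensorSq ι z) := by
  obtain ⟨NP, hNP⟩ := P.exists_hPow_le ht
  obtain ⟨NQ, hNQ⟩ := Q.exists_hPow_le ht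
  suffices h : ∃ Δ : H →ₐ[k⟦X⟧] (H ⧸ P.toIdeal) ⊗[k⟦X⟧] (H ⧸ Q.toIdeal), ∀ c v,
      (∃ z, hT.HRep j ι (max NP NQ) c z ∧ v = quotMap k P.toIdeal Q.toIdeal (tensorSq ι z))
        ↔ Δ c = v by
    obtain ⟨Δ, hΔ⟩ := h
    refine ⟨Δ, fun {N c z} hP hQ hz => ?_⟩
    obtain ⟨z', hz'⟩ := hj.exists_hrep hT hι (max N (max NP NQ)) c
    rw [(hΔ c _).1 ⟨z', hrep_mono hT (le_max_right _ _) hz', rfl⟩]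
    exact map_eq_of_sub_mem_hPow hP
      ((quotMap k P.toIdeal Q.toIdeal).toLinearMap ∘ₗ (tensorSq ι).toLinearMap)
      (hj.hrep_unique hT hι (hrep_mono hT (le_max_left _ _) hz') hz)
  have hP := hNP (max NP NQ) (le_max_left _ _)
  apply exists_algHom_of_rel
  · intro c
    obtain ⟨z, hz⟩ := hj.exists_hrep hT hι (max NP NQ) c
    exact ⟨_, z, hz, rfl⟩
  · rintro c _ _ ⟨z, hz, rfl⟩ ⟨z', hz', rfl⟩
    exact map_eq_of_sub_mem_hPow hP
      ((quotMap k P.toIdeal Q.toIdeal).toLinearMap ∘ₗ (tensorSq ι).toLinearMap)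
      (hj.hrep_unique hT hι hz hz')
  · rintro c d _ _ ⟨z, hz, rfl⟩ ⟨z', hz', rfl⟩
    exact ⟨_, hj.hrep_add hT hz hz', by rw [map_add, map_add]⟩
  · rintro c d _ _ ⟨z, hz, rfl⟩ ⟨z', hz', rfl⟩
    exact ⟨_, hj.hrep_mul hT hz hz', by rw [map_mul, map_mul]⟩
  · intro r
    refine ⟨algebraMap _ _ r, ?_, ?_⟩
    · have := hrep_of_trep (ι := ι) hT (trep_algebraMap (j := j) hT (max NP NQ) r)
      rwa [AlgHom.commutes] at this
    · rw [AlgHom.commutes, AlgHom.commutes]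

theorem exists_comul (ht : t = hAdicTopology k H) :
    ∃ Δ : H →ₐ[k⟦X⟧] CompletedTensor k H, ∀ {N : ℕ} {P Q : OpenIdeal H} {c : H}
      {z : A ⊗[k⟦X⟧] A}, hPow k H N ≤ P.toIdeal → hPow k H N ≤ Q.toIdeal → hT.HRep j ι N c z →
      Represents (Δ c) P Q (tensorSq ι z) := by
  choose Δ hΔ using fun p : OpenIdeal H × OpenIdeal H =>
    hj.exists_comul_component hT hι ht p.1 p.2
  refine ⟨(AlgHom.pi Δ).codRestrict (CompletedTensor k H) fun c p q h₁ h₂ => ?_,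
    fun {N P Q c z} hP hQ hz => hΔ (P, Q) hP hQ hz⟩
  obtain ⟨NP, hNP⟩ := p.1.exists_hPow_le ht
  obtain ⟨NQ, hNQ⟩ := p.2.exists_hPow_le ht
  obtain ⟨z, hz⟩ := hj.exists_hrep hT hι (max NP NQ) c
  have hP := hNP (max NP NQ) (le_max_left _ _)
  have hQ := hNQ (max NP NQ) (le_max_right _ _)
  change Algebra.TensorProduct.map _ _ (Δ p c) = Δ q c
  rw [hΔ p hP hQ hz, hΔ q (hP.trans h₁) (hQ.trans h₂) hz, factor_quotMap]

theorem exists_counit_vee : ∃ ε : H →ₐ[k⟦X⟧] k⟦X⟧, ∀ f, ε (ι (j f)) = T.counit f := by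
  obtain ⟨εA, hεA⟩ := hj.exists_counit
  have hA : ∀ a b, εA (a * b) = εA a * εA b := by
    intro a b
    obtain ⟨n, f, hf⟩ := hj.exists_pow a
    obtain ⟨m, f', hf'⟩ := hj.exists_pow b
    refine hTorsionFree_powerSeries.pow_cancel (n + m) ?_
    rw [← map_smul, pow_add, ← smul_mul_smul_comm, hf, hf', ← map_mul, hεA, map_mul,
      ← smul_mul_smul_comm, ← map_smul, ← map_smul, hf, hf', hεA, hεA]
  obtain ⟨ε, hε⟩ := hι.exists_extend isHComplete_powerSeries εA
  refine ⟨AlgHom.ofLinearMap ε ?_ ?_, fun f => (hε _).trans (hεA f)⟩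
  · rw [← map_one ι, ← map_one j, hε, hεA, map_one]
  · intro c d
    refine isHComplete_powerSeries.eq fun n => ?_
    obtain ⟨a, ha⟩ := hι.dense c n
    obtain ⟨b, hb⟩ := hι.dense d n
    have h1 := _root_.QuantumDuality.map_mem_hPow ε (mul_sub_mul_mem_hPow ha hb)
    have h2 := _root_.QuantumDuality.map_mem_hPow ε ha
    have h3 := _root_.QuantumDuality.map_mem_hPow ε hb
    rw [map_sub, hε] at h2 h3
    rw [map_sub, ← map_mul, hε, hA] at h1
    exact sub_mem_hPow_trans h1 (sub_mem_hPow_symm (mul_sub_mul_mem_hPow h2 h3))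

omit hj in
-- As `φ` and `ψ` carry `P` and `Q` into `L`, the given representative of `Δ(c)` may be exchanged
-- for one coming from `A ⊗ A`, where the convolution identity is already known.
theorem convMap_sub_mem_openIdeal {ht : t = hAdicTopology k H}
    {Δ : H →ₐ[k⟦X⟧] CompletedTensor k H}
    (hj : IsTimes T j)
    (hΔ : ∀ {N : ℕ} {P Q : OpenIdeal H} {c : H} {z : A ⊗[k⟦X⟧] A}, hPow k H N ≤ P.toIdeal →
      hPow k H N ≤ Q.toIdeal → hT.HRep j ι N c z → Represents (Δ c) P Q (tensorSq ι z))
    {φ ψ θ : H →ₗ[k⟦X⟧] H} {φ' ψ' θ' : A →ₗ[k⟦X⟧] A}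
    (hφ : ∀ a, φ (ι a) = ι (φ' a)) (hψ : ∀ a, ψ (ι a) = ι (ψ' a)) (hθ : ∀ a, θ (ι a) = ι (θ' a))
    (h : ∀ {N a z}, hT.TRep j N a z → convMap φ' ψ' z - θ' a ∈ hPow k A N)
    {P Q L : OpenIdeal H} (hP : ∀ b ∈ P.toIdeal, φ b ∈ L.toIdeal)
    (hQ : ∀ b ∈ Q.toIdeal, ψ b ∈ L.toIdeal) {c : H} {w : H ⊗[k⟦X⟧] H}
    (hw : Represents (Δ c) P Q w) : convMap φ ψ w - θ c ∈ L.toIdeal := by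
  obtain ⟨NP, hNP⟩ := P.exists_hPow_le ht
  obtain ⟨NQ, hNQ⟩ := Q.exists_hPow_le ht
  obtain ⟨NL, hNL⟩ := L.exists_hPow_le ht
  obtain ⟨N, h1, h2, h3⟩ : ∃ N, NP ≤ N ∧ NQ ≤ N ∧ NL ≤ N :=
    ⟨max NP (max NQ NL), by omega, by omega, by omega⟩
  obtain ⟨z, a, ha, hz⟩ := hj.exists_hrep hT hι N c
  have h4 := eq_of_quotMap_eq
    ((Ideal.Quotient.mkₐ k⟦X⟧ L.toIdeal).toLinearMap ∘ₗ convMap φ ψ)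
    (fun b hb d => Ideal.Quotient.eq_zero_iff_mem.2 (Ideal.mul_mem_right _ _ (hP b hb)))
    (fun b d hd => Ideal.Quotient.eq_zero_iff_mem.2 (Ideal.mul_mem_left _ _ (hQ d hd)))
    (hw.symm.trans (hΔ (hNP N h1) (hNQ N h2) ⟨a, ha, hz⟩))
  have h5 : ∀ z, convMap φ ψ (tensorSq ι z) = ι (convMap φ' ψ' z) := by
    intro z
    induction z with
    | zero => simp
    | tmul u v =>
      rw [convMap_tmul, Algebra.TensorProduct.map_tmul, convMap_tmul, hφ, hψ, map_mul]
    | add w w' h h' => rw [map_add, map_add, map_add, h, h', map_add]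
  have h6 := Ideal.Quotient.eq.1 h4
  have h7 := hNL N h3 (algHom_mem_hPow ι (h hz))
  have h8 := hNL N h3 (_root_.QuantumDuality.map_mem_hPow θ ha)
  rw [h5] at h6
  rw [map_sub, ← hθ] at h7
  rw [map_sub] at h8
  have := sub_mem (add_mem h6 h7) h8
  convert this using 1
  abel

omit hj in
-- Each side is the value of a linear map on `H ⊗ H` that kills the relevant ideals (`Λ` and `Λ'`),
-- so both can be evaluated on one common representative of `Δ(c)` from `A ⊗ A`. The equality is
-- then coassociativity in `A`, at a precision contained in all the open ideals.
theorem coassoc_of_comul {ht : t = hAdicTopology k H} (hj : IsTimes T j)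
    {Δ : H →ₐ[k⟦X⟧] CompletedTensor k H}
    (hΔ : ∀ {N : ℕ} {P Q : OpenIdeal H} {c : H} {z : A ⊗[k⟦X⟧] A}, hPow k H N ≤ P.toIdeal →
      hPow k H N ≤ Q.toIdeal → hT.HRep j ι N c z → Represents (Δ c) P Q (tensorSq ι z))
    {P Q S O O' : OpenIdeal H} (hO : ∀ b ∈ O.toIdeal, component (Δ b) P Q = 0)
    (hO' : ∀ b ∈ O'.toIdeal, component (Δ b) Q S = 0) {c : H} {M N : ℕ} {u v : Fin M → H}
    {u' v' : Fin N → H} (h : Approximates u v (Δ c) O S) (h' : Approximates u' v' (Δ c) P O') :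
    TensorProduct.assoc k⟦X⟧ _ _ _ (∑ i, component (Δ (u i)) P Q ⊗ₜ[k⟦X⟧] S.cls (v i))
        = ∑ i, P.cls (u' i) ⊗ₜ[k⟦X⟧] component (Δ (v' i)) Q S := by
  obtain ⟨N1, h1⟩ := P.exists_hPow_le ht
  obtain ⟨N2, h2⟩ := Q.exists_hPow_le ht
  obtain ⟨N3, h3⟩ := S.exists_hPow_le ht
  obtain ⟨N4, h4⟩ := O.exists_hPow_le ht
  obtain ⟨N5, h5⟩ := O'.exists_hPow_le ht
  obtain ⟨n, g1, g2, g3, g4, g5⟩ : ∃ n, N1 ≤ n ∧ N2 ≤ n ∧ N3 ≤ n ∧ N4 ≤ n ∧ N5 ≤ n :=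
    ⟨N1 + N2 + N3 + N4 + N5, by omega, by omega, by omega, by omega, by omega⟩
  obtain ⟨z, a, ha, hz⟩ := hj.exists_hrep hT hι n c
  obtain ⟨m, p, q, rfl⟩ := exists_fin_sum_tmul z
  choose w hw using fun i => hj.exists_trep hT n (p i)
  choose w' hw' using fun i => hj.exists_trep hT n (q i)
  let compₗ (P Q : OpenIdeal H) : H →ₗ[k⟦X⟧] (H ⧸ P.toIdeal) ⊗[k⟦X⟧] (H ⧸ Q.toIdeal) :=
    LinearMap.proj (R := k⟦X⟧) (φ := fun p : OpenIdeal H × OpenIdeal H =>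
      (H ⧸ p.1.toIdeal) ⊗[k⟦X⟧] (H ⧸ p.2.toIdeal)) (P, Q) ∘ₗ
      (CompletedTensor k H).val.toLinearMap ∘ₗ Δ.toLinearMap
  let Λ : H ⊗[k⟦X⟧] H →ₗ[k⟦X⟧] _ :=
    (TensorProduct.assoc k⟦X⟧ _ _ _).toLinearMap ∘ₗ
      TensorProduct.map (compₗ P Q) (Ideal.Quotient.mkₐ k⟦X⟧ S.toIdeal).toLinearMap
  let Λ' : H ⊗[k⟦X⟧] H →ₗ[k⟦X⟧] _ :=
    TensorProduct.map (Ideal.Quotient.mkₐ k⟦X⟧ P.toIdeal).toLinearMap (compₗ Q S)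
  have hΛ : ∀ x y, Λ (x ⊗ₜ y) = TensorProduct.assoc k⟦X⟧ _ _ _
      (component (Δ x) P Q ⊗ₜ[k⟦X⟧] S.cls y) := fun _ _ => rfl
  have hΛ' : ∀ x y, Λ' (x ⊗ₜ y) = P.cls x ⊗ₜ[k⟦X⟧] component (Δ y) Q S := fun _ _ => rfl
  have cls_eq : ∀ (R : OpenIdeal H), ∀ y ∈ R.toIdeal, R.cls y = 0 :=
    fun R y hy => Ideal.Quotient.eq_zero_iff_mem.2 hy
  have e1 := eq_of_quotMap_eq Λ (fun x hx y => by
    rw [hΛ, hO x hx, TensorProduct.zero_tmul, LinearEquiv.map_zero])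
    (fun x y hy => by rw [hΛ, cls_eq S y hy, TensorProduct.tmul_zero, LinearEquiv.map_zero])
    ((approximates_iff.1 h).symm.trans (hΔ (h4 n g4) (h3 n g3) ⟨a, ha, hz⟩))
  have e2 := eq_of_quotMap_eq Λ' (fun x hx y => by rw [hΛ', cls_eq P x hx, TensorProduct.zero_tmul])
    (fun x y hy => by rw [hΛ', hO' y hy, TensorProduct.tmul_zero])
    ((approximates_iff.1 h').symm.trans (hΔ (h1 n g1) (h5 n g5) ⟨a, ha, hz⟩))
  let K : A ⊗[k⟦X⟧] (A ⊗[k⟦X⟧] A) →ₗ[k⟦X⟧] _ :=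
    quotMapThree k P.toIdeal Q.toIdeal S.toIdeal ∘ₗ
      TensorProduct.map ι.toLinearMap (tensorSq ι).toLinearMap
  have hK : ∀ x z, K (x ⊗ₜ z) = P.cls (ι x) ⊗ₜ quotMap k Q.toIdeal S.toIdeal (tensorSq ι z) :=
    fun _ _ => rfl
  have hK' : ∀ z x, K (TensorProduct.assoc k⟦X⟧ _ _ _ (z ⊗ₜ x)) = TensorProduct.assoc k⟦X⟧ _ _ _
      (quotMap k P.toIdeal Q.toIdeal (tensorSq ι z) ⊗ₜ S.cls (ι x)) := by
    intro z x
    induction z with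
    | zero =>
      rw [TensorProduct.zero_tmul, LinearEquiv.map_zero, LinearMap.map_zero, map_zero (tensorSq ι),
        map_zero (quotMap k P.toIdeal Q.toIdeal), TensorProduct.zero_tmul, LinearEquiv.map_zero]
    | tmul b c => rfl
    | add z z' h h' =>
      rw [TensorProduct.add_tmul, map_add, map_add, h, h', map_add, map_add,
        TensorProduct.add_tmul, map_add]
  have e3 := map_eq_of_sub_mem_hPow (h1 n g1) K (hj.trep_coassoc hT hz hw hw')
  simp only [map_sum, Algebra.TensorProduct.map_tmul, hΛ, hΛ', hK, hK'] at e1 e2 e3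
  rw [map_sum, e1, e2]
  refine Eq.trans ?_ (e3.trans ?_)
  · refine Finset.sum_congr rfl fun i _ => ?_
    rw [show component (Δ (ι (p i))) P Q = _ from hΔ (h1 n g1) (h2 n g2) (hrep_of_trep hT (hw i))]
  · refine Finset.sum_congr rfl fun i _ => ?_
    rw [show component (Δ (ι (q i))) Q S = _ from hΔ (h2 n g2) (h3 n g3) (hrep_of_trep hT (hw' i))]

theorem exists_isVeeHopf (ht : t = hAdicTopology k H) :
    ∃ T' : TopologicalHopfAlgebra k H, IsVeeHopf hT j ι T' := by
  obtain ⟨Δ, hΔ⟩ := hj.exists_comul hT hι ht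
  obtain ⟨ε, hε⟩ := hj.exists_counit_vee hι
  obtain ⟨S', hS'⟩ := hj.exists_antipode hT
  obtain ⟨S, hS⟩ := hι.exists_extend hι.isHComplete (ι.toLinearMap ∘ₗ S')
  let η' : A →ₗ[k⟦X⟧] A := Algebra.linearMap k⟦X⟧ A ∘ₗ ε.toLinearMap ∘ₗ ι.toLinearMap
  let η : H →ₗ[k⟦X⟧] H := Algebra.linearMap k⟦X⟧ H ∘ₗ ε.toLinearMap
  have hη : ∀ a, η (ι a) = ι (η' a) := fun a => (ι.commutes _).symm
  have hη' : ∀ f, η' (j f) = j (unitCounit T f) := fun f => by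
    rw [unitCounit_apply, AlgHom.commutes, ← hε]
    rfl
  have hid : ∀ f : F, (LinearMap.id : A →ₗ[k⟦X⟧] A) (j f)
    = j ((LinearMap.id : F →ₗ[k⟦X⟧] F) f) := fun _ => rfl
  have hid' : ∀ a : A, (LinearMap.id : H →ₗ[k⟦X⟧] H) (ι a)
    = ι ((LinearMap.id : A →ₗ[k⟦X⟧] A) a) := fun _ => rfl
  refine ⟨{
    ideal_basis := fun U hU => ?_
    comul := Δ
    counit := ε
    antipode := S
    comul_continuous := fun P Q => ?_
    counit_continuous := ?_
    antipode_continuous := ?_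
    coassoc := fun P Q S O O' hO hO' c M N u v u' v' h h' =>
      coassoc_of_comul (ht := ht) hT hι hj hΔ hO hO' h h'
    counit_left := fun P Q hP c N u v h => ?_
    counit_right := fun P Q hQ c N u v h => ?_
    antipode_left := fun P Q L hP hQ c N u v h => ?_
    antipode_right := fun P Q L hP hQ c N u v h => ?_ },
    ⟨hΔ, hε, fun f => (hS _).trans (congrArg ι (hS' f))⟩⟩
  · obtain ⟨V, hVU, hV, h0⟩ := mem_nhds_iff.1 hU
    rw [ht] at hV
    obtain ⟨n, hn⟩ := isOpen_hAdic_iff.1 hV 0 h0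
    refine ⟨hOpen ht n, ?_⟩
    rintro _ ⟨b, rfl⟩
    exact hVU (by simpa using hn b)
  · obtain ⟨N, hN⟩ := P.exists_hPow_le ht
    refine (isOpen_iff_of_eq_hAdic ht).2 fun c (hc : component (Δ c) P Q = 0) => ⟨N, fun y => ?_⟩
    rw [Set.mem_ofPred_eq, map_add, map_smul]
    have : component (Δ c + (PowerSeries.X ^ N : k⟦X⟧) • Δ y) P Q
      = component (Δ c) P Q + (PowerSeries.X ^ N : k⟦X⟧) • component (Δ y) P Q := rfl
    rw [this, hc, pow_smul_tmul_quotient_eq_zero (hN N le_rfl), add_zero]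
  · rw [ht]
    exact continuous_hAdic_linearMap ε.toLinearMap
  · rw [ht]
    exact continuous_hAdic_linearMap S
  -- The four remaining axioms are the convolution identities `ε * id = id`, `id * ε = id`, `S * id
  -- = ε` and `id * S = ε`.
  · have := convMap_sub_mem_openIdeal (ht := ht) hT hι hj hΔ hη hid' hid'
      (hj.convMap_sub_mem hT hη' hid hid
        fun L => ⟨L, fun N hN a z h => Ideal.pow_le_pow_right hN (hT.convMap_counit_left h)⟩)
      hP (fun b hb => hb) (approximates_iff.1 h)
    rw [map_sum] at this
    simp only [Algebra.smul_def]
    exact Ideal.Quotient.eq.2 this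
  · have := convMap_sub_mem_openIdeal (ht := ht) hT hι hj hΔ hid' hη hid'
      (hj.convMap_sub_mem hT hid hη' hid
        fun L => ⟨L, fun N hN a z h => Ideal.pow_le_pow_right hN (hT.convMap_counit_right h)⟩)
      (fun b hb => hb) hQ (approximates_iff.1 h)
    rw [map_sum] at this
    simp only [Algebra.smul_def, Algebra.commutes]
    exact Ideal.Quotient.eq.2 this
  · have := convMap_sub_mem_openIdeal (ht := ht) hT hι hj hΔ hS hid' hη
      (hj.convMap_sub_mem hT hS' hid hη' hT.exists_convMap_antipode_left)
      hP (fun b hb => hQ hb) (approximates_iff.1 h)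
    rw [map_sum] at this
    exact Ideal.Quotient.eq.2 this
  · have := convMap_sub_mem_openIdeal (ht := ht) hT hι hj hΔ hid' hS hη
      (hj.convMap_sub_mem hT hid hS' hη' hT.exists_convMap_antipode_right)
      (fun b hb => hP hb) hQ (approximates_iff.1 h)
    rw [map_sum] at this
    exact Ideal.Quotient.eq.2 this

end IsTimes

theorem IsVeeHopf.isHopfMorphism {hT : IsAugAdic T} {j : F →ₐ[k⟦X⟧] A} {ι : A →ₐ[k⟦X⟧] H}
    {T' : TopologicalHopfAlgebra k H} (hT' : IsVeeHopf hT j ι T') (hj : IsTimes T j)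
    (ht : t = hAdicTopology k H) (hadd : ∀ x : F, Continuous fun y => x + y) :
    IsHopfMorphism T T' (ι.comp j) where
  continuous := by
    refine continuous_def.2 fun U hU => isOpen_iff_forall_mem_open.2 fun x hx => ?_
    rw [ht] at hU
    obtain ⟨n, hn⟩ := isOpen_hAdic_iff.1 hU _ hx
    -- The neighbourhood is the coset `x + Iⁿ`: it is open, and `Iⁿ` is sent into `hⁿ H`.
    refine ⟨_, ?_, (hT.isOpen n).preimage (hadd (-x)), ?_⟩
    · intro y hy
      obtain ⟨b, hb⟩ := algHom_mem_hPow ι (hj.map_mem_hPow hy)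
      have := hn b
      rw [← hb] at this
      change ι (j x) + ι (j (-x + y)) ∈ U at this
      rwa [← map_add, ← map_add, add_neg_cancel_left] at this
    · rw [Set.mem_preimage, neg_add_cancel]
      exact zero_mem _
  map_comul P Q O O' hO hO' a N u v h := by
    obtain ⟨N1, h1⟩ := P.exists_hPow_le ht
    obtain ⟨N2, h2⟩ := Q.exists_hPow_le ht
    obtain ⟨N3, h3⟩ := hT.exists_le O
    obtain ⟨N4, h4⟩ := hT.exists_le O'
    obtain ⟨n, g1, g2, g3, g4⟩ : ∃ n, N1 ≤ n ∧ N2 ≤ n ∧ N3 ≤ n ∧ N4 ≤ n :=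
      ⟨N1 + N2 + N3 + N4, by omega, by omega, by omega, by omega⟩
    obtain ⟨w, hw⟩ := hT.exists_rep n a
    have e1 := hT'.comul_spec (h1 n g1) (h2 n g2)
      (IsTimes.hrep_of_trep (ι := ι) hT (IsTimes.trep_map (j := j) hT hw))
    have e2 := Represents.mono hw ((Ideal.pow_le_pow_right g3).trans h3)
      ((Ideal.pow_le_pow_right g4).trans h4)
    have e3 := eq_of_quotMap_eq
      ((quotMap k P.toIdeal Q.toIdeal).toLinearMap ∘ₗ (tensorSq ι).toLinearMap ∘ₗ
        (tensorSq j).toLinearMap)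
      (fun b hb d => by
        change quotMap k P.toIdeal Q.toIdeal (ι (j b) ⊗ₜ ι (j d)) = 0
        rw [quotMap_tmul, Ideal.Quotient.eq_zero_iff_mem.2 (show ι (j b) ∈ _ from hO b hb),
          TensorProduct.zero_tmul])
      (fun b d hd => by
        change quotMap k P.toIdeal Q.toIdeal (ι (j b) ⊗ₜ ι (j d)) = 0
        rw [quotMap_tmul, Ideal.Quotient.eq_zero_iff_mem.2 (show ι (j d) ∈ _ from hO' d hd),
          TensorProduct.tmul_zero])
      ((approximates_iff.1 h).symm.trans e2)
    refine approximates_iff.2 (e1.trans (e3.symm.trans ?_))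
    change quotMap k P.toIdeal Q.toIdeal (tensorSq ι (tensorSq j (∑ i, u i ⊗ₜ v i))) = _
    simp only [map_sum]
    rfl
  map_counit f := hT'.counit_spec f
  map_antipode f := hT'.antipode_spec f

theorem IsWeakProduct.continuous_const_add {F : Type*} [Ring F] [Algebra k⟦X⟧ F]
    [TopologicalSpace F] (hW : IsWeakProduct k F) (x : F) : Continuous fun y => x + y := by
  obtain ⟨E, e, he⟩ := hW
  refine continuous_def.2 fun U hU => (isOpen_weak_iff e he).2 fun y hy => ?_
  obtain ⟨S, n, h⟩ := (isOpen_weak_iff e he).1 hU _ hy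
  refine ⟨S, n, fun z hz => ?_⟩
  rw [Set.mem_preimage, ← add_assoc]
  exact h z hz

end VeeHopf

/-! ### Ordered monomials span the enveloping algebra -/

section ProdSpan

variable {k A : Type*} [Field k] [Ring A] [Algebra k A] {n : ℕ}

/-- The span of the products of at most `m` of the elements `yᵢ`. -/
def prodSpan (k : Type*) {A : Type*} [Field k] [Ring A] [Algebra k A] {n : ℕ} (y : Fin n → A)
    (m : ℕ) : Submodule k A :=
  Submodule.span k {a | ∃ l : List (Fin n), l.length ≤ m ∧ a = (l.map y).prod}

theorem prodSpan_mono (y : Fin n → A) {m m' : ℕ} (h : m ≤ m') :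
    prodSpan k y m ≤ prodSpan k y m' :=
  Submodule.span_mono fun _ ⟨l, hl, ha⟩ => ⟨l, hl.trans h, ha⟩

theorem mul_mem_prodSpan {y : Fin n → A} {m m' : ℕ} {a b : A} (ha : a ∈ prodSpan k y m)
    (hb : b ∈ prodSpan k y m') : a * b ∈ prodSpan k y (m + m') := by
  have h := Submodule.mul_mem_mul ha hb
  rw [prodSpan, prodSpan, Submodule.span_mul_span] at h
  refine Submodule.span_mono ?_ h
  rintro _ ⟨_, ⟨l, hl, rfl⟩, _, ⟨l', hl', rfl⟩, rfl⟩
  exact ⟨l ++ l', by rw [List.length_append]; omega, by rw [List.map_append, List.prod_append]⟩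

theorem list_prod_mem_prodSpan (y : Fin n → A) {l : List (Fin n)} {m : ℕ} (h : l.length ≤ m) :
    (l.map y).prod ∈ prodSpan k y m := Submodule.subset_span ⟨l, h, rfl⟩

/-- An adjacent swap changes a word by a commutator of two letters, which is a combination of words
of length at most one; the difference is therefore a combination of shorter words. -/
theorem list_prod_sub_mem_prodSpan {y : Fin n → A}
    (hy : ∀ i j, y i * y j - y j * y i ∈ prodSpan k y 1) {l l' : List (Fin n)} (h : l.Perm l') :
    ∀ m, l.length ≤ m + 1 → (l.map y).prod - (l'.map y).prod ∈ prodSpan k y m := by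
  induction h with
  | nil => exact fun m _ => by rw [sub_self]; exact zero_mem _
  | cons i h ih =>
    rename_i l l'
    intro m hm
    rw [List.length_cons] at hm
    rw [List.map_cons, List.map_cons, List.prod_cons, List.prod_cons, ← mul_sub]
    cases m with
    | zero =>
      obtain rfl := List.length_eq_zero_iff.1 (show l.length = 0 by omega)
      rw [h.symm.eq_nil, sub_self, mul_zero]
      exact zero_mem _
    | succ m =>
      rw [add_comm m 1]
      refine mul_mem_prodSpan ?_ (ih m (by omega))
      simpa using list_prod_mem_prodSpan (k := k) y (l := [i]) le_rfl
  | swap i j l =>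
    intro m hm
    rw [List.length_cons, List.length_cons] at hm
    obtain ⟨m, rfl⟩ := Nat.exists_eq_add_of_le (show 1 ≤ m by omega)
    simp only [List.map_cons, List.prod_cons, ← mul_assoc, ← sub_mul]
    exact mul_mem_prodSpan (hy _ _) (list_prod_mem_prodSpan y (by omega))
  | trans h _ ih ih' =>
    intro m hm
    have := add_mem (ih m hm) (ih' m (by rwa [← h.length_eq]))
    rwa [sub_add_sub_cancel] at this

/-- The easy half of the PBW theorem: a word equals its sorted version modulo shorter words, which
are handled by induction on the length. -/
theorem prodSpan_le_span_orderedMonomial {y : Fin n → A}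
    (hy : ∀ i j, y i * y j - y j * y i ∈ prodSpan k y 1) (m : ℕ) :
    prodSpan k y m ≤ Submodule.span k (Set.range fun d : Fin n →₀ ℕ => orderedMonomial y d) := by
  have step : ∀ l : List (Fin n), ∃ d : Fin n →₀ ℕ, ∀ m, l.length ≤ m + 1 →
      (l.map y).prod - orderedMonomial y d ∈ prodSpan k y m := by
    intro l
    refine ⟨Finsupp.equivFunOnFinite.symm fun i => l.count i, ?_⟩
    rw [orderedMonomial_eq_prod]
    refine list_prod_sub_mem_prodSpan hy (List.perm_iff_count.2 fun i => ?_)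
    rw [count_expList]
    rfl
  induction m with
  | zero =>
    refine Submodule.span_le.2 ?_
    rintro _ ⟨l, hl, rfl⟩
    obtain rfl := List.length_eq_zero_iff.1 (Nat.le_zero.1 hl)
    exact Submodule.subset_span ⟨0, orderedMonomial_zero y⟩
  | succ m ih =>
    refine Submodule.span_le.2 ?_
    rintro _ ⟨l, hl, rfl⟩
    obtain ⟨d, hd⟩ := step l
    have := add_mem (ih (hd m hl)) (Submodule.subset_span ⟨d, rfl⟩)
    rwa [sub_add_cancel] at this

end ProdSpan

/-! ### The enveloping algebra: universal property and spanning monomials -/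

section Enveloping

attribute [local instance 100] LieRing.ofAssociativeRing

variable {k L : Type*} [Field k] [LieRing L] [LieAlgebra k L] {n : ℕ}

theorem envIncl_lie (x y : L) : envIncl k L ⁅x, y⁆
    = envIncl k L x * envIncl k L y - envIncl k L y * envIncl k L x :=
  (UniversalEnvelopingAlgebra.ι k).map_lie x y

theorem exists_envLift {Q : Type*} [Ring Q] [Algebra k Q] (θ : L →ₗ[k] Q)
    (hθ : ∀ x y, θ ⁅x, y⁆ = θ x * θ y - θ y * θ x) :
    ∃ Ψ : UniversalEnvelopingAlgebra k L →ₐ[k] Q, ∀ x, Ψ (envIncl k L x) = θ x :=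
  ⟨UniversalEnvelopingAlgebra.lift k { θ with map_lie' := fun {x y} => hθ x y },
    fun x => UniversalEnvelopingAlgebra.lift_ι_apply k _ x⟩

theorem envHom_ext {Q : Type*} [Ring Q] [Algebra k Q]
    {Ψ Ψ' : UniversalEnvelopingAlgebra k L →ₐ[k] Q}
    (h : ∀ x, Ψ (envIncl k L x) = Ψ' (envIncl k L x)) : Ψ = Ψ' :=
  UniversalEnvelopingAlgebra.hom_ext k (LieHom.ext h)

theorem envComul_envIncl (x : L) :
    envComul k L (envIncl k L x) = envIncl k L x ⊗ₜ 1 + 1 ⊗ₜ envIncl k L x :=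
  UniversalEnvelopingAlgebra.lift_ι_apply k _ x

theorem envCounit_envIncl (x : L) : envCounit k L (envIncl k L x) = 0 :=
  UniversalEnvelopingAlgebra.lift_ι_apply k _ x

theorem comm_envComul (u : UniversalEnvelopingAlgebra k L) :
    TensorProduct.comm k _ _ (envComul k L u) = envComul k L u := by
  have h : ((Algebra.TensorProduct.comm k _ _).toAlgHom.comp (envComul k L)) = envComul k L := by
    refine envHom_ext fun x => ?_
    change Algebra.TensorProduct.comm k _ _ (envComul k L (envIncl k L x)) = _
    rw [envComul_envIncl, map_add, Algebra.TensorProduct.comm_tmul,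
      Algebra.TensorProduct.comm_tmul, add_comm]
  exact DFunLike.congr_fun h u

/-- The elements satisfying `p` form a subalgebra `S` containing `L`. The lift `U(L) → S` followed
by the inclusion is the identity by uniqueness, so `S` is everything. -/
theorem env_induction {p : UniversalEnvelopingAlgebra k L → Prop}
    (scalar : ∀ r, p (algebraMap k _ r)) (incl : ∀ x, p (envIncl k L x))
    (add : ∀ a b, p a → p b → p (a + b)) (mul : ∀ a b, p a → p b → p (a * b)) (u) : p u := by
  let S : Subalgebra k (UniversalEnvelopingAlgebra k L) :=
    { carrier := {u | p u}
      add_mem' := fun ha hb => add _ _ ha hb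
      mul_mem' := fun ha hb => mul _ _ ha hb
      algebraMap_mem' := scalar }
  obtain ⟨Ψ, hΨ⟩ := exists_envLift (Q := S) ((envIncl k L).codRestrict S.toSubmodule incl)
    (fun x y => Subtype.ext (envIncl_lie x y))
  have h : S.val.comp Ψ = AlgHom.id k _ := envHom_ext fun x => congrArg Subtype.val (hΨ x)
  have := (Ψ u).2
  rwa [show ((Ψ u : S) : UniversalEnvelopingAlgebra k L) = u from DFunLike.congr_fun h u] at this

theorem env_mem_span_orderedMonomial (ξ : Fin n → L) (hξ : Submodule.span k (Set.range ξ) = ⊤)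
    (u : UniversalEnvelopingAlgebra k L) : u ∈ Submodule.span k
      (Set.range fun d : Fin n →₀ ℕ => orderedMonomial (fun i => envIncl k L (ξ i)) d) := by
  have hincl : ∀ x, envIncl k L x ∈ prodSpan k (fun i => envIncl k L (ξ i)) 1 := by
    intro x
    have hx : x ∈ Submodule.span k (Set.range ξ) := hξ ▸ Submodule.mem_top
    have h := Submodule.mem_map_of_mem (f := envIncl k L) hx
    rw [Submodule.map_span] at h
    refine Submodule.span_mono ?_ h
    rintro _ ⟨_, ⟨i, rfl⟩, rfl⟩
    exact ⟨[i], le_rfl, by simp⟩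
  obtain ⟨m, hm⟩ : ∃ m, u ∈ prodSpan k (fun i => envIncl k L (ξ i)) m := by
    refine env_induction (p := fun u => ∃ m, u ∈ prodSpan k (fun i => envIncl k L (ξ i)) m)
      (fun r => ⟨0, ?_⟩) (fun x => ⟨1, hincl x⟩) ?_ ?_ u
    · rw [Algebra.algebraMap_eq_smul_one]
      exact Submodule.smul_mem _ _
        (list_prod_mem_prodSpan (fun i => envIncl k L (ξ i)) (l := []) le_rfl)
    · rintro a b ⟨m, ha⟩ ⟨m', hb⟩
      exact ⟨max m m', add_mem (prodSpan_mono _ (le_max_left _ _) ha)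
        (prodSpan_mono _ (le_max_right _ _) hb)⟩
    · rintro a b ⟨m, ha⟩ ⟨m', hb⟩
      exact ⟨m + m', mul_mem_prodSpan ha hb⟩
  refine prodSpan_le_span_orderedMonomial (fun i j => ?_) m hm
  rw [← envIncl_lie]
  exact hincl _

end Enveloping

/-! ### Differentials at the unit -/

/-- First-order Taylor expansion: the constant term of `π f` is the residue of `ε(f)`, hence zero,
so subtracting the linear part leaves order at least `2`. -/
theorem IsFormalCoordinates.exists_eq_linear_add {k F : Type*} [Field k] [Ring F]
    [Algebra k⟦X⟧ F] [TopologicalSpace F] {n : ℕ} {π : F →+* MvPowerSeries (Fin n) k}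
    (hπ : IsFormalCoordinates k π) (T : TopologicalHopfAlgebra k F) {x : Fin n → F}
    (hx : ∀ i, π (x i) = MvPowerSeries.X i) {f : F} (hf : counitZero T f = 0) :
    ∃ s ∈ augIdeal T ^ 2, ∃ b,
      f = ∑ i, (PowerSeries.C (MvPowerSeries.coeff (Finsupp.single i 1) (π f)) : k⟦X⟧) • x i + s
        + (PowerSeries.X : k⟦X⟧) • b := by
  classical
  have hlin : π (∑ i, (PowerSeries.C (MvPowerSeries.coeff (Finsupp.single i 1) (π f)) : k⟦X⟧) • x i)
      = ∑ i, MvPowerSeries.C (MvPowerSeries.coeff (Finsupp.single i 1) (π f))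
        * MvPowerSeries.X i := by
    rw [map_sum]
    refine Finset.sum_congr rfl fun i _ => ?_
    rw [Algebra.smul_def, map_mul, hπ.2.1, PowerSeries.constantCoeff_C, hx]
  obtain ⟨q, b, h⟩ := hπ.exists_eq_sum_add hx 2
    (f - ∑ i, (PowerSeries.C (MvPowerSeries.coeff (Finsupp.single i 1) (π f)) : k⟦X⟧) • x i) (by
      intro e he
      rw [map_sub, hlin, map_sub, map_sum]
      simp only [MvPowerSeries.coeff_C_mul, MvPowerSeries.coeff_X]
      rcases Nat.lt_succ_iff_lt_or_eq.1 he with he | he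
      · obtain rfl := (Finsupp.degree_eq_zero_iff e).1 (Nat.lt_one_iff.1 he)
        rw [MvPowerSeries.coeff_zero_eq_constantCoeff_apply, hπ.constantCoeff_eq T, hf, zero_sub,
          neg_eq_zero]
        refine Finset.sum_eq_zero fun i _ => ?_
        rw [if_neg (fun h => by simpa using DFunLike.congr_fun h i), mul_zero]
      · obtain ⟨i, rfl⟩ : e ∈ Set.range fun i : Fin n => Finsupp.single i 1 := by
          rw [Finsupp.range_single_one]
          exact he
        rw [Finset.sum_eq_single i, if_pos rfl, mul_one, sub_self]
        · intro i' _ hi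
          rw [if_neg, mul_zero]
          intro h
          exact hi (Finsupp.single_left_injective one_ne_zero h).symm
        · simp)
  exact ⟨_, hπ.sum_orderedMonomial_mem T hx 2 q, b, by rw [add_assoc, ← h, add_sub_cancel]⟩

section Differential

variable {k F L : Type*} [Field k] [Ring F] [Algebra k⟦X⟧ F] [TopologicalSpace F]
  [LieRing L] [LieAlgebra k L] [LieBialgebra k L]

/-- The properties of the map sending a function on a formal Poisson group to its differential at
the unit, an element of the dual Lie bialgebra of the tangent Lie bialgebra. -/
structure IsDifferential {T : TopologicalHopfAlgebra k F} (hT : IsAugAdic T) (d : F →+ L) :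
    Prop where
  smul : ∀ (r : k⟦X⟧) f, d (r • f) = PowerSeries.constantCoeff r • d f
  mul : ∀ f g, d (f * g) = counitZero T f • d g + counitZero T g • d f
  mem_sq : ∀ f, T.counit f = 0 → d f = 0 → f ∈ augIdeal T ^ 2
  surj : ∀ x, ∃ f, T.counit f = 0 ∧ d f = x
  lie : ∀ f g c, (PowerSeries.X : k⟦X⟧) • c = f * g - g * f → d c = ⁅d f, d g⁆
  cobracket : ∀ f N (u v : Fin N → F), hT.Rep 2 f (∑ i, u i ⊗ₜ v i) →
    ∑ i, (d (u i) ⊗ₜ[k] d (v i) - d (v i) ⊗ₜ[k] d (u i)) = LieBialgebra.cobracket (d f)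

namespace IsDifferential

variable {T : TopologicalHopfAlgebra k F} {hT : IsAugAdic T} {d : F →+ L}
  (hd : IsDifferential hT d)
include hd

theorem map_algebraMap (r : k⟦X⟧) : d (algebraMap _ _ r) = 0 := by
  have h := hd.mul 1 1
  rw [mul_one, map_one (counitZero T), one_smul] at h
  rw [Algebra.algebraMap_eq_smul_one, hd.smul, left_eq_add.1 h, smul_zero]

theorem map_X_smul (f : F) : d ((PowerSeries.X : k⟦X⟧) • f) = 0 := by
  rw [hd.smul, PowerSeries.constantCoeff_X, zero_smul]

theorem map_sq {f : F} (hf : f ∈ augIdeal T ^ 2) : d f = 0 := by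
  rw [Submodule.pow_succ, Submodule.pow_one] at hf
  refine Submodule.mul_induction_on hf (fun a ha b hb => ?_) (fun a b ha hb => ?_)
  · rw [hd.mul, counitZero_apply, counitZero_apply, mem_augIdeal.1 ha, mem_augIdeal.1 hb, zero_smul,
      zero_smul, add_zero]
  · rw [map_add, ha, hb, add_zero]

theorem span_coordinates {n : ℕ} {π : F →+* MvPowerSeries (Fin n) k}
    (hπ : IsFormalCoordinates k π) {x : Fin n → F} (hx : ∀ i, π (x i) = MvPowerSeries.X i) :
    Submodule.span k (Set.range fun i => d (x i)) = ⊤ := by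
  refine eq_top_iff.2 fun ξ _ => ?_
  obtain ⟨f, hf, rfl⟩ := hd.surj ξ
  obtain ⟨s, hs, b, h⟩ := hπ.exists_eq_linear_add T hx (f := f)
    (by rw [counitZero_apply, hf, map_zero])
  rw [h, map_add, map_add, hd.map_X_smul, hd.map_sq hs, map_sum, add_zero, add_zero]
  refine sum_mem fun i _ => ?_
  rw [hd.smul]
  exact Submodule.smul_mem _ _ (Submodule.subset_span ⟨i, rfl⟩)

end IsDifferential

section Existence

variable {T : TopologicalHopfAlgebra k F} {n : ℕ} {π : F →+* MvPowerSeries (Fin n) k}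
  (hπ : IsFormalCoordinates k π)

/-- The partial derivative at the unit with respect to a formal coordinate. -/
def coordDerivation (hπ : IsFormalCoordinates k π) (T : TopologicalHopfAlgebra k F) (i : Fin n) :
    tangentSpace T :=
  ⟨fun f => MvPowerSeries.coeff (Finsupp.single i 1) (π f), by
    classical
    refine ⟨fun a b => ?_, fun r a => ?_, fun a b => ?_⟩
    · dsimp only
      rw [map_add, map_add]
    · dsimp only
      rw [Algebra.smul_def, map_mul, hπ.2.1, MvPowerSeries.coeff_C_mul]
    · dsimp only
      rw [map_mul, MvPowerSeries.coeff_mul, Finsupp.antidiagonal_single, Finset.sum_map,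
        Finset.Nat.antidiagonal_succ]
      simp [hπ.constantCoeff_eq T, counitZero_apply]⟩

theorem coordDerivation_apply (i : Fin n) (f : F) :
    (coordDerivation hπ T i).1 f = MvPowerSeries.coeff (Finsupp.single i 1) (π f) := rfl

include hπ in
-- A derivation at the counit kills constants, `hF` and `I²`, so only the linear part of `f`
-- contributes.
theorem tangentSpace_apply_eq {x : Fin n → F} (hx : ∀ i, π (x i) = MvPowerSeries.X i)
    (D : tangentSpace T) (f : F) :
    D.1 f = ∑ i, D.1 (x i) * MvPowerSeries.coeff (Finsupp.single i 1) (π f) := by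
  obtain ⟨D, h1, h2, h3⟩ := D
  have hone : D 1 = 0 := by
    have h := h3 1 1
    rw [mul_one, map_one, map_one, one_mul, mul_one] at h
    exact left_eq_add.1 h
  have hX : ∀ a, D ((PowerSeries.X : k⟦X⟧) • a) = 0 := fun a => by
    rw [h2, PowerSeries.constantCoeff_X, zero_mul]
  have hsq : ∀ s ∈ augIdeal T ^ 2, D s = 0 := by
    intro s hs
    rw [Submodule.pow_succ, Submodule.pow_one] at hs
    refine Submodule.mul_induction_on hs (fun a ha b hb => ?_) (fun a b ha hb => ?_)
    · rw [h3, mem_augIdeal.1 ha, mem_augIdeal.1 hb, zero_mul, mul_zero, add_zero]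
    · rw [h1, ha, hb, add_zero]
  let D' : F →+ k := ⟨⟨D, by simpa using hX 0⟩, h1⟩
  obtain ⟨s, hs, b, h⟩ := hπ.exists_eq_linear_add T hx (f := f - algebraMap _ _ (T.counit f))
    (by rw [map_sub, counitZero_apply, counitZero_apply, AlgHom.commutes]; simp)
  have h4 : D (f - algebraMap _ _ (T.counit f)) = D f := by
    have : D' (f - algebraMap _ _ (T.counit f)) = D' f - D' (algebraMap _ _ (T.counit f)) :=
      map_sub _ _ _
    refine this.trans ?_
    change D f - D _ = _
    rw [Algebra.algebraMap_eq_smul_one, h2, hone, mul_zero, sub_zero]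
  have h5 : ∀ i, MvPowerSeries.coeff (Finsupp.single i 1)
      (π (f - algebraMap _ _ (T.counit f))) = MvPowerSeries.coeff (Finsupp.single i 1) (π f) := by
    intro i
    rw [map_sub, hπ.2.1, map_sub, MvPowerSeries.coeff_C, if_neg (by simp), sub_zero]
  have h6 := congrArg D' h
  rw [map_add, map_add, map_sum] at h6
  refine h4.symm.trans (h6.trans ?_)
  change ∑ i, D _ + D s + D _ = _
  rw [hsq s hs, hX, add_zero, add_zero]
  refine Finset.sum_congr rfl fun i _ => ?_
  rw [h2, PowerSeries.constantCoeff_C, h5, mul_comm]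

/-- The differential of `f` is the linear form on `g` obtained by evaluating tangent vectors at `f`.
The bracket and cobracket conditions are the two pairings in the definition of a QFSHA. The kernel
and surjectivity statements hold because `g` is the whole tangent space and so contains the partial
derivatives at the unit. -/
theorem exists_isDifferential {g : Type*} [LieRing g] [LieAlgebra k g] [Module.Finite k g]
    [LieBialgebra k g] (hT : IsAugAdic T) (hF : IsQFSHA T g) :
    ∃ d : F →+ LieDual k g, IsDifferential hT d := by
  obtain ⟨-, ⟨n, π, hπ⟩, τ, h1, h2⟩ := hF
  have hadd : ∀ z f f', (τ z).1 (f + f') = (τ z).1 f + (τ z).1 f' := fun z => (τ z).2.1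
  have hsmul : ∀ z (r : k⟦X⟧) f, (τ z).1 (r • f) = PowerSeries.constantCoeff r * (τ z).1 f :=
    fun z => (τ z).2.2.1
  have hmul : ∀ z f f', (τ z).1 (f * f') = counitZero T f * (τ z).1 f'
    + (τ z).1 f * counitZero T f' := fun z => (τ z).2.2.2
  let d : F →+ LieDual k g := AddMonoidHom.mk' (fun f => LieDual.ofForm (differential T τ f))
    fun f f' => LieDual.ext' fun z => hadd z f f'
  have hd : ∀ f z, (d f).form z = (τ z).1 f := fun _ _ => rfl
  have hsq : ∀ f ∈ augIdeal T ^ 2, d f = 0 := by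
    intro s hs
    rw [Submodule.pow_succ, Submodule.pow_one] at hs
    refine Submodule.mul_induction_on hs (fun a ha b hb => ?_) (fun a b ha hb => ?_)
    · refine LieDual.ext' fun z => ?_
      rw [hd, hmul, counitZero_apply, counitZero_apply, mem_augIdeal.1 ha, mem_augIdeal.1 hb,
        zero_mul, mul_zero, add_zero]
      rfl
    · rw [map_add, ha, hb, add_zero]
  obtain ⟨x₀, hx₀⟩ := hπ.exists_lift
  let x : Fin n → F := fun i => x₀ i - algebraMap _ _ (T.counit (x₀ i))
  have hxc : ∀ i, T.counit (x i) = 0 := fun i => sub_counit_mem T _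
  have hx : ∀ i, π (x i) = MvPowerSeries.X i := by
    intro i
    rw [map_sub, hπ.2.1, hx₀, ← counitZero_apply, ← hπ.constantCoeff_eq, hx₀,
      MvPowerSeries.constantCoeff_X, map_zero, sub_zero]
  refine ⟨d, ⟨fun r f => LieDual.ext' fun z => hsmul z r f, fun f f' => LieDual.ext' fun z => ?_,
    fun f hf hdf => ?_, fun ξ => ?_, fun f f' c hc => LieDual.ext' fun z => h2 z f f' c hc,
    fun f N u v h => ?_⟩⟩
  · rw [hd, hmul, mul_comm ((τ z).1 f)]
    rfl
  · obtain ⟨s, hs, b, h⟩ := hπ.exists_eq_linear_add T hx (f := f)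
      (by rw [counitZero_apply, hf, map_zero])
    have h0 : ∀ i, MvPowerSeries.coeff (Finsupp.single i 1) (π f) = 0 := by
      intro i
      have := hd f (τ.symm (coordDerivation hπ T i))
      rw [LinearEquiv.apply_symm_apply, coordDerivation_apply, hdf] at this
      exact this.symm
    rw [Finset.sum_eq_zero (fun i _ => by rw [h0, map_zero, zero_smul]), zero_add] at h
    -- Here `f = s + h b` with `s ∈ I²`. As `ε(f) = 0` and `h²` divides `ε(s)`, the counit of `b` is
    -- divisible by `h`; so `b ∈ I` and `h b ∈ I²`.
    have h3 := congrArg T.counit h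
    obtain ⟨r, hr⟩ := counit_pow_dvd T _ _ hs
    rw [hf, map_add, map_smul, hr, smul_eq_mul, pow_two, mul_assoc, ← mul_add] at h3
    have h4 := (mul_eq_zero.1 h3.symm).resolve_left PowerSeries.X_ne_zero
    have h5 : b ∈ augIdeal T := by
      rw [mem_augIdeal, eq_neg_of_add_eq_zero_right h4]
      simp
    rw [h]
    refine add_mem hs ?_
    have := ideal_mul_mem_pow_succ (J := augIdeal T) (n := 1)
      (by rw [Submodule.pow_one]; exact X_smul_mem_augIdeal T (1 : F)) h5
    rwa [smul_mul_assoc, one_mul] at this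
  -- The coefficient of `xᵢ` is the value of `ξ` on the vector of `g` corresponding to the `i`-th
  -- partial derivative.
  · refine ⟨∑ i, (PowerSeries.C (ξ.form (τ.symm (coordDerivation hπ T i))) : k⟦X⟧) • x i, ?_, ?_⟩
    · rw [map_sum]
      exact Finset.sum_eq_zero fun i _ => by rw [map_smul, hxc, smul_zero]
    · refine LieDual.ext' fun z => ?_
      have h3 : τ z = ∑ i, (τ z).1 (x i) • coordDerivation hπ T i := by
        refine Subtype.ext (funext fun f => ?_)
        rw [tangentSpace_apply_eq hπ hx (τ z) f, AddSubmonoidClass.coe_finsetSum,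
          Finset.sum_apply]
        rfl
      have h4 := congrArg (fun t => ξ.form (τ.symm t)) h3
      simp only [LinearEquiv.symm_apply_apply, map_sum, map_smul] at h4
      rw [h4, map_sum]
      have h5 : ∀ (s : Finset (Fin n)) (q : Fin n → LieDual k g),
          (∑ i ∈ s, q i).form z = ∑ i ∈ s, (q i).form z := fun s q =>
        map_sum (LieDual.evalAt z) q s
      rw [h5]
      refine Finset.sum_congr rfl fun i _ => ?_
      rw [hd, hsmul, PowerSeries.constantCoeff_C, smul_eq_mul, mul_comm]
  · refine LieDual.pairing_injective (TensorProduct.ext' fun y y' => ?_)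
    have h3 := h1 y y' (hT.openPow 2) (hT.openPow 2)
      (fun b hb => ⟨LinearMap.congr_fun (hsq b hb) y, LinearMap.congr_fun (hsq b hb) y'⟩)
      (fun b hb => ⟨LinearMap.congr_fun (hsq b hb) y, LinearMap.congr_fun (hsq b hb) y'⟩)
      f N u v (approximates_iff.2 h)
    refine Eq.trans ?_ (h3.symm.trans (LieDual.pairing_cobracket (d f) y y').symm)
    rw [map_sum, LinearMap.sum_apply]
    refine Finset.sum_congr rfl fun i _ => ?_
    rw [map_sub, LinearMap.sub_apply, LieDual.pairing_tmul, LieDual.pairing_tmul,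
      mul_comm (differential T τ (u i) y')]
    rfl

end Existence

end Differential

/-! ### The special fibre -/

section SpecialFibre

variable (k H : Type*) [Field k] [Ring H] [Algebra k⟦X⟧ H]

/-- The `k`-algebra `H / hH`. -/
def SpecialFibre : Type _ := H ⧸ hPow k H 1

instance : Ring (SpecialFibre k H) := inferInstanceAs (Ring (H ⧸ hPow k H 1))

instance : Algebra k (SpecialFibre k H) :=
  Algebra.compHom (H ⧸ hPow k H 1) (PowerSeries.C : k →+* k⟦X⟧)

variable {H}

/-- The quotient map `H → H / hH`. -/
def SpecialFibre.mk : H →+* SpecialFibre k H := Ideal.Quotient.mk (hPow k H 1)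

variable {k}

namespace SpecialFibre

theorem mk_surjective : Function.Surjective (mk k : H → SpecialFibre k H) :=
  Ideal.Quotient.mk_surjective

theorem mk_eq_zero {a : H} : mk k a = 0 ↔ a ∈ hPow k H 1 := Ideal.Quotient.eq_zero_iff_mem

theorem mk_eq {a b : H} : mk k a = mk k b ↔ a - b ∈ hPow k H 1 := Ideal.Quotient.eq

theorem mk_C_smul (c : k) (a : H) : mk k ((PowerSeries.C c : k⟦X⟧) • a) = c • mk k a := rfl

theorem mk_smul (r : k⟦X⟧) (a : H) : mk k (r • a) = PowerSeries.constantCoeff r • mk k a := by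
  rw [← mk_C_smul, mk_eq, ← sub_smul]
  obtain ⟨s, hs⟩ := PowerSeries.X_dvd_iff.2
    (show PowerSeries.constantCoeff (r - PowerSeries.C (PowerSeries.constantCoeff r)) = 0 by simp)
  rw [hs, mul_smul]
  exact mem_hPow_one.2 ⟨_, rfl⟩

theorem mk_algebraMap (r : k⟦X⟧) :
    mk k (algebraMap _ H r) = algebraMap k _ (PowerSeries.constantCoeff r) := by
  rw [Algebra.algebraMap_eq_smul_one, mk_smul, map_one, Algebra.algebraMap_eq_smul_one]

end SpecialFibre

/-- A `k`-linear section of `H → H/hH` lifts a basis, and `exists_formalSeries_equiv` applies. -/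
theorem isTopologicallyFree_of_isHComplete {k : Type u} {H : Type v} [Field k] [Ring H]
    [Algebra k⟦X⟧ H] [t : TopologicalSpace H] (ht : t = hAdicTopology k H)
    (htf : HTorsionFree k H) (hH : IsHComplete k H) : IsTopologicallyFree k H := by
  let : Module k H := Module.compHom H (PowerSeries.C : k →+* k⟦X⟧)
  let p : H →ₗ[k] SpecialFibre k H :=
    { toFun := SpecialFibre.mk k
      map_add' := map_add _
      map_smul' := SpecialFibre.mk_C_smul }
  obtain ⟨s, hs⟩ := p.exists_rightInverse_of_surjective
    (LinearMap.range_eq_top.2 SpecialFibre.mk_surjective)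
  have hs' : ∀ q, SpecialFibre.mk k (s q) = q := fun q => LinearMap.congr_fun hs q
  obtain ⟨e, -⟩ := exists_formalSeries_equiv htf hH (V := SpecialFibre k H) s.toAddMonoidHom
    (fun c q => s.map_smul c q) (fun q hq => by
      rw [← hs' q]
      exact SpecialFibre.mk_eq_zero.2 hq)
    (fun c => ⟨SpecialFibre.mk k c, SpecialFibre.mk_eq.1 (hs' _).symm⟩)
  exact ⟨ht, SpecialFibre k H, inferInstance, inferInstance, ⟨e.symm⟩⟩

end SpecialFibre

/-! ### The isomorphism of the special fibre with the enveloping algebra -/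

section ClassicalLimit

variable {k F A H L : Type*} [Field k] [Ring F] [Algebra k⟦X⟧ F] [TopologicalSpace F]
  [Ring A] [Algebra k⟦X⟧ A] [Ring H] [Algebra k⟦X⟧ H]
  [LieRing L] [LieAlgebra k L] [LieBialgebra k L] {T : TopologicalHopfAlgebra k F}

/-- A map `H → U(L)` identifying `H / hH` with `U(L)`, such that the class of `h⁻¹ f` is the
differential of `f` at the unit. -/
structure IsClassicalLimit (T : TopologicalHopfAlgebra k F) (ι : A →ₐ[k⟦X⟧] H)
    (χ : F →ₗ[k⟦X⟧] A) (d : F →+ L) (φ : H →+* UniversalEnvelopingAlgebra k L) : Prop where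
  surjective : Function.Surjective φ
  eq_zero_iff : ∀ a, φ a = 0 ↔ ∃ b, a = (PowerSeries.X : k⟦X⟧) • b
  map_algebraMap : ∀ r : k⟦X⟧, φ (algebraMap k⟦X⟧ H r)
    = algebraMap k _ (PowerSeries.constantCoeff r)
  map_check : ∀ f, T.counit f = 0 → φ (ι (χ f)) = envIncl k L (d f)

variable {j : F →ₐ[k⟦X⟧] A} {ι : A →ₐ[k⟦X⟧] H} {hT : IsAugAdic T} {d : F →+ L}
  {χ : F →ₗ[k⟦X⟧] A} {n : ℕ} {π : F →+* MvPowerSeries (Fin n) k}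

/-- The class of `h⁻¹f` depends only on `df`: if `df = 0` and `ε(f) = 0`, then `f ∈ I²` and `h⁻¹f`
is divisible by `h`. The assignment respects brackets because `[h⁻¹f, h⁻¹f'] = h⁻¹b` with `b =
h⁻¹[f, f']`, and `db = [df, df']`. -/
theorem exists_envMap (hj : IsTimes T j) (hπ : IsFormalCoordinates k π)
    (hχ : ∀ f, (PowerSeries.X : k⟦X⟧) • χ f = j f - algebraMap _ _ (T.counit f))
    (hd : IsDifferential hT d) (ι : A →ₐ[k⟦X⟧] H) :
    ∃ Ψ : UniversalEnvelopingAlgebra k L →ₐ[k] SpecialFibre k H,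
      ∀ f, T.counit f = 0 → Ψ (envIncl k L (d f)) = SpecialFibre.mk k (ι (χ f)) := by
  have hχ0 : ∀ f, T.counit f = 0 → (PowerSeries.X : k⟦X⟧) • χ f = j f := fun f hf => by
    rw [hχ, hf, map_zero, sub_zero]
  obtain ⟨θ, hθ⟩ : ∃ θ : L →ₗ[k] SpecialFibre k H, ∀ ξ q,
      (∃ f, T.counit f = 0 ∧ d f = ξ ∧ q = SpecialFibre.mk k (ι (χ f))) ↔ θ ξ = q := by
    apply exists_linearMap_of_rel
    · intro ξ
      obtain ⟨f, hf, hdf⟩ := hd.surj ξ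
      exact ⟨_, f, hf, hdf, rfl⟩
    · rintro _ _ _ ⟨f, hf, rfl, rfl⟩ ⟨f', hf', hff, rfl⟩
      rw [SpecialFibre.mk_eq, ← map_sub, ← map_sub]
      have hε : T.counit (f - f') = 0 := by rw [map_sub, hf, hf', sub_self]
      have h1 := hj.map_mem_hPow (hd.mem_sq (f - f') hε (by rw [map_sub, hff, sub_self]))
      rw [← hχ0 _ hε, ← pow_one (PowerSeries.X : k⟦X⟧)] at h1
      exact algHom_mem_hPow ι (hj.torsionFree.mem_hPow_of_smul h1)
    · rintro _ _ _ _ ⟨f, hf, rfl, rfl⟩ ⟨f', hf', rfl, rfl⟩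
      exact ⟨f + f', by rw [map_add, hf, hf', add_zero], map_add _ _ _,
        by rw [map_add, map_add, map_add]⟩
    · rintro c _ _ ⟨f, hf, rfl, rfl⟩
      exact ⟨(PowerSeries.C c : k⟦X⟧) • f, by rw [map_smul, hf, smul_zero],
        by rw [hd.smul, PowerSeries.constantCoeff_C],
        by rw [map_smul, map_smul, SpecialFibre.mk_C_smul]⟩
  have hθ' : ∀ f, T.counit f = 0 → θ (d f) = SpecialFibre.mk k (ι (χ f)) := fun f hf =>
    (hθ _ _).1 ⟨f, hf, rfl, rfl⟩
  obtain ⟨Ψ, hΨ⟩ := exists_envLift θ (fun ξ ξ' => by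
    obtain ⟨f, hf, rfl⟩ := hd.surj ξ
    obtain ⟨f', hf', rfl⟩ := hd.surj ξ'
    obtain ⟨b, hb, hbf⟩ := hπ.exists_commutator_mem T f f'
    have h1 : χ b = χ f * χ f' - χ f' * χ f := by
      refine hj.torsionFree.cancel (hj.torsionFree.cancel ?_)
      rw [smul_sub, smul_sub, hχ0 b hb, ← mul_smul_comm, ← smul_mul_assoc, ← mul_smul_comm,
        ← smul_mul_assoc, hχ0 f hf, hχ0 f' hf', ← map_mul, ← map_mul, ← map_sub, hbf, map_smul]
    rw [← hd.lie f f' b hbf.symm, hθ' b hb, hθ' f hf, hθ' f' hf', h1, map_sub, map_mul, map_mul,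
      map_sub, map_mul, map_mul])
  exact ⟨Ψ, fun f hf => (hΨ _).trans (hθ' f hf)⟩

/-- Let `Φ` send commutative monomials to ordered monomials in the `dxᵢ`; it is onto because these
span `U(L)`. The composite `Ψ ∘ Φ` is evaluation at the `h⁻¹xᵢ` modulo `h`, which is bijective by
the basis theorem for `F^×`. Hence `Ψ` is bijective. -/
theorem exists_isClassicalLimit (hj : IsTimes T j) (hι : IsHCompletion ι)
    (hπ : IsFormalCoordinates k π)
    (hχ : ∀ f, (PowerSeries.X : k⟦X⟧) • χ f = j f - algebraMap _ _ (T.counit f))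
    (hd : IsDifferential hT d) : ∃ φ, IsClassicalLimit T ι χ d φ := by
  obtain ⟨Ψ, hΨ⟩ := exists_envMap hj hπ hχ hd ι
  obtain ⟨x₀, hx₀⟩ := hπ.exists_lift
  -- The coordinates are corrected by constants so that `ε(xᵢ) = 0` exactly and `χ(xᵢ)` is `h⁻¹xᵢ`;
  -- the correction lies in `hF`, so `π` does not see it.
  let x : Fin n → F := fun i => x₀ i - algebraMap _ _ (T.counit (x₀ i))
  have hxc : ∀ i, T.counit (x i) = 0 := fun i => sub_counit_mem T _
  have hx : ∀ i, π (x i) = MvPowerSeries.X i := by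
    intro i
    rw [map_sub, hπ.2.1, hx₀, ← counitZero_apply, ← hπ.constantCoeff_eq, hx₀,
      MvPowerSeries.constantCoeff_X, map_zero, sub_zero]
  let y : Fin n → A := fun i => χ (x i)
  have hy : ∀ i, (PowerSeries.X : k⟦X⟧) • y i = j (x i) := fun i => by
    rw [hχ, hxc, map_zero, sub_zero]
  let Φ : MvPolynomial (Fin n) k →ₗ[k] UniversalEnvelopingAlgebra k L :=
    (MvPolynomial.basisMonomials (Fin n) k).constr k
      fun e => orderedMonomial (fun i => envIncl k L (d (x i))) e
  have hΦ : Function.Surjective Φ := by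
    intro u
    rw [← LinearMap.mem_range, Module.Basis.constr_range]
    exact env_mem_span_orderedMonomial _ (hd.span_coordinates hπ hx) u
  have hΨΦ : ∀ P, Ψ (Φ P) = SpecialFibre.mk k (ι (orderedEval y P)) := by
    let Ξ : MvPolynomial (Fin n) k →ₗ[k] SpecialFibre k H :=
      { toFun := fun P => SpecialFibre.mk k (ι (orderedEval y P))
        map_add' := fun P Q => by
          rw [← map_add, ← map_add]
          exact congrArg _ (congrArg _ (map_add (orderedEvalHom y) P Q))
        map_smul' := fun c P => by
          rw [orderedEval_smul, map_smul, SpecialFibre.mk_C_smul]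
          rfl }
    have h : Ψ.toLinearMap ∘ₗ Φ = Ξ := by
      refine (MvPolynomial.basisMonomials (Fin n) k).ext fun e => ?_
      rw [LinearMap.comp_apply, Module.Basis.constr_basis, MvPolynomial.coe_basisMonomials]
      change Ψ _ = SpecialFibre.mk k (ι (orderedEval y _))
      rw [orderedEval_monomial, map_orderedMonomial, map_one, one_smul, map_orderedMonomial,
        map_orderedMonomial]
      simp only [hΨ _ (hxc _), y]
    exact fun P => LinearMap.congr_fun h P
  have hinj : Function.Injective Ψ := by
    rw [injective_iff_map_eq_zero]
    intro u hu
    obtain ⟨P, rfl⟩ := hΦ u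
    rw [hΨΦ, SpecialFibre.mk_eq_zero] at hu
    rw [hj.eq_zero_of_orderedEval_mem hπ hx hy P (hι.reflect _ _ hu), map_zero]
  have hsurj : Function.Surjective Ψ := by
    intro q
    obtain ⟨c, rfl⟩ := SpecialFibre.mk_surjective q
    obtain ⟨a, ha⟩ := hι.dense c 1
    obtain ⟨P, hP⟩ := hj.exists_sub_orderedEval_mem hπ hx hy a
    refine ⟨Φ P, ?_⟩
    rw [hΨΦ, eq_comm, SpecialFibre.mk_eq]
    have := algHom_mem_hPow ι hP
    rw [map_sub] at this
    exact sub_mem_hPow_trans ha this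
  let e := RingEquiv.ofBijective Ψ ⟨hinj, hsurj⟩
  have he : ∀ q u, e.symm q = u ↔ q = Ψ u := fun q u => e.symm_apply_eq
  refine ⟨(e.symm : SpecialFibre k H →+* _).comp (SpecialFibre.mk k),
    e.symm.surjective.comp SpecialFibre.mk_surjective, fun a => ?_, fun r => ?_, fun f hf => ?_⟩
  · refine (he _ _).trans ?_
    rw [map_zero, SpecialFibre.mk_eq_zero, mem_hPow_one]
  · refine (he _ _).2 ?_
    rw [SpecialFibre.mk_algebraMap, AlgHom.commutes]
  · exact (he _ _).2 (hΨ f hf).symm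

end ClassicalLimit

/-! ### Tensor squares of maps to the special fibre -/

section TensorHom

variable {k H U : Type*} [Field k] [Ring H] [Algebra k⟦X⟧ H] [Ring U] [Algebra k U] {φ : H →+* U}
  (hφ : ∀ r : k⟦X⟧, φ (algebraMap k⟦X⟧ H r) = algebraMap k U (PowerSeries.constantCoeff r))
include hφ

theorem map_smul_of_map_algebraMap (r : k⟦X⟧) (a : H) :
    φ (r • a) = PowerSeries.constantCoeff r • φ a := by
  rw [Algebra.smul_def, map_mul, hφ, ← Algebra.smul_def]

/-- The map `φ ⊗ φ : H ⊗ H → U ⊗ U` over the reduction `k[[h]] → k`. -/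
def tensorHom : H ⊗[k⟦X⟧] H →+ U ⊗[k] U :=
  TensorProduct.liftAddHom
    (AddMonoidHom.mk' (fun a => AddMonoidHom.mk' (fun b => φ a ⊗ₜ[k] φ b)
        fun b b' => by rw [map_add, TensorProduct.tmul_add])
      fun a a' => AddMonoidHom.ext fun b => by
        simp only [AddMonoidHom.mk'_apply, map_add, TensorProduct.add_tmul, AddMonoidHom.add_apply])
    fun r a b => by
      simp only [AddMonoidHom.mk'_apply, map_smul_of_map_algebraMap hφ, TensorProduct.smul_tmul]

@[simp] theorem tensorHom_tmul (a b : H) : tensorHom hφ (a ⊗ₜ b) = φ a ⊗ₜ φ b := rfl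

theorem tensorHom_smul (r : k⟦X⟧) (z : H ⊗[k⟦X⟧] H) :
    tensorHom hφ (r • z) = PowerSeries.constantCoeff r • tensorHom hφ z := by
  induction z with
  | zero => rw [smul_zero, map_zero, smul_zero]
  | tmul a b =>
    rw [TensorProduct.smul_tmul', tensorHom_tmul, tensorHom_tmul, map_smul_of_map_algebraMap hφ,
      TensorProduct.smul_tmul']
  | add z z' h h' => rw [smul_add, map_add, h, h', map_add, smul_add]

theorem tensorHom_mul (z z' : H ⊗[k⟦X⟧] H) :
    tensorHom hφ (z * z') = tensorHom hφ z * tensorHom hφ z' := by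
  induction z with
  | zero => rw [zero_mul, map_zero, zero_mul]
  | tmul a b =>
    induction z' with
    | zero => rw [mul_zero, map_zero, mul_zero]
    | tmul c d =>
      rw [Algebra.TensorProduct.tmul_mul_tmul, tensorHom_tmul, tensorHom_tmul, tensorHom_tmul,
        Algebra.TensorProduct.tmul_mul_tmul, map_mul, map_mul]
    | add z z' h h' => rw [mul_add, map_add, h, h', map_add, mul_add]
  | add z z'' h h' => rw [add_mul, map_add, h, h', map_add, add_mul]

theorem tensorHom_comm (z : H ⊗[k⟦X⟧] H) :
    tensorHom hφ (TensorProduct.comm k⟦X⟧ H H z) = TensorProduct.comm k U U (tensorHom hφ z) := by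
  induction z with
  | zero => simp only [map_zero]
  | tmul a b => rfl
  | add z z' h h' => simp only [map_add, h, h']

theorem tensorHom_eq_of_quotMap_eq {P Q : Ideal H} [P.IsTwoSided] [Q.IsTwoSided]
    (hP : ∀ a ∈ P, φ a = 0) (hQ : ∀ a ∈ Q, φ a = 0) {z z' : H ⊗[k⟦X⟧] H}
    (h : quotMap k P Q z = quotMap k P Q z') : tensorHom hφ z = tensorHom hφ z' := by
  -- `U ⊗ U` becomes a `k[[h]]`-module on which `h` acts as zero, which makes `φ ⊗ φ` linear.
  let : Module k⟦X⟧ (U ⊗[k] U) :=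
    Module.compHom _ (PowerSeries.constantCoeff : k⟦X⟧ →+* k)
  let τ : H ⊗[k⟦X⟧] H →ₗ[k⟦X⟧] U ⊗[k] U :=
    { tensorHom hφ with map_smul' := tensorHom_smul hφ }
  refine eq_of_quotMap_eq τ (fun a ha b => ?_) (fun a b hb => ?_) h
  · change φ a ⊗ₜ φ b = 0
    rw [hP a ha, TensorProduct.zero_tmul]
  · change φ a ⊗ₜ φ b = 0
    rw [hQ b hb, TensorProduct.tmul_zero]

theorem tensorHom_tensorSq_eq {A : Type*} [Ring A] [Algebra k⟦X⟧ A] (ι : A →ₐ[k⟦X⟧] H)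
    {z z' : A ⊗[k⟦X⟧] A} (h : z - z' ∈ hPow k (A ⊗[k⟦X⟧] A) 1) :
    tensorHom hφ (tensorSq ι z) = tensorHom hφ (tensorSq ι z') := by
  obtain ⟨b, hb⟩ := mem_hPow_one.1 h
  rw [eq_add_of_sub_eq hb, map_add, map_smul, map_add, tensorHom_smul,
    PowerSeries.constantCoeff_X, zero_smul, zero_add]

end TensorHom

/-! ### The quantised universal enveloping algebra -/

section QUEA

variable {k F A H L : Type*} [Field k] [Ring F] [Algebra k⟦X⟧ F] [TopologicalSpace F]
  [Ring A] [Algebra k⟦X⟧ A] [Ring H] [Algebra k⟦X⟧ H] [t : TopologicalSpace H]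
  [LieRing L] [LieAlgebra k L] [LieBialgebra k L] {T : TopologicalHopfAlgebra k F}
  {j : F →ₐ[k⟦X⟧] A} {ι : A →ₐ[k⟦X⟧] H} {hT : IsAugAdic T} {d : F →+ L}
  {χ : F →ₗ[k⟦X⟧] A} {φ : H →+* UniversalEnvelopingAlgebra k L}
  (hφ : IsClassicalLimit T ι χ d φ) (hj : IsTimes T j) (hι : IsHCompletion ι)
  (hχ : ∀ f, (PowerSeries.X : k⟦X⟧) • χ f = j f - algebraMap _ _ (T.counit f))
  (hd : IsDifferential hT d)

namespace IsClassicalLimit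

include hφ

theorem map_eq_of_sub_mem {a b : H} (h : a - b ∈ hPow k H 1) : φ a = φ b := by
  rw [← sub_eq_zero, ← map_sub, hφ.eq_zero_iff]
  exact mem_hPow_one.1 h

include hj hχ

/-- Both sides are multiplicative, so generators suffice. For `h⁻¹f` with `ε(f) = 0`, `trep_check`
gives a primitive element plus a multiple of `h`, and `φ ⊗ φ` kills the latter. -/
theorem envComul_of_trep {a : A} {z : A ⊗[k⟦X⟧] A} (h : hT.TRep j 1 a z) :
    envComul k L (φ (ι a)) = tensorHom hφ.map_algebraMap (tensorSq ι z) := by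
  suffices h : ∃ z, hT.TRep j 1 a z ∧
      envComul k L (φ (ι a)) = tensorHom hφ.map_algebraMap (tensorSq ι z) by
    obtain ⟨z', hz', e⟩ := h
    rw [e]
    exact tensorHom_tensorSq_eq _ ι (hj.trep_unique hT hz' h)
  refine hj.induction' (p := fun a => ∃ z, hT.TRep j 1 a z ∧
      envComul k L (φ (ι a)) = tensorHom hφ.map_algebraMap (tensorSq ι z))
    (fun r => ?_) (fun b f hf hb => ?_) ?_ ?_ a
  · refine ⟨_, IsTimes.trep_algebraMap hT 1 r, ?_⟩
    rw [AlgHom.commutes, AlgHom.commutes, hφ.map_algebraMap, AlgHom.commutes,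
      Algebra.algebraMap_eq_smul_one (R := k⟦X⟧), tensorHom_smul, Algebra.TensorProduct.one_def,
      tensorHom_tmul, map_one, ← Algebra.TensorProduct.one_def, Algebra.algebraMap_eq_smul_one]
  · obtain rfl : b = χ f := hj.torsionFree.cancel (by rw [hb, hχ, hf, map_zero, sub_zero])
    obtain ⟨w, hw⟩ := hT.exists_rep 2 f
    refine ⟨_, hj.trep_check hT hχ hf hw, ?_⟩
    rw [hφ.map_check f hf, envComul_envIncl, map_add, map_smul, map_add, tensorHom_smul,
      PowerSeries.constantCoeff_X, zero_smul, add_zero, map_add, map_add,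
      Algebra.TensorProduct.map_tmul, Algebra.TensorProduct.map_tmul, tensorHom_tmul,
      tensorHom_tmul, map_one, map_one, hφ.map_check f hf]
  · rintro a b ⟨z, hz, e⟩ ⟨z', hz', e'⟩
    exact ⟨_, hj.trep_add hT hz hz', by simp only [map_add, e, e']⟩
  · rintro a b ⟨z, hz, e⟩ ⟨z', hz', e'⟩
    exact ⟨_, hj.trep_mul hT hz hz', by rw [map_mul, map_mul, map_mul, e, e', map_mul, tensorHom_mul]⟩

theorem envComul_of_hrep {N : ℕ} (hN : 1 ≤ N) {c : H} {z : A ⊗[k⟦X⟧] A}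
    (h : hT.HRep j ι N c z) :
    envComul k L (φ c) = tensorHom hφ.map_algebraMap (tensorSq ι z) := by
  obtain ⟨a, ha, hz⟩ := IsTimes.hrep_mono hT hN h
  rw [hφ.map_eq_of_sub_mem ha, hφ.envComul_of_trep hj hχ hz]

include hι in
theorem envCounit_map {T' : TopologicalHopfAlgebra k H} (hT' : IsVeeHopf hT j ι T') (c : H) :
    envCounit k L (φ c) = PowerSeries.constantCoeff (T'.counit c) := by
  obtain ⟨a, ha⟩ := hι.dense c 1
  have h1 : PowerSeries.constantCoeff (T'.counit c) = PowerSeries.constantCoeff (T'.counit (ι a)) := by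
    obtain ⟨b, hb⟩ := mem_hPow_one.1 ha
    rw [eq_add_of_sub_eq hb, map_add, map_add, map_smul, smul_eq_mul, map_mul,
      PowerSeries.constantCoeff_X, zero_mul, zero_add]
  rw [hφ.map_eq_of_sub_mem ha, h1]
  refine hj.induction' (p := fun a => envCounit k L (φ (ι a))
      = PowerSeries.constantCoeff (T'.counit (ι a))) (fun r => ?_) (fun b f hf hb => ?_)
    (fun a b ha hb => by rw [map_add, map_add, map_add, map_add, map_add, ha, hb])
    (fun a b ha hb => by rw [map_mul, map_mul, map_mul, map_mul, map_mul, ha, hb]) a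
  · rw [AlgHom.commutes, hφ.map_algebraMap, AlgHom.commutes, AlgHom.commutes]
    rfl
  · obtain rfl : b = χ f := hj.torsionFree.cancel (by rw [hb, hχ, hf, map_zero, sub_zero])
    have h2 : T'.counit (ι (χ f)) = 0 := by
      refine hTorsionFree_powerSeries _ ?_
      rw [← map_smul, ← map_smul, hb, hT'.counit_spec, hf]
    rw [hφ.map_check f hf, h2, map_zero, envCounit_envIncl]

include hd in
-- Under `φ` the map `χ` becomes `d` on all of `F`, because both ignore constants. The left side is
-- then the antisymmetrisation of `(d ⊗ d)Δ(f)`, which is the cobracket of `df`.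
theorem tensorHom_check {f : F} {w : F ⊗[k⟦X⟧] F} (hw : hT.Rep 2 f w) :
    tensorHom hφ.map_algebraMap (tensorSq ι (TensorProduct.map χ χ w))
        - TensorProduct.comm k _ _
          (tensorHom hφ.map_algebraMap (tensorSq ι (TensorProduct.map χ χ w)))
      = TensorProduct.map (envIncl k L) (envIncl k L) (LieBialgebra.cobracket (k := k) (d f)) := by
  have h1 : ∀ f, φ (ι (χ f)) = envIncl k L (d f) := by
    intro f
    have h2 : χ f = χ (f - algebraMap _ _ (T.counit f)) := by
      refine hj.torsionFree.cancel ?_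
      rw [hχ, hχ, sub_counit_mem, map_zero, sub_zero, map_sub, AlgHom.commutes]
    rw [h2, hφ.map_check _ (sub_counit_mem T f), map_sub, hd.map_algebraMap, sub_zero]
  obtain ⟨N, u, v, rfl⟩ := exists_fin_sum_tmul w
  rw [← hd.cobracket f N u v hw]
  simp only [map_sum, TensorProduct.map_tmul, Algebra.TensorProduct.map_tmul, tensorHom_tmul, h1,
    TensorProduct.comm_tmul, map_sub, Finset.sum_sub_distrib]

/-- Representatives of the Poisson cobracket `h⁻¹ (Δ(c) - Δᵒᵖ(c))` modulo `hᴺ`. -/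
theorem exists_cobracket_rep (hd : IsDifferential hT d) (hι : IsHCompletion ι) {x : L} {c : H}
    (hc : φ c = envIncl k L x) (N : ℕ) :
    ∃ z s : A ⊗[k⟦X⟧] A, hT.HRep j ι (N + 1) c z ∧
      (PowerSeries.X : k⟦X⟧) • s = z - TensorProduct.comm k⟦X⟧ A A z ∧
      tensorHom hφ.map_algebraMap (tensorSq ι s)
        = TensorProduct.map (envIncl k L) (envIncl k L) (LieBialgebra.cobracket (k := k) x) := by
  obtain ⟨f, hf, rfl⟩ := hd.surj x
  obtain ⟨b, hb⟩ := (hφ.eq_zero_iff (c - ι (χ f))).1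
    (by rw [map_sub, hc, hφ.map_check f hf, sub_self])
  -- Precision `N + 2`, since the coproduct formula for `h⁻¹f` loses one order and `N + 1` is
  -- wanted.
  obtain ⟨w, hw⟩ := hT.exists_rep (N + 2) f
  obtain ⟨zb, a, ha, hzb⟩ := hj.exists_hrep hT hι (N + 1) b
  have h1 := hj.trep_check hT hχ hf (N := N + 1) hw
  have h2 := hj.trep_add hT h1 (hj.trep_smul hT (PowerSeries.X : k⟦X⟧) hzb)
  -- With `c = χ(f) + h b`, the coproduct is a symmetric part plus `h v`, so `h⁻¹(Δ - Δᵒᵖ)` is the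
  -- antisymmetrisation of `v`. The summand `zb`, representing `Δ(b)`, drops out modulo `h` because
  -- `U(L)` is cocommutative.
  obtain ⟨v, hv⟩ : ∃ v, v = TensorProduct.map χ χ w + zb := ⟨_, rfl⟩
  have hsym : TensorProduct.comm k⟦X⟧ A A (χ f ⊗ₜ 1 + 1 ⊗ₜ χ f) = χ f ⊗ₜ 1 + 1 ⊗ₜ χ f := by
    rw [map_add, TensorProduct.comm_tmul, TensorProduct.comm_tmul, add_comm]
  refine ⟨_, v - TensorProduct.comm k⟦X⟧ A A v, ⟨_, ?_, h2⟩, ?_, ?_⟩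
  · rw [map_add, map_smul, ← sub_sub, hb, ← smul_sub]
    exact smul_mem_hPow _ ha
  · rw [add_assoc, ← smul_add, ← hv, map_add, hsym, map_smul, smul_sub, add_sub_add_left_eq_sub]
  · have h3 : ∀ z, tensorSq ι (TensorProduct.comm k⟦X⟧ A A z)
        = TensorProduct.comm k⟦X⟧ H H (tensorSq ι z) := by
      intro z
      induction z with
      | zero => simp only [map_zero]
      | tmul a b => rfl
      | add z z' h h' => simp only [map_add, h, h']
    have h4 : hT.HRep j ι (N + 1) b zb := ⟨a, ha, hzb⟩
    have h5 := hφ.envComul_of_hrep hj hχ (Nat.le_add_left 1 N) h4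
    rw [map_sub, map_sub, h3, tensorHom_comm, hv, map_add, map_add, map_add, ← h5, comm_envComul,
      add_sub_add_right_eq_sub]
    exact hφ.tensorHom_check hj hχ hd (hw.mono (by omega))

/-- Representatives of `Δ(c)` modulo `h^{N+1}` determine the quotients `s N` of `z - zᵒᵖ` by `h`
modulo `hᴺ`. They are therefore compatible and define an element of the completed tensor square. -/
theorem exists_cobracket (hd : IsDifferential hT d) (hι : IsHCompletion ι)
    (ht : t = hAdicTopology k H) {T' : TopologicalHopfAlgebra k H} (hT' : IsVeeHopf hT j ι T')
    {x : L} {c : H} (hc : φ c = envIncl k L x) :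
    ∃ c' : CompletedTensor k H,
      (∀ P Q : OpenIdeal H, (PowerSeries.X : k⟦X⟧) • component c' P Q
        = component (T'.comul c) P Q
          - TensorProduct.comm k⟦X⟧ _ _ (component (T'.comul c) Q P)) ∧
      ∀ P Q : OpenIdeal H, (∀ b ∈ P.toIdeal, φ b = 0) → (∀ b ∈ Q.toIdeal, φ b = 0) →
        ∀ w : H ⊗[k⟦X⟧] H, Represents c' P Q w → tensorHom hφ.map_algebraMap w
          = TensorProduct.map (envIncl k L) (envIncl k L)
              (LieBialgebra.cobracket (k := k) x) := by
  choose z s hz hs hΘ using hφ.exists_cobracket_rep hj hχ hd hι hc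
  have hanti : ∀ {M N}, M ≤ N → s N - s M ∈ hPow k (A ⊗[k⟦X⟧] A) M := by
    intro M N hMN
    have h1 := hj.hrep_unique hT hι (IsTimes.hrep_mono hT (Nat.succ_le_succ hMN) (hz N)) (hz M)
    have h2 := sub_mem h1 (map_mem_hPow (TensorProduct.comm k⟦X⟧ A A).toLinearMap h1)
    refine hj.tensor_torsionFree.mem_hPow_of_smul (n := 1) ?_
    rw [pow_one, smul_sub, hs, hs]
    convert h2 using 1
    change _ = z N - z M - TensorProduct.comm k⟦X⟧ A A (z N - z M)
    rw [map_sub]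
    abel
  choose ν hν using fun P : OpenIdeal H => P.exists_hPow_le ht
  have key : ∀ (P Q : OpenIdeal H) (N : ℕ), hPow k H N ≤ P.toIdeal → hPow k H N ≤ Q.toIdeal →
      quotMap k P.toIdeal Q.toIdeal (tensorSq ι (s (max (ν P) (ν Q))))
        = quotMap k P.toIdeal Q.toIdeal (tensorSq ι (s N)) := by
    intro P Q N hP hQ
    have e : ∀ {M N}, hPow k H M ≤ P.toIdeal → M ≤ N →
        quotMap k P.toIdeal Q.toIdeal (tensorSq ι (s N))
          = quotMap k P.toIdeal Q.toIdeal (tensorSq ι (s M)) := fun hP hMN =>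
      map_eq_of_sub_mem_hPow hP
        ((quotMap k P.toIdeal Q.toIdeal).toLinearMap ∘ₗ (tensorSq ι).toLinearMap) (hanti hMN)
    rw [← e (hν P _ (le_max_left _ _)) (le_max_left _ N), e hP (le_max_right _ N)]
  refine ⟨⟨fun p => quotMap k p.1.toIdeal p.2.toIdeal (tensorSq ι (s (max (ν p.1) (ν p.2)))),
    fun p q h₁ h₂ => ?_⟩, fun P Q => ?_, fun P Q hP hQ w hw => ?_⟩
  · rw [factor_quotMap]
    exact (key q.1 q.2 _ ((hν p.1 _ (le_max_left _ _)).trans h₁)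
      ((hν p.2 _ (le_max_right _ _)).trans h₂)).symm
  · have hP := hν P (max (ν P) (ν Q)) (le_max_left _ _)
    have hQ := hν Q (max (ν P) (ν Q)) (le_max_right _ _)
    have hz' := IsTimes.hrep_mono hT (Nat.le_succ _) (hz (max (ν P) (ν Q)))
    rw [show component (T'.comul c) P Q = _ from hT'.comul_spec hP hQ hz',
      show component (T'.comul c) Q P = _ from hT'.comul_spec hQ hP hz']
    change (PowerSeries.X : k⟦X⟧) • quotMap k P.toIdeal Q.toIdeal
      (tensorSq ι (s (max (ν P) (ν Q)))) = _
    have h3 : ∀ z, quotMap k P.toIdeal Q.toIdeal (tensorSq ι (TensorProduct.comm k⟦X⟧ A A z))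
        = TensorProduct.comm k⟦X⟧ _ _ (quotMap k Q.toIdeal P.toIdeal (tensorSq ι z)) := by
      intro z
      induction z with
      | zero => simp only [map_zero]
      | tmul a b => rfl
      | add z z' h h' => simp only [map_add, h, h']
    rw [← map_smul, ← map_smul, hs, map_sub, map_sub, h3]
  · exact (tensorHom_eq_of_quotMap_eq hφ.map_algebraMap hP hQ hw).symm.trans (hΘ _)

end IsClassicalLimit

end QUEA

theorem isQUEA_of_isVeeHopf {k : Type u} {F A : Type*} {H : Type v} {L : Type w} [Field k]
    [Ring F] [Algebra k⟦X⟧ F] [TopologicalSpace F] [Ring A] [Algebra k⟦X⟧ A] [Ring H]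
    [Algebra k⟦X⟧ H] [t : TopologicalSpace H] [LieRing L] [LieAlgebra k L] [Module.Finite k L]
    [LieBialgebra k L] {T : TopologicalHopfAlgebra k F} {j : F →ₐ[k⟦X⟧] A} {ι : A →ₐ[k⟦X⟧] H}
    {hT : IsAugAdic T} {d : F →+ L} {n : ℕ} {π : F →+* MvPowerSeries (Fin n) k}
    (ht : t = hAdicTopology k H) (hj : IsTimes T j) (hι : IsHCompletion ι)
    (hπ : IsFormalCoordinates k π) (hd : IsDifferential hT d)
    {T' : TopologicalHopfAlgebra k H} (hT' : IsVeeHopf hT j ι T') : IsQUEA T' L := by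
  obtain ⟨χ, hχ⟩ := hj.exists_check
  obtain ⟨φ, hφ⟩ := exists_isClassicalLimit hj hι hπ hχ hd
  refine ⟨isTopologicallyFree_of_isHComplete ht hι.torsionFree hι.isHComplete, φ, hφ.surjective,
    hφ.eq_zero_iff, hφ.map_algebraMap, fun P Q hP hQ c N u v h => ?_,
    hφ.envCounit_map hj hι hχ hT', fun x c hc => ?_⟩
  · obtain ⟨NP, hNP⟩ := P.exists_hPow_le ht
    obtain ⟨NQ, hNQ⟩ := Q.exists_hPow_le ht
    obtain ⟨M, h1, h2, h3⟩ : ∃ M, NP ≤ M ∧ NQ ≤ M ∧ 1 ≤ M :=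
      ⟨NP + NQ + 1, by omega, by omega, by omega⟩
    obtain ⟨z, hz⟩ := hj.exists_hrep hT hι M c
    rw [hφ.envComul_of_hrep hj hχ h3 hz, ← tensorHom_eq_of_quotMap_eq hφ.map_algebraMap hP hQ
      ((approximates_iff.1 h).symm.trans (hT'.comul_spec (hNP M h1) (hNQ M h2) hz)), map_sum]
    rfl
  · obtain ⟨c', h1, h2⟩ := hφ.exists_cobracket hj hχ hd hι ht hT' hc
    refine ⟨c', h1, fun P Q hP hQ N u v h => ?_⟩
    rw [← h2 P Q hP hQ _ (approximates_iff.1 h), map_sum]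
    rfl

theorem IsQFSHA.isAugAdic {k F g : Type*} [Field k] [Ring F] [Algebra k⟦X⟧ F] [TopologicalSpace F]
    [LieRing g] [LieAlgebra k g] [Module.Finite k g] [LieBialgebra k g]
    {T : TopologicalHopfAlgebra k F} (hF : IsQFSHA T g) : IsAugAdic T := by
  obtain ⟨hW, ⟨n, π, hπ⟩, -⟩ := hF
  exact ⟨isOpen_augIdeal_pow hW hπ T, exists_augIdeal_pow_le hW hπ T,
    eq_zero_of_mem_augIdeal_pow hW hπ T⟩

theorem exists_formalSeries_equiv_of_coordinates {k F A H : Type*} [Field k] [Ring F]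
    [Algebra k⟦X⟧ F] [TopologicalSpace F] [Ring A] [Algebra k⟦X⟧ A] [Ring H] [Algebra k⟦X⟧ H]
    {T : TopologicalHopfAlgebra k F} {j : F →ₐ[k⟦X⟧] A} {ι : A →ₐ[k⟦X⟧] H} (hj : IsTimes T j)
    (hι : IsHCompletion ι) {n : ℕ} {π : F →+* MvPowerSeries (Fin n) k}
    (hπ : IsFormalCoordinates k π) {x : Fin n → F} (hx : ∀ i, π (x i) = MvPowerSeries.X i) :
    ∃ y : Fin n → H, (∀ i, (PowerSeries.X : k⟦X⟧) • y i = ι (j (x i))) ∧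
      ∃ e : FormalSeries (MvPolynomial (Fin n) k) ≃ₗ[k⟦X⟧] H,
        ∀ P N, e P - partialSum (k := k) (orderedEvalHom y) P N ∈ hPow k H N := by
  choose b hb using fun i => hj.exists_div (x i) (hπ.mem_augIdeal_of_X T (hx i))
  refine ⟨fun i => ι (b i), fun i => by rw [← map_smul, hb], ?_⟩
  refine exists_formalSeries_equiv hι.torsionFree hι.isHComplete _
    (fun c P => orderedEval_smul _ c P) (fun P hP => ?_) (fun c => ?_)
  · change orderedEval _ P ∈ _ at hP
    rw [← map_orderedEval] at hP
    exact hj.eq_zero_of_orderedEval_mem hπ hx hb P (hι.reflect _ _ hP)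
  · obtain ⟨a, ha⟩ := hι.dense c 1
    obtain ⟨P, hP⟩ := hj.exists_sub_orderedEval_mem hπ hx hb a
    have := algHom_mem_hPow ι hP
    rw [map_sub, map_orderedEval] at this
    exact ⟨P, sub_mem_hPow_trans ha this⟩

end QuantumDuality

end

open QuantumDuality in
theorem proposition3p2 {k : Type*} [Field k] {F : Type*} [Ring F] [Algebra k⟦X⟧ F]
    [TopologicalSpace F] {g : Type*} [LieRing g] [LieAlgebra k g] [Module.Finite k g]
    [LieBialgebra k g] (T : TopologicalHopfAlgebra k F) (hF : IsQFSHA T g) :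
    ∃ T' : TopologicalHopfAlgebra k (Vee T),
      IsHopfMorphism T T' (toVee T) ∧
      IsQUEA T' (LieDual k g) ∧
      ∀ (n : ℕ) (π : F →+* MvPowerSeries (Fin n) k), IsFormalCoordinates k π →
        ∀ x : Fin n → F, (∀ j, π (x j) = MvPowerSeries.X j) →
          ∃ y : Fin n → Vee T,
            (∀ j, (PowerSeries.X : k⟦X⟧) • y j = toVee T (x j)) ∧
            ∃ e : FormalSeries (MvPolynomial (Fin n) k) ≃ₗ[k⟦X⟧] Vee T,
              ∀ (P : FormalSeries (MvPolynomial (Fin n) k)) (N : ℕ),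
                e P - ∑ m ∈ Finset.range N,
                    (PowerSeries.X ^ m : k⟦X⟧) • orderedEval y (P.coeff m)
                  ∈ hPow k (Vee T) N := by
  have hW := hF.1
  have hT := hF.isAugAdic
  have hj := isTimes_times hW.torsionFree T
  obtain ⟨ι, hιj, hι⟩ : ∃ ι : Times T →ₐ[k⟦X⟧] Vee T,
      toVee T = ι.comp ((Algebra.TensorProduct.includeRight :
        F →ₐ[k⟦X⟧] LaurentSeries k ⊗[k⟦X⟧] F).codRestrict (Times T) (one_tmul_mem_times T)) ∧
      IsHCompletion (k := k) (A := Times T) (H := Vee T) ι := by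
    refine ⟨hCompletionOf k (Times T), rfl, ?_⟩
    exact isHCompletion_hCompletionOf hj.torsionFree
  obtain ⟨d, hd⟩ := exists_isDifferential hT hF
  obtain ⟨n, π, hπ⟩ := hF.2.1
  obtain ⟨T', hT'⟩ := hj.exists_isVeeHopf hT hι rfl
  rw [hιj]
  exact ⟨T', hT'.isHopfMorphism hj rfl hW.continuous_const_add,
    isQUEA_of_isVeeHopf rfl hj hι hπ hd hT',
    fun n π hπ x hx => exists_formalSeries_equiv_of_coordinates hj hι hπ hx⟩
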